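/- **Notation and model.** For real polynomials, $P \preceq Q$ means that $Q-P$ is a sum of squares of polynomials. A degree-$d$ pseudo-distribution $\{u\}$ over $\mathbb R^n$ is given by a linear operator $\tilde{\mathbb E}$ on the polynomials of degree at most $d$ in $u=(u_1,\dots,u_n)$ with $\tilde{\mathbb E}\,1=1$ and $\tilde{\mathbb E}\,P^2\ge 0$ whenever $\deg P\le d/2$. It satisfies the constraint $\{P=0\}$ if $\tilde{\mathbb E}\,PQ=0$ for all $Q$ with $\deg P+\deg Q\le d$. An algorithm is a program for a real random-access machine with unit-cost exact real arithmetic ($+,-,\times,\div,\sqrt{\ }$, comparison, rational constants), unit-cost index arithmetic (addition, truncated subtraction, comparison) and unit-cost sampling of independent standard Gaussian numbers. A pseudo-distribution is given to it as the list of the pseudo-expectations of all monomials up to its degree, and a polynomial as the list of its coefficients. **Theorem (refined sampling from pseudo-distributions).** There is an absolute constant $C\in\mathbb N$ such that for every integer $k\ge 1$ there is a randomized algorithm (depending only on $k$) with the following properties. Its input consists of $n\ge 1$, a degree-$2(1+2k)$ pseudo-distribution $\{u\}$ over $\mathbb R^n$ and a polynomial $W\in\mathbb R[u]$ of degree at most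 $2(1+k)$. It always halts after at most $(n+1)^{Ck}$ steps and outputs a unit vector $c'\in\mathbb R^n$. Let $0<\varepsilon\le 1$, $\tau\ge 0$, $M\in\mathbb R$, let $c\in\mathbb R^n$ be a unit vector, and suppose: * $W$ is drawn from a probability distribution over sums of squares of degree at most $2(1+k)$ whose mean $\bar W=\mathbb E_W W$ and second moment $\mathbb E_W W(u)W(u')$ exist (coefficient by coefficient) and satisfy, as polynomials in $u$ and in $(u,u')$ respectively, $$\langle c,u\rangle^{2(1+k)}\preceq \bar W\preceq\bigl(\langle c,u\rangle^2+\tau\|u\|_2^2\bigr)^{1+k},\qquad \mathbb E_W W(u)W(u')\preceq M\cdot\bar W(u)\,\bar W(u').$$ * $\{u\}$ is a degree-$2(1+2k)$ pseudo-distribution that satisfies the constraint $\|u\|_2^2=1$ and $$\tilde{\mathbb E}\,\langle c,u\rangle^{2(1+2k)}\ge e^{-\varepsilon k}\,\tilde{\mathbb E}\,\langle c,u\rangle^{2},\qquad \tilde{\mathbb E}\,\langle c,u\rangle^{2}\ge\tau^{k}.$$ Then, with probability at least $$\frac{\tau^2}{M\cdot 2^{Ck/\varepsilon^{C}}}$$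 over the choice of $W$ and the (independent) random numbers of the algorithm, the output on input $(n,\{u\},W)$ satisfies $$\langle c,c'\rangle^2\ge e^{-C\,(\varepsilon+3(1/k+1)\tau)}.$$ -/

import Mathlib

open MeasureTheory ProbabilityTheory

noncomputable section

namespace SOSSampling

/-! ### Sums of squares, pseudo-expectations, random polynomials -/

/-- The order `P ⪯ Q` on real polynomials: `Q - P` is a sum of squares of polynomials. -/
def SOSLe {σ : Type*} (P Q : MvPolynomial σ ℝ) : Prop := IsSumSq (Q - P)

/-- `L` is a degree-`d` pseudo-expectation operator on `ℝ[u]`: it is linear, `L 1 = 1`, and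
`L (P ^ 2) ≥ 0` whenever `deg P ≤ d / 2`. Only the values of `L` on polynomials of degree at most
`d` are ever used; a linear functional on that subspace always extends to all of `ℝ[u]`, so it is
no restriction to let `L` be defined everywhere. -/
structure IsPseudoExpectation {n : ℕ} (d : ℕ) (L : MvPolynomial (Fin n) ℝ →ₗ[ℝ] ℝ) : Prop where
  map_one : L 1 = 1
  map_sq_nonneg : ∀ P : MvPolynomial (Fin n) ℝ, 2 * P.totalDegree ≤ d → 0 ≤ L (P ^ 2)

/-- The degree-`d` pseudo-distribution with pseudo-expectation `L` satisfies the polynomial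
constraint `{P = 0}`: `L (P * Q) = 0` for all `Q` of degree at most `d - deg P`. -/
def SatisfiesConstraint {n : ℕ} (d : ℕ) (L : MvPolynomial (Fin n) ℝ →ₗ[ℝ] ℝ)
    (P : MvPolynomial (Fin n) ℝ) : Prop :=
  ∀ Q : MvPolynomial (Fin n) ℝ, P.totalDegree + Q.totalDegree ≤ d → L (P * Q) = 0

/-- The polynomial `⟨c, u⟩` in the indeterminates `u`. -/
def linForm {n : ℕ} (c : EuclideanSpace ℝ (Fin n)) : MvPolynomial (Fin n) ℝ :=
  ∑ i, MvPolynomial.C (c i) * MvPolynomial.X i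

/-- The polynomial `‖u‖₂²` in the indeterminates `u`. -/
def normSq (n : ℕ) : MvPolynomial (Fin n) ℝ := ∑ i, MvPolynomial.X i ^ 2

/-- The polynomial `P` is the expectation of the random polynomial `F`: every coefficient of `F`
is integrable, with mean the corresponding coefficient of `P`. -/
def IsMean {Ω σ : Type*} [MeasurableSpace Ω] (μ : Measure Ω) (F : Ω → MvPolynomial σ ℝ)
    (P : MvPolynomial σ ℝ) : Prop :=
  ∀ m : σ →₀ ℕ, Integrable (fun ω => (F ω).coeff m) μ ∧ ∫ ω, (F ω).coeff m ∂μ = P.coeff m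

/-- The polynomial `P(u)` in the indeterminates `(u, u')`. -/
def inU {n : ℕ} (P : MvPolynomial (Fin n) ℝ) : MvPolynomial (Fin n ⊕ Fin n) ℝ :=
  MvPolynomial.rename Sum.inl P

/-- The polynomial `P(u')` in the indeterminates `(u, u')`. -/
def inU' {n : ℕ} (P : MvPolynomial (Fin n) ℝ) : MvPolynomial (Fin n ⊕ Fin n) ℝ :=
  MvPolynomial.rename Sum.inr P

/-! ### Randomized real random-access machines

A program is a structured program over finitely many natural-number registers (used for counting
and addressing: constants, addition, truncated subtraction, comparison) and finitely many arrays of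
real numbers (rational constants, field operations, square root, comparison). One instruction
draws an independent standard Gaussian number. Each operation costs one step. -/

/-- Index expressions. -/
inductive NExpr where
  | const : ℕ → NExpr
  | reg : ℕ → NExpr
  | add : NExpr → NExpr → NExpr
  | sub : NExpr → NExpr → NExpr

/-- Real expressions; `cell a i` is the entry of the array `a` at the address `i`. -/
inductive RExpr where
  | const : ℚ → RExpr
  | cell : ℕ → NExpr → RExpr
  | add : RExpr → RExpr → RExpr
  | sub : RExpr → RExpr → RExpr
  | mul : RExpr → RExpr → RExpr
  | div : RExpr → RExpr → RExpr
  | sqrt : RExpr → RExpr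

/-- Tests. -/
inductive Test where
  | natLt : NExpr → NExpr → Test
  | realLt : RExpr → RExpr → Test

/-- Programs. -/
inductive Prog where
  | skip : Prog
  | setNat : ℕ → NExpr → Prog
  | setReal : ℕ → NExpr → RExpr → Prog
  | gauss : ℕ → NExpr → Prog
  | seq : Prog → Prog → Prog
  | ite : Test → Prog → Prog → Prog
  | while : Test → Prog → Prog

/-- A machine state: the registers, the arrays, and the number of Gaussians drawn so far. -/
structure State where
  nat : ℕ → ℕ
  real : ℕ → ℕ → ℝ
  drawn : ℕ

/-- The value of an index expression. -/
def NExpr.eval (s : State) : NExpr → ℕ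
  | .const c => c
  | .reg r => s.nat r
  | .add e f => e.eval s + f.eval s
  | .sub e f => e.eval s - f.eval s

/-- The number of steps for evaluating an index expression. -/
def NExpr.cost : NExpr → ℕ
  | .const _ => 1
  | .reg _ => 1
  | .add e f => e.cost + f.cost + 1
  | .sub e f => e.cost + f.cost + 1

/-- The value of a real expression (with `x / 0 = 0`, and `√x = 0` for `x < 0`). -/
def RExpr.eval (s : State) : RExpr → ℝ
  | .const q => (q : ℝ)
  | .cell a i => s.real a (i.eval s)
  | .add e f => e.eval s + f.eval s
  | .sub e f => e.eval s - f.eval s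
  | .mul e f => e.eval s * f.eval s
  | .div e f => e.eval s / f.eval s
  | .sqrt e => Real.sqrt (e.eval s)

/-- The number of steps for evaluating a real expression. -/
def RExpr.cost : RExpr → ℕ
  | .const _ => 1
  | .cell _ i => i.cost + 1
  | .add e f => e.cost + f.cost + 1
  | .sub e f => e.cost + f.cost + 1
  | .mul e f => e.cost + f.cost + 1
  | .div e f => e.cost + f.cost + 1
  | .sqrt e => e.cost + 1

/-- The truth value of a test. -/
def Test.holds (s : State) : Test → Prop
  | .natLt e f => e.eval s < f.eval s
  | .realLt e f => e.eval s < f.eval s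

/-- The number of steps for evaluating a test. -/
def Test.cost : Test → ℕ
  | .natLt e f => e.cost + f.cost + 1
  | .realLt e f => e.cost + f.cost + 1

/-- Write `v` into the register `r`. -/
def State.setNat (s : State) (r v : ℕ) : State :=
  { s with nat := Function.update s.nat r v }

/-- Write `v` into the array `a` at the address `i`. -/
def State.setReal (s : State) (a i : ℕ) (v : ℝ) : State :=
  { s with real := Function.update s.real a (Function.update (s.real a) i v) }

/-- `Exec g p s t s'`: on the random tape `g` (the `j`-th Gaussian drawn is `g j`), the program `p`
started in the state `s` halts after exactly `t` steps in the state `s'`. -/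
inductive Exec (g : ℕ → ℝ) : Prog → State → ℕ → State → Prop where
  | skip (s : State) : Exec g .skip s 1 s
  | setNat (s : State) (r : ℕ) (e : NExpr) :
      Exec g (.setNat r e) s (e.cost + 1) (s.setNat r (e.eval s))
  | setReal (s : State) (a : ℕ) (i : NExpr) (e : RExpr) :
      Exec g (.setReal a i e) s (i.cost + e.cost + 1) (s.setReal a (i.eval s) (e.eval s))
  | gauss (s : State) (a : ℕ) (i : NExpr) :
      Exec g (.gauss a i) s (i.cost + 1)
        { s.setReal a (i.eval s) (g s.drawn) with drawn := s.drawn + 1 }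
  | seq {p q : Prog} {s₁ s₂ s₃ : State} {t₁ t₂ : ℕ} :
      Exec g p s₁ t₁ s₂ → Exec g q s₂ t₂ s₃ → Exec g (.seq p q) s₁ (t₁ + t₂) s₃
  | iteTrue {b : Test} {p q : Prog} {s s' : State} {t : ℕ} :
      b.holds s → Exec g p s t s' → Exec g (.ite b p q) s (b.cost + t) s'
  | iteFalse {b : Test} {p q : Prog} {s s' : State} {t : ℕ} :
      ¬ b.holds s → Exec g q s t s' → Exec g (.ite b p q) s (b.cost + t) s'
  | whileDone {b : Test} {p : Prog} {s : State} :
      ¬ b.holds s → Exec g (.while b p) s b.cost s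
  | whileStep {b : Test} {p : Prog} {s₁ s₂ s₃ : State} {t₁ t₂ : ℕ} :
      b.holds s₁ → Exec g p s₁ t₁ s₂ → Exec g (.while b p) s₂ t₂ s₃ →
        Exec g (.while b p) s₁ (b.cost + t₁ + t₂) s₃

/-- Runs are unique: the halting time and the final state are functions of the initial state and
of the random tape. -/
theorem Exec.unique {g : ℕ → ℝ} {p : Prog} {s s₁ : State} {t₁ : ℕ} (h₁ : Exec g p s t₁ s₁) :
    ∀ {t₂ : ℕ} {s₂ : State}, Exec g p s t₂ s₂ → t₁ = t₂ ∧ s₁ = s₂ := by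
  induction h₁ with
  | skip s => intro _ _ h; cases h; exact ⟨rfl, rfl⟩
  | setNat s r e => intro _ _ h; cases h; exact ⟨rfl, rfl⟩
  | setReal s a i e => intro _ _ h; cases h; exact ⟨rfl, rfl⟩
  | gauss s a i => intro _ _ h; cases h; exact ⟨rfl, rfl⟩
  | seq _ _ ih₁ ih₂ =>
    intro _ _ h
    cases h with
    | seq ha hb =>
      obtain ⟨rfl, rfl⟩ := ih₁ ha
      obtain ⟨rfl, rfl⟩ := ih₂ hb
      exact ⟨rfl, rfl⟩
  | iteTrue hb _ ih =>
    intro _ _ h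
    cases h with
    | iteTrue _ ha => obtain ⟨rfl, rfl⟩ := ih ha; exact ⟨rfl, rfl⟩
    | iteFalse hn _ => exact absurd hb hn
  | iteFalse hb _ ih =>
    intro _ _ h
    cases h with
    | iteTrue hp _ => exact absurd hp hb
    | iteFalse _ ha => obtain ⟨rfl, rfl⟩ := ih ha; exact ⟨rfl, rfl⟩
  | whileDone hb =>
    intro _ _ h
    cases h with
    | whileDone _ => exact ⟨rfl, rfl⟩
    | whileStep hp _ _ => exact absurd hp hb
  | whileStep hb _ _ ih₁ ih₂ =>
    intro _ _ h
    cases h with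
    | whileDone hn => exact absurd hb hn
    | whileStep _ ha hc =>
      obtain ⟨rfl, rfl⟩ := ih₁ ha
      obtain ⟨rfl, rfl⟩ := ih₂ hc
      exact ⟨rfl, rfl⟩

/-- The law of the random tape: independent standard Gaussians. -/
def tapeLaw : Measure (ℕ → ℝ) := Measure.infinitePi fun _ : ℕ => gaussianReal 0 1

/-! ### Input and output

A monomial of degree at most `d` in `u₁, …, uₙ` is written as a product of `d` factors from the
list `1, u₁, …, uₙ`, that is, as a word of length `d` over `{0, …, n}`; the word is used, read as a
number in base `n + 1`, as an address in an array of length `(n + 1) ^ d`. -/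

/-- The exponent vector of the monomial of a word over `{0, …, n}`. -/
def wordExponent {n d : ℕ} (t : Fin d → Fin (n + 1)) : Fin n →₀ ℕ :=
  ∑ j, Fin.cases (0 : Fin n →₀ ℕ) (fun i => Finsupp.single i 1) (t j)

/-- The array that lists a quantity `f` depending on a monomial of degree at most `d`. -/
def monomialArray (n d : ℕ) (f : (Fin n →₀ ℕ) → ℝ) (a : ℕ) : ℝ :=
  if h : a < (n + 1) ^ d then f (wordExponent (finFunctionFinEquiv.symm ⟨a, h⟩)) else 0

/-- The list of the pseudo-expectations of all monomials of degree at most `d`. -/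
def momentArray {n : ℕ} (d : ℕ) (L : MvPolynomial (Fin n) ℝ →ₗ[ℝ] ℝ) : ℕ → ℝ :=
  monomialArray n d fun m => L (MvPolynomial.monomial m 1)

/-- The list of the coefficients of `P` at all monomials of degree at most `d`. -/
def coeffArray {n : ℕ} (d : ℕ) (P : MvPolynomial (Fin n) ℝ) : ℕ → ℝ :=
  monomialArray n d fun m => P.coeff m

/-- The initial state: `n` is in register `0`, the two input lists are in the arrays `0` and `1`,
and everything else is zero. -/
def initState (n : ℕ) (x y : ℕ → ℝ) : State where
  nat := fun r => if r = 0 then n else 0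
  real := fun a => if a = 0 then x else if a = 1 then y else fun _ => 0
  drawn := 0

/-- The output vector in `ℝⁿ`: the first `n` entries of the array `2`. -/
def output (n : ℕ) (s : State) : EuclideanSpace ℝ (Fin n) :=
  WithLp.toLp 2 fun i : Fin n => s.real 2 i

end SOSSampling

end

/-! Write `p = ⟨c,u⟩²`, `k = m + 1`, `θ = ε + 3(1/k + 1)τ`, and let `L` be the pseudo-expectation.
The algorithm draws Gaussian vectors `ξ_0, …, ξ_m`, forms the weight `G = W · ∏_{l ≥ 1} ⟨ξ_l,u⟩²`
and normalizes `A ξ_0`, where `A` is the matrix `L(G u uᵀ)`. The degree `2(1+k) + 2m + 2 = 2(1+2k)`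
uses exactly the available moments.

Why the weights concentrate `u` around `c`: restrict to the event that every `⟨c,ξ_l⟩` with `l ≥ 1`
lies in `[R, R+1]`, whose probability is still affordable. There `⟨ξ_l,u⟩²` averages to a multiple
of `q = p + δ(‖u‖² - p)` with `δ ≤ 1/R`, so `G` averages to a multiple of `W̄ q^m`. The hypotheses
give `L(W̄ p^k) ≥ L(p^(1+2k)) ≥ e^(-εk) L p ≥ e^(-θk) L W̄`. Hence `b_j = L(W̄ q^j)` loses at most
`e^(-θk)` in `k` steps. By Cauchy–Schwarz it is log-convex, so its smallest ratios come first and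
the last one is at least `e^(-θ)`. This says that under the weight `W̄ q^m` the average of `p` is at
least `e^(-θ) - δ` (`mean_weight_bounds`).

From averages to probabilities: `measure_lt_ge_of_moments` is a Paley–Zygmund inequality with a free
parameter `l`; being linear in the moments, it can still be integrated over `W`. The second moment
over the Gaussians costs a factor `gaussFourth ^ m`. The one over `W` costs `M`: the hypothesis on
`E W(u)W(u')` is evaluated by `L ⊗ L`, which is nonnegative on sums of squares by the Schur product
theorem (`tensorSquare_sq_nonneg`). So `L(Gp) > e^(-3θ) L G` has probability at least
`e^(-O(k/ε²))/M`. Then `E⟨c,Aξ_0⟩² = ‖Ac‖² ≥ L(Gp)²`, while `E‖Aξ_0‖²` is the squared Frobenius norm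
of `A`, at most `(tr A)² = (L G)²`; the same inequality yields correlation `e^(-7θ)`
(`stdGaussian_close_ge`).

The program evaluates `A ξ_0` by brute force over all words of length `4k + 2` in the letters `1,
u_1, …, u_n`, with an odometer whose digits sit in registers (`rawVector_eq`, `sampler_exec`). -/

namespace SOSSampling

/-! ### Executing loop-free programs and loops -/

/-- Programs without loops. -/
def Prog.LoopFree : Prog → Prop
  | .seq p q => p.LoopFree ∧ q.LoopFree
  | .ite _ p q => p.LoopFree ∧ q.LoopFree
  | .while _ _ => False
  | _ => True

/-- A bound for the running time of a loop-free program. -/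
def Prog.size : Prog → ℕ
  | .skip => 1
  | .setNat _ e => e.cost + 1
  | .setReal _ i e => i.cost + e.cost + 1
  | .gauss _ i => i.cost + 1
  | .seq p q => p.size + q.size
  | .ite b p q => b.cost + (p.size + q.size)
  | .while _ _ => 0

open Classical in
/-- The final state of a loop-free program. -/
noncomputable def Prog.step (g : ℕ → ℝ) : Prog → State → State
  | .skip, s => s
  | .setNat r e, s => s.setNat r (e.eval s)
  | .setReal a i e, s => s.setReal a (i.eval s) (e.eval s)
  | .gauss a i, s => { s.setReal a (i.eval s) (g s.drawn) with drawn := s.drawn + 1 }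
  | .seq p q, s => q.step g (p.step g s)
  | .ite b p q, s => if b.holds s then p.step g s else q.step g s
  | .while _ _, s => s

theorem Prog.step_seq (g : ℕ → ℝ) (p q : Prog) (s : State) :
    (Prog.seq p q).step g s = q.step g (p.step g s) := rfl

theorem Prog.step_setNat (g : ℕ → ℝ) (r : ℕ) (e : NExpr) (s : State) :
    (Prog.setNat r e).step g s = s.setNat r (e.eval s) := rfl

theorem Prog.step_ite_of_holds {g : ℕ → ℝ} {b : Test} {p q : Prog} {s : State} (h : b.holds s) :
    (Prog.ite b p q).step g s = p.step g s := if_pos h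

theorem Prog.step_ite_of_not_holds {g : ℕ → ℝ} {b : Test} {p q : Prog} {s : State}
    (h : ¬ b.holds s) : (Prog.ite b p q).step g s = q.step g s := if_neg h

theorem Prog.LoopFree.exec {g : ℕ → ℝ} {p : Prog} (hp : p.LoopFree) (s : State) :
    ∃ t ≤ p.size, Exec g p s t (p.step g s) := by
  induction p generalizing s with
  | skip => exact ⟨_, le_rfl, .skip s⟩
  | setNat r e => exact ⟨_, le_rfl, .setNat s r e⟩
  | setReal a i e => exact ⟨_, le_rfl, .setReal s a i e⟩
  | gauss a i => exact ⟨_, le_rfl, .gauss s a i⟩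
  | seq p q ihp ihq =>
    obtain ⟨t₁, h₁, e₁⟩ := ihp hp.1 s
    obtain ⟨t₂, h₂, e₂⟩ := ihq hp.2 (p.step g s)
    exact ⟨_, add_le_add h₁ h₂, .seq e₁ e₂⟩
  | ite b p q ihp ihq =>
    by_cases hb : b.holds s
    · obtain ⟨t₁, h₁, e₁⟩ := ihp hp.1 s
      refine ⟨b.cost + t₁, by simp only [Prog.size]; omega, ?_⟩
      simp only [Prog.step, if_pos hb]
      exact .iteTrue hb e₁
    · obtain ⟨t₁, h₁, e₁⟩ := ihq hp.2 s
      refine ⟨b.cost + t₁, by simp only [Prog.size]; omega, ?_⟩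
      simp only [Prog.step, if_neg hb]
      exact .iteFalse hb e₁
  | _ => exact hp.elim

/-- A loop with loop-free body that runs through the states `S 0, …, S K`. -/
theorem Exec.while_of_states {g : ℕ → ℝ} {b : Test} {p : Prog} (hp : p.LoopFree) (K : ℕ)
    (S : ℕ → State) (hb : ∀ i < K, b.holds (S i)) (hK : ¬ b.holds (S K))
    (hS : ∀ i < K, p.step g (S i) = S (i + 1)) :
    ∃ t ≤ K * (b.cost + p.size) + b.cost, Exec g (.while b p) (S 0) t (S K) := by
  induction K generalizing S with
  | zero => exact ⟨b.cost, by simp, .whileDone hK⟩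
  | succ K ih =>
    obtain ⟨t₂, h₂, e₂⟩ := ih (fun i => S (i + 1)) (fun i hi => hb _ (by omega)) hK
      (fun i hi => hS _ (by omega))
    obtain ⟨t₁, h₁, e₁⟩ := hp.exec (g := g) (S 0)
    rw [hS 0 (by omega)] at e₁
    refine ⟨b.cost + t₁ + t₂, ?_, .whileStep (hb 0 (by omega)) e₁ e₂⟩
    rw [Nat.succ_mul]; omega

/-! ### The program -/

/-- Draw one entry of each of the Gaussian vectors `0, …, l - 1`. -/
def drawEntries : ℕ → Prog
  | 0 => .skip
  | l + 1 => .seq (drawEntries l) (.gauss (10 + l) (.reg 1))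

/-- Draw `k` Gaussian vectors. -/
def drawVectors (k : ℕ) : Prog :=
  .while (.natLt (.reg 1) (.reg 0))
    -- The register is increased before drawing: entries occupy the addresses `1, …, n`, and address
    -- `0`, belonging to the letter `1`, keeps the value `0`.
    (.seq (.setNat 1 (.add (.reg 1) (.const 1))) (drawEntries k))

/-- The summand of the current word, with the factors of the digits `1, …, j`. -/
def summandExpr : ℕ → RExpr
  -- Register `2` holds the code of the whole word, the address of a moment; register `3` holds the
  -- code of its upper digits, the address of a coefficient of `W`.
  | 0 => .mul (.cell 1 (.reg 3)) (.cell 0 (.reg 2))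
  -- Digit `0` selects the output coordinate, digit `1` belongs to Gaussian vector `0`, and digits
  -- `2l` and `2l + 1` to vector `l`, which therefore enters squared.
  | j + 1 => .mul (summandExpr j) (.cell (10 + (j + 1) / 2) (.reg (10 + (j + 1))))

/-- Add the summand of the current word to the entry of the first digit, unless one of the `i`
digits after digit `b` is smaller than its predecessor. -/
def addIfSorted (b j : ℕ) : ℕ → Prog
  | 0 => .setReal 4 (.reg 10) (.add (.cell 4 (.reg 10)) (summandExpr j))
  | i + 1 => .ite (.natLt (.reg (10 + (b + i + 1))) (.reg (10 + (b + i)))) .skip (addIfSorted b j i)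

/-- Increase the odometer at digit `j`, with `f` more digits above; the number formed by the digits
from `b` on is also kept in register `3`. -/
def increment (b : ℕ) : ℕ → ℕ → Prog
  | j, 0 => .setNat (10 + j) (.add (.reg (10 + j)) (.const 1))
  | j, f + 1 => .seq (.setNat (10 + j) (.add (.reg (10 + j)) (.const 1)))
      (.ite (.natLt (.reg 0) (.reg (10 + j)))
        (.seq (.setNat (10 + j) (.const 0))
          (.seq (if j + 1 = b then .setNat 3 (.add (.reg 3) (.const 1)) else .skip)
            (increment b (j + 1) f)))
        .skip)

/-- Sum over all words. -/
def sumWords (k : ℕ) : Prog :=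
  -- Digit `4k + 2` lies above the word; it becomes `1` exactly when all words are exhausted.
  .while (.natLt (.reg (10 + (4 * k + 2))) (.const 1))
    (.seq (addIfSorted (2 * k) (2 * k - 1) (2 * k + 1))
      (.seq (.setNat 2 (.add (.reg 2) (.const 1))) (increment (2 * k) 0 (4 * k + 2))))

/-- Compute the squared norm of the vector in array `4`. -/
def sumSquares : Prog :=
  -- Register `1` still holds `n` from the drawing loop; counting down leaves it at `0` for
  -- `writeOutput`.
  .while (.natLt (.const 0) (.reg 1))
    (.seq (.setReal 5 (.const 0) (.add (.cell 5 (.const 0))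
        (.mul (.cell 4 (.reg 1)) (.cell 4 (.reg 1)))))
      (.setNat 1 (.sub (.reg 1) (.const 1))))

/-- Write the normalized vector into array `2`. -/
def writeOutput : Prog :=
  .ite (.realLt (.const 0) (.cell 5 (.const 0)))
    (.while (.natLt (.reg 1) (.reg 0))
      (.seq (.setReal 2 (.reg 1) (.div (.cell 4 (.add (.reg 1) (.const 1)))
          (.sqrt (.cell 5 (.const 0)))))
        (.setNat 1 (.add (.reg 1) (.const 1)))))
    -- A zero vector cannot be normalized; the first basis vector is returned, so that the output is
    -- always a unit vector.
    (.setReal 2 (.const 0) (.const 1))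

/-- The sampling algorithm. -/
def sampler (k : ℕ) : Prog :=
  .seq (drawVectors k) (.seq (sumWords k) (.seq sumSquares writeOutput))

/-! ### Correctness of the program -/

/-- The `j`-th digit of `c` in base `N`. -/
def digit (N c j : ℕ) : ℕ := c / N ^ j % N

/-- The `l`-th Gaussian vector, with entries `1, …, n`. -/
def drawnVector (k : ℕ) (g : ℕ → ℝ) (l j : ℕ) : ℝ := if 1 ≤ j then g ((j - 1) * k + l) else 0

/-- The summand of the word with code `c`. -/
noncomputable def summand (N k : ℕ) (x y g : ℕ → ℝ) (c : ℕ) : ℝ :=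
  y (c / N ^ (2 * k)) * x c *
    ∏ j ∈ Finset.Icc 1 (2 * k - 1), drawnVector k g (j / 2) (digit N c j)

/-- The digits `2 * k, …, 4 * k + 1` are increasing. -/
def SortedCode (N k c : ℕ) : Prop :=
  ∀ i < 2 * k + 1, digit N c (2 * k + i) ≤ digit N c (2 * k + i + 1)

open Classical in
/-- The sum over the codes below `K` of words that start with `a`. -/
noncomputable def partialVector (N k : ℕ) (x y g : ℕ → ℝ) (K a : ℕ) : ℝ :=
  ∑ c ∈ Finset.range K, if digit N c 0 = a ∧ SortedCode N k c then summand N k x y g c else 0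

/-- The arrays after `i` entries of each of `k` Gaussian vectors, and one more entry of the first `l`
vectors, have been drawn. -/
noncomputable def drawArrays (k : ℕ) (x y g : ℕ → ℝ) (i l a b : ℕ) : ℝ :=
  if a = 0 then x b else if a = 1 then y b else
    if 10 ≤ a ∧ a < 10 + k ∧ (b ≤ i ∨ b = i + 1 ∧ a < 10 + l) then drawnVector k g (a - 10) b else 0

/-- The registers while the Gaussian vectors are drawn. -/
def drawRegs (n i r : ℕ) : ℕ := if r = 0 then n else if r = 1 then i else 0

theorem drawEntries_loopFree (l : ℕ) : (drawEntries l).LoopFree := by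
  induction l with
  | zero => trivial
  | succ l ih => exact ⟨ih, trivial⟩

theorem drawEntries_size (l : ℕ) : (drawEntries l).size = 2 * l + 1 := by
  induction l with
  | zero => rfl
  | succ l ih => simp only [drawEntries, Prog.size, ih, NExpr.cost]; ring

theorem drawEntries_step (n k : ℕ) (x y g : ℕ → ℝ) (i l : ℕ) (hl : l ≤ k) :
    (drawEntries l).step g ⟨drawRegs n (i + 1), drawArrays k x y g i 0, i * k⟩ =
      ⟨drawRegs n (i + 1), drawArrays k x y g i l, i * k + l⟩ := by
  induction l with
  | zero => rfl
  | succ l ih =>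
    rw [drawEntries, Prog.step, ih (by omega)]
    simp only [Prog.step, State.setReal, NExpr.eval, State.mk.injEq]
    refine ⟨trivial, ?_, by ring⟩
    funext a b
    have hr : drawRegs n (i + 1) 1 = i + 1 := by simp [drawRegs]
    rw [hr]
    by_cases ha : a = 10 + l
    · subst ha
      rw [Function.update_self]
      by_cases hb : b = i + 1
      · subst hb
        rw [Function.update_self]
        have : 10 + l < 10 + k := by omega
        have h1 : 10 + l ≠ 1 := by omega
        simp [drawArrays, drawnVector, this, h1]
      · rw [Function.update_of_ne hb]
        simp [drawArrays, hb]
    · rw [Function.update_of_ne ha]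
      have : (a < 10 + (l + 1)) ↔ (a < 10 + l) := by omega
      simp [drawArrays, this]

theorem drawArrays_row (k : ℕ) (x y g : ℕ → ℝ) (i : ℕ) :
    drawArrays k x y g i k = drawArrays k x y g (i + 1) 0 := by
  funext a b
  have : (10 ≤ a ∧ a < 10 + k ∧ (b ≤ i ∨ b = i + 1 ∧ a < 10 + k)) ↔
      (10 ≤ a ∧ a < 10 + k ∧ (b ≤ i + 1 ∨ b = i + 1 + 1 ∧ a < 10 + 0)) := by omega
  simp only [drawArrays, this]

theorem drawVectors_exec (n k : ℕ) (x y g : ℕ → ℝ) :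
    ∃ t ≤ n * (2 * k + 8) + 3, Exec g (drawVectors k) (initState n x y) t
      ⟨drawRegs n n, drawArrays k x y g n 0, n * k⟩ := by
  have h0 : initState n x y = ⟨drawRegs n 0, drawArrays k x y g 0 0, 0 * k⟩ := by
    simp only [initState, State.mk.injEq]
    refine ⟨by funext r; simp [drawRegs], ?_, by simp⟩
    funext a b
    -- `drawArrays` counts address `0` as drawn from the start; this is consistent because
    -- `drawnVector` vanishes there.
    rcases eq_or_ne b 0 with rfl | hb
    · by_cases h0 : a = 0
      · simp [drawArrays, h0]
      · by_cases h1 : a = 1 <;> simp [drawArrays, drawnVector, h0, h1]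
    · have : ¬ (10 ≤ a ∧ a < 10 + k ∧ (b ≤ 0 ∨ b = 0 + 1 ∧ a < 10 + 0)) := by omega
      by_cases h0 : a = 0
      · simp [drawArrays, h0]
      · by_cases h1 : a = 1
        · simp [drawArrays, h1]
        · simp only [drawArrays, h0, h1, this, if_false]
  rw [h0]
  obtain ⟨t, ht, he⟩ := Exec.while_of_states (g := g) (b := .natLt (.reg 1) (.reg 0))
    (p := .seq (.setNat 1 (.add (.reg 1) (.const 1))) (drawEntries k))
    ⟨trivial, drawEntries_loopFree k⟩ n
    (fun i => ⟨drawRegs n i, drawArrays k x y g i 0, i * k⟩)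
    (fun i hi => by simpa [Test.holds, NExpr.eval, drawRegs] using hi)
    (by simp [Test.holds, NExpr.eval, drawRegs])
    (fun i _ => by
      have hu : Function.update (drawRegs n i) 1 (drawRegs n i 1 + 1) = drawRegs n (i + 1) := by
        funext r
        by_cases hr : r = 1
        · subst hr; simp [drawRegs]
        · simp [drawRegs, hr]
      simp only [Prog.step, State.setNat, NExpr.eval, hu]
      rw [drawEntries_step n k x y g i k le_rfl, drawArrays_row]
      simp [Nat.succ_mul])
  refine ⟨t, ht.trans (le_of_eq ?_), he⟩
  simp only [Test.cost, NExpr.cost, Prog.size, drawEntries_size]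
  ring

/-! ### The odometer -/

/-- The registers in the main loop at the code `c`. -/
def codeRegs (n k c r : ℕ) : ℕ :=
  if r = 0 then n else if r = 1 then n else if r = 2 then c else if r = 3 then
    c / (n + 1) ^ (2 * k) else if 10 ≤ r ∧ r ≤ 10 + (4 * k + 2) then digit (n + 1) c (r - 10) else 0

/-- The registers while the code `c` is increased, after the digits below `j` are updated. -/
def carryRegs (n k c j r : ℕ) : ℕ :=
  if r = 2 then c + 1 else if r = 3 then (if j < 2 * k then c else c + 1) / (n + 1) ^ (2 * k)
  else if 10 ≤ r ∧ r < 10 + j then codeRegs n k (c + 1) r else codeRegs n k c r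

theorem increment_loopFree (b j f : ℕ) : (increment b j f).LoopFree := by
  induction f generalizing j with
  | zero => trivial
  | succ f ih =>
    refine ⟨trivial, ⟨trivial, ?_, ih _⟩, trivial⟩
    split_ifs <;> trivial

theorem increment_size (b j f : ℕ) : (increment b j f).size ≤ 15 * f + 4 := by
  induction f generalizing j with
  | zero => simp [increment, Prog.size, NExpr.cost]
  | succ f ih =>
    have := ih (j + 1)
    simp only [increment, Prog.size, NExpr.cost, Test.cost]
    split_ifs <;> simp only [Prog.size, NExpr.cost] <;> omega

theorem div_succ_of_not_dvd {N c i : ℕ} (h : ¬ N ^ i ∣ c + 1) : (c + 1) / N ^ i = c / N ^ i := by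
  rw [Nat.succ_div, if_neg h, add_zero]

theorem div_succ_of_dvd {N c i : ℕ} (h : N ^ i ∣ c + 1) : (c + 1) / N ^ i = c / N ^ i + 1 := by
  rw [Nat.succ_div, if_pos h]

/-- The carry of `c + 1` reaches digit `j` iff `(n + 1) ^ j ∣ c + 1`; in that case the quotient
grows by one, and the carry goes on iff the digit was maximal. -/
theorem pow_succ_dvd_iff_digit {n c j : ℕ} (h : (n + 1) ^ j ∣ c + 1) :
    (n + 1) ^ (j + 1) ∣ c + 1 ↔ digit (n + 1) c j = n := by
  have hpos : 0 < (n + 1) ^ j := by positivity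
  have key : (n + 1) ^ (j + 1) ∣ c + 1 ↔ (n + 1) ∣ c / (n + 1) ^ j + 1 := by
    rw [← div_succ_of_dvd h]
    obtain ⟨e, he⟩ := h
    rw [he, Nat.mul_div_cancel_left _ hpos, pow_succ]
    exact Nat.mul_dvd_mul_iff_left hpos
  rw [key, digit, Nat.dvd_iff_mod_eq_zero]
  have hlt : c / (n + 1) ^ j % (n + 1) < n + 1 := Nat.mod_lt _ (Nat.succ_pos n)
  rw [Nat.add_mod]
  constructor
  · intro h0
    by_contra hne
    rcases Nat.eq_zero_or_pos n with rfl | hn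
    · omega
    · rw [Nat.mod_eq_of_lt (a := 1) (by omega), Nat.mod_eq_of_lt (by omega)] at h0
      omega
  · intro h0
    rw [h0]
    rcases Nat.eq_zero_or_pos n with rfl | hn
    · rfl
    · rw [Nat.mod_eq_of_lt (a := 1) (by omega), Nat.mod_self]

theorem carryRegs_digit {n k c j : ℕ} (hj : j ≤ 4 * k + 2) :
    carryRegs n k c j (10 + j) = digit (n + 1) c j := by
  simp only [carryRegs, codeRegs]
  rw [if_neg (by omega), if_neg (by omega), if_neg (by omega), if_neg (by omega),
    if_neg (by omega), if_neg (by omega), if_neg (by omega), if_pos (by omega)]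
  congr 1; omega

/-- Once the carry stops at `j`, no higher power of `n + 1` divides `c + 1`, so all higher quotients
are unchanged, including the one in register `3` when `j < 2k`. -/
theorem carryRegs_stop {n k c j : ℕ} (hjk : j ≤ 4 * k + 2) (hj : (n + 1) ^ j ∣ c + 1)
    (hne : digit (n + 1) c j ≠ n) :
    Function.update (carryRegs n k c j) (10 + j) (digit (n + 1) c j + 1)
      = codeRegs n k (c + 1) := by
  have hnd : ¬ (n + 1) ^ (j + 1) ∣ c + 1 := fun h => hne ((pow_succ_dvd_iff_digit hj).1 h)
  have hup : ∀ i, j < i → (c + 1) / (n + 1) ^ i = c / (n + 1) ^ i := fun i hi =>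
    div_succ_of_not_dvd fun h => hnd ((pow_dvd_pow _ hi).trans h)
  have hlt : digit (n + 1) c j < n + 1 := Nat.mod_lt _ (Nat.succ_pos n)
  funext r
  by_cases hr : r = 10 + j
  · subst hr
    rw [Function.update_self]
    simp only [codeRegs]
    rw [if_neg (by omega), if_neg (by omega), if_neg (by omega), if_neg (by omega),
      if_pos (by omega), show 10 + j - 10 = j by omega]
    rw [digit] at hne hlt
    rw [digit, digit, div_succ_of_dvd hj, Nat.add_mod (c / (n + 1) ^ j) 1,
      Nat.mod_eq_of_lt (a := 1) (by omega), Nat.mod_eq_of_lt (a := _ + 1) (by omega)]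
  · rw [Function.update_of_ne hr]
    simp only [carryRegs]
    by_cases h2 : r = 2
    · simp [codeRegs, h2]
    rw [if_neg h2]
    by_cases h3 : r = 3
    · rw [if_pos h3]
      by_cases hjk : j < 2 * k
      · rw [if_pos hjk]
        simp [codeRegs, h3, hup _ hjk]
      · rw [if_neg hjk]
        simp [codeRegs, h3]
    rw [if_neg h3]
    split_ifs with h
    · rfl
    · simp only [codeRegs, if_neg h2, if_neg h3]
      by_cases h0 : r = 0
      · simp [h0]
      by_cases h1 : r = 1
      · simp [h1]
      rw [if_neg h0, if_neg h1, if_neg h0, if_neg h1]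
      by_cases h10 : 10 ≤ r ∧ r ≤ 10 + (4 * k + 2)
      · rw [if_pos h10, if_pos h10, digit, digit, hup _ (by omega)]
      · rw [if_neg h10, if_neg h10]

theorem increment_step {n k c : ℕ} (g : ℕ → ℝ) (R : ℕ → ℕ → ℝ) (d : ℕ) (f j : ℕ)
    (hf : j + f = 4 * k + 2) (hc : c + 1 ≤ (n + 1) ^ (4 * k + 2)) (hn : 1 ≤ n)
    (hj : (n + 1) ^ j ∣ c + 1) :
    (increment (2 * k) j f).step g ⟨carryRegs n k c j, R, d⟩ = ⟨codeRegs n k (c + 1), R, d⟩ := by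
  induction f generalizing j with
  | zero =>
    simp only [increment, Prog.step, State.setNat, NExpr.eval, carryRegs_digit (show j ≤ 4 * k + 2 by omega)]
    rw [carryRegs_stop (by omega) hj]
    -- A carry out of the top digit would give `(n + 1) ^ (4k + 3) ≤ c + 1`, beyond the range of
    -- codes.
    intro hd
    have h1 := Nat.le_of_dvd (Nat.succ_pos c) ((pow_succ_dvd_iff_digit hj).2 hd)
    have h2 : (n + 1) ^ j < (n + 1) ^ (j + 1) := Nat.pow_lt_pow_right (by omega) (by omega)
    have h3 : j = 4 * k + 2 := by omega
    subst h3
    omega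
  | succ f ih =>
    have hdig := carryRegs_digit (n := n) (c := c) (show j ≤ 4 * k + 2 by omega)
    have h0 : Function.update (carryRegs n k c j) (10 + j) (digit (n + 1) c j + 1) 0 = n := by
      rw [Function.update_of_ne (by omega)]
      simp [carryRegs, codeRegs]
    have hlt : digit (n + 1) c j < n + 1 := Nat.mod_lt _ (Nat.succ_pos n)
    by_cases hd : digit (n + 1) c j = n
    · have hb : (Test.natLt (.reg 0) (.reg (10 + j))).holds
          ⟨Function.update (carryRegs n k c j) (10 + j) (carryRegs n k c j (10 + j) + 1), R, d⟩ := by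
        simp only [Test.holds, NExpr.eval, hdig, h0, Function.update_self]
        omega
      have hj' := (pow_succ_dvd_iff_digit hj).2 hd
      rw [increment, Prog.step_seq, Prog.step_setNat]
      simp only [State.setNat, NExpr.eval]
      rw [Prog.step_ite_of_holds hb, Prog.step_seq, Prog.step_seq, Prog.step_setNat]
      simp only [State.setNat, NExpr.eval, Function.update_idem]
      have hdig0 : digit (n + 1) (c + 1) j = 0 := by
        obtain ⟨e, he⟩ := hj'
        rw [digit, he, pow_succ, mul_assoc, Nat.mul_div_cancel_left _ (by positivity),
          Nat.mul_mod_right]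
      have hfin : (Prog.step g (if j + 1 = 2 * k then Prog.setNat 3 (.add (.reg 3) (.const 1))
          else .skip) ⟨Function.update (carryRegs n k c j) (10 + j) 0, R, d⟩) =
          ⟨carryRegs n k c (j + 1), R, d⟩ := by
        have hr3 : ∀ r, r ≠ 3 → Function.update (carryRegs n k c j) (10 + j) 0 r =
            carryRegs n k c (j + 1) r := by
          intro r h3
          by_cases hr : r = 10 + j
          · subst hr
            rw [Function.update_self]
            simp only [carryRegs, codeRegs]
            rw [if_neg (by omega), if_neg (by omega), if_pos (by omega), if_neg (by omega),
              if_neg (by omega), if_neg (by omega), if_neg (by omega), if_pos (by omega),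
              show 10 + j - 10 = j by omega, hdig0]
          · rw [Function.update_of_ne hr]
            have : (10 ≤ r ∧ r < 10 + (j + 1)) ↔ (10 ≤ r ∧ r < 10 + j) := by omega
            simp only [carryRegs, this, if_neg h3]
        -- The upper code in register `3` increases exactly when the carry enters digit `2k`.
        split_ifs with hjk
        · simp only [Prog.step, State.setNat, NExpr.eval, State.mk.injEq, and_true]
          funext r
          by_cases h3 : r = 3
          · subst h3
            rw [Function.update_self, Function.update_of_ne (by omega)]
            simp only [carryRegs]
            rw [hjk] at hj'
            simp [show j < 2 * k by omega, show ¬ (j + 1 < 2 * k) by omega,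
              div_succ_of_dvd hj']
          · rw [Function.update_of_ne h3, hr3 r h3]
        · simp only [Prog.step, State.mk.injEq, and_true]
          funext r
          by_cases h3 : r = 3
          · subst h3
            rw [Function.update_of_ne (by omega)]
            have : (j + 1 < 2 * k) ↔ (j < 2 * k) := by omega
            simp [carryRegs, this]
          · exact hr3 r h3
      rw [hfin]
      exact ih (j + 1) (by omega) hj'
    · have hb : ¬ (Test.natLt (.reg 0) (.reg (10 + j))).holds
          ⟨Function.update (carryRegs n k c j) (10 + j) (carryRegs n k c j (10 + j) + 1), R, d⟩ := by
        simp only [Test.holds, NExpr.eval, hdig, h0, Function.update_self]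
        omega
      rw [increment, Prog.step_seq, Prog.step_setNat]
      simp only [State.setNat, NExpr.eval]
      rw [Prog.step_ite_of_not_holds hb, Prog.step, hdig, carryRegs_stop (by omega) hj hd]

/-! ### The main loop -/

/-- The arrays in the main loop at the code `c`. -/
noncomputable def codeArrays (n k : ℕ) (x y g : ℕ → ℝ) (c a b : ℕ) : ℝ :=
  if a = 4 then partialVector (n + 1) k x y g c b else drawArrays k x y g n 0 a b

/-- The state in the main loop at the code `c`. -/
noncomputable def codeState (n k : ℕ) (x y g : ℕ → ℝ) (c : ℕ) : State :=
  ⟨codeRegs n k c, codeArrays n k x y g c, n * k⟩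

theorem digit_lt (n c j : ℕ) : digit (n + 1) c j < n + 1 := Nat.mod_lt _ (Nat.succ_pos n)

theorem codeRegs_digit {n k c j : ℕ} (hj : j ≤ 4 * k + 2) :
    codeRegs n k c (10 + j) = digit (n + 1) c j := by
  simp only [codeRegs]
  rw [if_neg (by omega), if_neg (by omega), if_neg (by omega), if_neg (by omega),
    if_pos (by omega), show 10 + j - 10 = j by omega]

theorem codeState_digit {n k : ℕ} (x y g : ℕ → ℝ) {c j : ℕ} (hj : j ≤ 4 * k + 2) :
    (codeState n k x y g c).nat (10 + j) = digit (n + 1) c j := codeRegs_digit hj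

theorem summandExpr_eval (n k : ℕ) (x y g : ℕ → ℝ) (c J : ℕ) (hJ : J ≤ 2 * k - 1) :
    (summandExpr J).eval (codeState n k x y g c) = y (c / (n + 1) ^ (2 * k)) * x c *
      ∏ j ∈ Finset.Icc 1 J, drawnVector k g (j / 2) (digit (n + 1) c j) := by
  induction J with
  | zero => simp [summandExpr, RExpr.eval, NExpr.eval, codeState, codeArrays, drawArrays, codeRegs]
  | succ J ih =>
    rw [summandExpr, RExpr.eval, ih (by omega), Finset.prod_Icc_succ_top (by omega), ← mul_assoc]
    congr 1
    simp only [RExpr.eval, NExpr.eval, codeState]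
    rw [codeRegs_digit (by omega), codeArrays, if_neg (by omega), drawArrays, if_neg (by omega),
      if_neg (by omega), if_pos, show 10 + (J + 1) / 2 - 10 = (J + 1) / 2 by omega]
    have := digit_lt n c (J + 1)
    omega

theorem summandExpr_cost (J : ℕ) : (summandExpr J).cost = 3 * J + 5 := by
  induction J with
  | zero => rfl
  | succ J ih => simp only [summandExpr, RExpr.cost, ih, NExpr.cost]; ring

theorem addIfSorted_loopFree (b j i : ℕ) : (addIfSorted b j i).LoopFree := by
  induction i with
  | zero => trivial
  | succ i ih => exact ⟨trivial, ih⟩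

theorem addIfSorted_size (b j i : ℕ) : (addIfSorted b j i).size = 4 * i + 3 * j + 10 := by
  induction i with
  | zero => simp only [addIfSorted, Prog.size, NExpr.cost, RExpr.cost, summandExpr_cost]; ring
  | succ i ih => simp only [addIfSorted, Prog.size, ih, Test.cost, NExpr.cost]; ring

open Classical in
theorem addIfSorted_step (n k : ℕ) (x y g : ℕ → ℝ) (c i : ℕ) (hi : i ≤ 2 * k + 1) :
    (addIfSorted (2 * k) (2 * k - 1) i).step g (codeState n k x y g c) =
      if ∀ i' < i, digit (n + 1) c (2 * k + i') ≤ digit (n + 1) c (2 * k + i' + 1) then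
        (codeState n k x y g c).setReal 4 (digit (n + 1) c 0)
          (partialVector (n + 1) k x y g c (digit (n + 1) c 0) + summand (n + 1) k x y g c)
      else codeState n k x y g c := by
  induction i with
  | zero =>
    simp only [addIfSorted, Prog.step, RExpr.eval, NExpr.eval,
      summandExpr_eval n k x y g c _ le_rfl]
    have : (codeState n k x y g c).nat 10 = digit (n + 1) c 0 :=
      codeState_digit x y g (j := 0) (by omega)
    rw [this]
    simp [summand, codeState, codeArrays]
  | succ i ih =>
    have h1 : (codeState n k x y g c).nat (10 + (2 * k + i + 1)) =
      digit (n + 1) c (2 * k + i + 1) := codeState_digit x y g (by omega)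
    have h2 : (codeState n k x y g c).nat (10 + (2 * k + i)) =
      digit (n + 1) c (2 * k + i) := codeState_digit x y g (by omega)
    rw [addIfSorted]
    by_cases hlt : digit (n + 1) c (2 * k + i + 1) < digit (n + 1) c (2 * k + i)
    · rw [Prog.step_ite_of_holds (by simpa only [Test.holds, NExpr.eval, h1, h2] using hlt),
        if_neg (fun h => absurd (h i (by omega)) (by omega)), Prog.step]
    · rw [Prog.step_ite_of_not_holds (by simpa only [Test.holds, NExpr.eval, h1, h2] using hlt),
        ih (by omega)]
      congr 1
      refine propext ⟨fun h i' hi' => ?_, fun h i' hi' => h i' (by omega)⟩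
      rcases Nat.lt_succ_iff_lt_or_eq.1 hi' with h' | rfl
      · exact h i' h'
      · omega

open Classical in
theorem partialVector_succ (N k : ℕ) (x y g : ℕ → ℝ) (c a : ℕ) :
    partialVector N k x y g (c + 1) a = partialVector N k x y g c a +
      if digit N c 0 = a ∧ SortedCode N k c then summand N k x y g c else 0 := by
  rw [partialVector, Finset.sum_range_succ, partialVector]

theorem addIfSorted_step_full (n k : ℕ) (x y g : ℕ → ℝ) (c : ℕ) :
    (addIfSorted (2 * k) (2 * k - 1) (2 * k + 1)).step g (codeState n k x y g c) =
      ⟨codeRegs n k c, codeArrays n k x y g (c + 1), n * k⟩ := by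
  classical
  rw [addIfSorted_step n k x y g c _ le_rfl]
  split_ifs with h
  · have hs : SortedCode (n + 1) k c := h
    simp only [codeState, State.setReal, State.mk.injEq, true_and, and_true]
    funext a b
    by_cases ha : a = 4
    · subst ha
      rw [Function.update_self]
      by_cases hb : b = digit (n + 1) c 0
      · subst hb
        rw [Function.update_self, codeArrays, if_pos rfl, partialVector_succ, if_pos ⟨rfl, hs⟩]
      · rw [Function.update_of_ne hb, codeArrays, codeArrays, if_pos rfl, if_pos rfl,
          partialVector_succ, if_neg (fun h => hb h.1.symm), add_zero]
    · rw [Function.update_of_ne ha, codeArrays, codeArrays, if_neg ha, if_neg ha]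
  · have hs : ¬ SortedCode (n + 1) k c := h
    simp only [codeState, State.mk.injEq, true_and, and_true]
    funext a b
    simp only [codeArrays, partialVector_succ, hs, and_false, if_false, add_zero]

theorem sumWords_exec {n k : ℕ} (hn : 1 ≤ n) (hk : 1 ≤ k) (x y g : ℕ → ℝ) :
    ∃ t ≤ (n + 1) ^ (4 * k + 2) * (74 * k + 54) + 3, Exec g (sumWords k)
      ⟨drawRegs n n, drawArrays k x y g n 0, n * k⟩ t
      (codeState n k x y g ((n + 1) ^ (4 * k + 2))) := by
  have h0 : (⟨drawRegs n n, drawArrays k x y g n 0, n * k⟩ : State) = codeState n k x y g 0 := by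
    simp only [codeState, State.mk.injEq, and_true]
    constructor
    · funext r
      simp [drawRegs, codeRegs, digit]
    · funext a b
      by_cases ha : a = 4
      · simp [codeArrays, partialVector, drawArrays, ha]
      · simp [codeArrays, ha]
  have hd : ∀ c, c ≤ (n + 1) ^ (4 * k + 2) → (Test.holds (codeState n k x y g c)
      (.natLt (.reg (10 + (4 * k + 2))) (.const 1)) ↔ c < (n + 1) ^ (4 * k + 2)) := by
    intro c hc
    have : (codeState n k x y g c).nat (10 + (4 * k + 2)) = digit (n + 1) c (4 * k + 2) :=
      codeState_digit x y g (by omega)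
    simp only [Test.holds, NExpr.eval, this, digit]
    rcases hc.lt_or_eq with h | h
    · simp [Nat.div_eq_of_lt h, h]
    · rw [h, Nat.div_self (by positivity), Nat.mod_eq_of_lt (by omega)]
      simp
  obtain ⟨t, ht, he⟩ := Exec.while_of_states (g := g)
    (b := .natLt (.reg (10 + (4 * k + 2))) (.const 1))
    (p := .seq (addIfSorted (2 * k) (2 * k - 1) (2 * k + 1))
      (.seq (.setNat 2 (.add (.reg 2) (.const 1))) (increment (2 * k) 0 (4 * k + 2))))
    ⟨addIfSorted_loopFree _ _ _, trivial, increment_loopFree _ _ _⟩ ((n + 1) ^ (4 * k + 2))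
    (codeState n k x y g) (fun i hi => (hd i hi.le).2 hi) (fun h => ((hd _ le_rfl).1 h).false)
    (fun i hi => by
      rw [Prog.step_seq, addIfSorted_step_full, Prog.step_seq, Prog.step_setNat]
      have hu : Function.update (codeRegs n k i) 2 (codeRegs n k i 2 + 1) = carryRegs n k i 0 := by
        funext r
        by_cases h2 : r = 2
        · subst h2; simp [carryRegs, codeRegs]
        · rw [Function.update_of_ne h2]
          by_cases h3 : r = 3
          · simp [carryRegs, codeRegs, h3, show 0 < k by omega]
          · have : ¬ (10 ≤ r ∧ r < 10 + 0) := by omega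
            simp only [carryRegs, h2, h3, this, if_false]
      simp only [State.setNat, NExpr.eval, hu]
      exact increment_step g _ _ _ _ (by omega) hi hn (by simp))
  rw [h0]
  refine ⟨t, ht.trans (Nat.add_le_add (Nat.mul_le_mul_left _ ?_) (by simp [Test.cost, NExpr.cost])), he⟩
  have := increment_size (2 * k) 0 (4 * k + 2)
  simp only [Test.cost, NExpr.cost, Prog.size, addIfSorted_size]
  omega

/-! ### The output -/

/-- The vector that the algorithm computes, before it is normalized. -/
noncomputable def rawVector (n k : ℕ) (x y g : ℕ → ℝ) (i : ℕ) : ℝ :=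
  partialVector (n + 1) k x y g ((n + 1) ^ (4 * k + 2)) (i + 1)

theorem sumSquares_exec (n k : ℕ) (x y g : ℕ → ℝ) :
    ∃ t ≤ n * 17 + 3, ∃ s : State, Exec g sumSquares
      (codeState n k x y g ((n + 1) ^ (4 * k + 2))) t s ∧ s.nat 0 = n ∧ s.nat 1 = 0 ∧
      s.real 5 0 = ∑ i ∈ Finset.range n, rawVector n k x y g i ^ 2 ∧
      (∀ i, s.real 4 (i + 1) = rawVector n k x y g i) ∧ ∀ i, s.real 2 i = 0 := by
  set s₀ := codeState n k x y g ((n + 1) ^ (4 * k + 2)) with hs₀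
  have h4 : ∀ i, s₀.real 4 (i + 1) = rawVector n k x y g i := fun i => by
    simp [hs₀, codeState, codeArrays, rawVector]
  -- The coordinates are summed from the last to the first; `Finset.sum_range_reflect` restores the
  -- order at the end.
  let S : ℕ → State := fun i => ⟨Function.update s₀.nat 1 (n - i),
    Function.update s₀.real 5 (Function.update (s₀.real 5) 0
      (∑ j ∈ Finset.range i, rawVector n k x y g (n - 1 - j) ^ 2)), s₀.drawn⟩
  have hS0 : s₀ = S 0 := by
    have h1 : s₀.nat 1 = n := by simp [hs₀, codeState, codeRegs]
    have h5 : s₀.real 5 0 = 0 := by simp [hs₀, codeState, codeArrays, drawArrays]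
    have e5 : Function.update (s₀.real 5) 0 0 = s₀.real 5 := by
      rw [← h5, Function.update_eq_self]
    have e1 : Function.update s₀.nat 1 n = s₀.nat := by
      conv_lhs => rw [← h1]
      rw [Function.update_eq_self]
    simp [S, e5, e1]
  obtain ⟨t, ht, he⟩ := Exec.while_of_states (g := g) (b := .natLt (.const 0) (.reg 1))
    (p := .seq (.setReal 5 (.const 0) (.add (.cell 5 (.const 0))
        (.mul (.cell 4 (.reg 1)) (.cell 4 (.reg 1)))))
      (.setNat 1 (.sub (.reg 1) (.const 1)))) ⟨trivial, trivial⟩ n S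
    (fun i hi => by simp [S, Test.holds, NExpr.eval]; omega)
    (by simp [S, Test.holds, NExpr.eval])
    (fun i hi => by
      have hv : s₀.real 4 (n - i) = rawVector n k x y g (n - 1 - i) := by
        rw [← h4]; congr 1; omega
      simp only [S, Prog.step, State.setNat, State.setReal, NExpr.eval, RExpr.eval,
        Function.update_self, Function.update_idem, State.mk.injEq, and_true]
      refine ⟨by congr 1, ?_⟩
      congr 2
      rw [Function.update_of_ne (by decide), hv, Finset.sum_range_succ, sq])
  refine ⟨t, by simpa [Test.cost, Prog.size, NExpr.cost, RExpr.cost] using ht, S n,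
    by rw [hS0]; exact he, ?_, ?_, ?_, ?_, ?_⟩
  · simp [S, hs₀, codeState, codeRegs]
  · simp [S]
  · simp only [S, Function.update_self]
    exact Finset.sum_range_reflect (fun j => rawVector n k x y g j ^ 2) n
  · intro i; simpa [S] using h4 i
  · intro i; simp [S, hs₀, codeState, codeArrays, drawArrays]

theorem writeOutput_exec {n : ℕ} (g : ℕ → ℝ) (s : State) (h0 : s.nat 0 = n) (h1 : s.nat 1 = 0)
    (h2 : ∀ i, s.real 2 i = 0) :
    ∃ t ≤ n * 17 + 13, ∃ s' : State, Exec g writeOutput s t s' ∧ ∀ i < n,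
      s'.real 2 i = if 0 < s.real 5 0 then s.real 4 (i + 1) / √(s.real 5 0)
        else if i = 0 then 1 else 0 := by
  by_cases hpos : 0 < s.real 5 0
  · let S : ℕ → State := fun i => ⟨Function.update s.nat 1 i, Function.update s.real 2
      (fun j => if j < i then s.real 4 (j + 1) / √(s.real 5 0) else 0), s.drawn⟩
    have hS0 : s = S 0 := by
      have e1 : Function.update s.nat 1 0 = s.nat := by
        conv_lhs => rw [← h1]
        rw [Function.update_eq_self]
      have e2 : Function.update s.real 2 (fun _ => 0) = s.real := by
        rw [show (fun _ => 0) = s.real 2 from funext fun i => (h2 i).symm, Function.update_eq_self]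
      simp [S, e1, e2]
    obtain ⟨t, ht, he⟩ := Exec.while_of_states (g := g) (b := .natLt (.reg 1) (.reg 0))
      (p := .seq (.setReal 2 (.reg 1) (.div (.cell 4 (.add (.reg 1) (.const 1)))
          (.sqrt (.cell 5 (.const 0)))))
        (.setNat 1 (.add (.reg 1) (.const 1)))) ⟨trivial, trivial⟩ n S
      (fun i hi => by simpa [S, Test.holds, NExpr.eval, h0] using hi)
      (by simp [S, Test.holds, NExpr.eval, h0])
      (fun i hi => by
        simp only [S, Prog.step, State.setNat, State.setReal, NExpr.eval, RExpr.eval,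
          Function.update_self, Function.update_idem, State.mk.injEq, and_true, true_and]
        congr 1
        funext j
        rw [Function.update_of_ne (show (4 : ℕ) ≠ 2 by decide),
          Function.update_of_ne (show (5 : ℕ) ≠ 2 by decide)]
        by_cases hj : j = i
        · subst hj
          simp
        · rw [Function.update_of_ne hj]
          have : (j < i + 1) ↔ (j < i) := by omega
          simp only [this])
    refine ⟨(Test.realLt (.const 0) (.cell 5 (.const 0))).cost + t, ?_, S n, ?_, ?_⟩
    · simp only [Test.cost, Prog.size, NExpr.cost, RExpr.cost] at ht ⊢
      omega
    · refine .iteTrue (by simpa [Test.holds, RExpr.eval, NExpr.eval] using hpos) ?_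
      rw [hS0]; exact he
    · intro i hi
      simp [S, hi, hpos]
  · refine ⟨(Test.realLt (.const 0) (.cell 5 (.const 0))).cost + 3, ?_,
      s.setReal 2 0 1, ?_, ?_⟩
    · simp [Test.cost, NExpr.cost, RExpr.cost]
    · refine .iteFalse (by simpa [Test.holds, RExpr.eval, NExpr.eval] using hpos) ?_
      simpa [NExpr.cost, RExpr.cost, NExpr.eval, RExpr.eval] using
        Exec.setReal (g := g) s 2 (.const 0) (.const 1)
    · intro i _
      rw [if_neg hpos]
      by_cases hi : i = 0
      · subst hi; simp [State.setReal]
      · simp [State.setReal, hi, h2]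

/-- The vector that the algorithm computes, as a vector in `ℝⁿ`. -/
noncomputable def rawOutput (n k : ℕ) (x y g : ℕ → ℝ) : EuclideanSpace ℝ (Fin n) :=
  WithLp.toLp 2 fun i : Fin n => rawVector n k x y g i

/-- The number of words is at most `(n + 1) ^ (6k)`, and the cost per word, linear in `k`, is
absorbed by `(k + 1) 2^13 ≤ 2^(14k) ≤ (n + 1) ^ (14k)`. -/
theorem time_bound {n k : ℕ} (hn : 1 ≤ n) (hk : 1 ≤ k) :
    (n * (2 * k + 8) + 3) + (((n + 1) ^ (4 * k + 2) * (74 * k + 54) + 3) +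
      ((n * 17 + 3) + (n * 17 + 13))) ≤ (n + 1) ^ (20 * k) := by
  have hN : 2 ≤ n + 1 := by omega
  have h1 : n + 1 ≤ (n + 1) ^ (6 * k) := Nat.le_self_pow (by omega) _
  have h2 : (n + 1) ^ (4 * k + 2) ≤ (n + 1) ^ (6 * k) := Nat.pow_le_pow_right (by omega) (by omega)
  have h3 : k < 2 ^ k := Nat.lt_two_pow_self
  have h4 : 2 ^ (14 * k) ≤ (n + 1) ^ (14 * k) := Nat.pow_le_pow_left hN _
  have h5 : 2 ^ (14 * k) = 2 ^ k * (2 ^ k) ^ 13 := by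
    rw [← pow_succ', ← pow_mul, Nat.mul_comm k]
  have h6 : 2 ^ 13 ≤ (2 ^ k) ^ 13 := Nat.pow_le_pow_left (by omega) _
  have h7 : (k + 1) * 2 ^ 13 ≤ (n + 1) ^ (14 * k) := by
    refine le_trans ?_ h4
    rw [h5]
    exact Nat.mul_le_mul (by omega) h6
  calc _ ≤ (n + 1) ^ (6 * k) * (2 * k + 8) + 3 + ((n + 1) ^ (6 * k) * (74 * k + 54) + 3 +
        ((n + 1) ^ (6 * k) * 17 + 3 + ((n + 1) ^ (6 * k) * 17 + 13))) := by gcongr <;> omega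
    _ ≤ (n + 1) ^ (6 * k) * ((k + 1) * 2 ^ 13) := by
      have : 1 ≤ (n + 1) ^ (6 * k) := by omega
      nlinarith
    _ ≤ (n + 1) ^ (6 * k) * (n + 1) ^ (14 * k) := Nat.mul_le_mul_left _ h7
    _ = (n + 1) ^ (20 * k) := by rw [← pow_add]; congr 1; ring

theorem sampler_exec {n k : ℕ} (hn : 1 ≤ n) (hk : 1 ≤ k) (x y g : ℕ → ℝ) :
    ∃ t ≤ (n + 1) ^ (20 * k), ∃ s : State, Exec g (sampler k) (initState n x y) t s ∧
      ‖output n s‖ = 1 ∧ (rawOutput n k x y g ≠ 0 →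
        output n s = ‖rawOutput n k x y g‖⁻¹ • rawOutput n k x y g) := by
  obtain ⟨t₁, ht₁, e₁⟩ := drawVectors_exec n k x y g
  obtain ⟨t₂, ht₂, e₂⟩ := sumWords_exec hn hk x y g
  obtain ⟨t₃, ht₃, s₃, e₃, hs0, hs1, hs5, hs4, hs2⟩ := sumSquares_exec n k x y g
  obtain ⟨t₄, ht₄, s₄, e₄, hs⟩ := writeOutput_exec g s₃ hs0 hs1 hs2
  have hnorm : ‖rawOutput n k x y g‖ ^ 2 = s₃.real 5 0 := by
    rw [hs5, EuclideanSpace.real_norm_sq_eq, ← Fin.sum_univ_eq_sum_range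
      (fun i => rawVector n k x y g i ^ 2)]
    rfl
  have hout : rawOutput n k x y g ≠ 0 →
      output n s₄ = ‖rawOutput n k x y g‖⁻¹ • rawOutput n k x y g := by
    intro hne
    have hpos : 0 < s₃.real 5 0 := by rw [← hnorm]; positivity
    ext i
    simp only [output, PiLp.smul_apply, smul_eq_mul]
    rw [hs i i.2, if_pos hpos, ← hnorm, Real.sqrt_sq (norm_nonneg _), hs4, rawOutput, div_eq_inv_mul]
  refine ⟨_, le_trans (add_le_add ht₁ (add_le_add ht₂ (add_le_add ht₃ ht₄))) (time_bound hn hk),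
    s₄, .seq e₁ (.seq e₂ (.seq e₃ e₄)), ?_, hout⟩
  by_cases hne : rawOutput n k x y g = 0
  · have h0 : s₃.real 5 0 = 0 := by rw [← hnorm, hne]; simp
    have : output n s₄ = EuclideanSpace.single (⟨0, hn⟩ : Fin n) (1 : ℝ) := by
      ext i
      simp only [output]
      rw [hs i i.2, h0, if_neg (lt_irrefl _)]
      simp [Fin.ext_iff]
    rw [this]; simp
  · rw [hout hne, norm_smul, norm_inv, norm_norm, inv_mul_cancel₀ (norm_ne_zero_iff.2 hne)]

open MvPolynomial

/-! ### The output in terms of the pseudo-expectation -/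

/-- The factor of a digit: `1` for the digit `0`, and the `i`-th indeterminate for `i + 1`. -/
noncomputable def digitFactor (n w : ℕ) : MvPolynomial (Fin n) ℝ :=
  if h : 1 ≤ w ∧ w ≤ n then X ⟨w - 1, by omega⟩ else 1

/-- The monomial of a code of length `d`. -/
noncomputable def codeMonomial (n d c : ℕ) : MvPolynomial (Fin n) ℝ :=
  ∏ j ∈ Finset.range d, digitFactor n (digit (n + 1) c j)

theorem digitFactor_val {n : ℕ} (w : Fin (n + 1)) : digitFactor n w =
    monomial (Fin.cases (0 : Fin n →₀ ℕ) (fun i => Finsupp.single i 1) w) (1 : ℝ) := by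
  refine Fin.cases ?_ (fun i => ?_) w
  · simp [digitFactor]
  · simp [digitFactor, X]

theorem monomial_wordExponent {n d : ℕ} (t : Fin d → Fin (n + 1)) :
    monomial (wordExponent t) (1 : ℝ) = ∏ j, digitFactor n (t j) := by
  simp_rw [digitFactor_val, wordExponent]
  rw [monomial_sum_one]

theorem digit_finFunctionFinEquiv {N d : ℕ} (t : Fin d → Fin N) (j : Fin d) :
    digit N (finFunctionFinEquiv t) j = t j := by
  conv_rhs => rw [← finFunctionFinEquiv.symm_apply_apply t]
  rfl

theorem codeMonomial_finFunctionFinEquiv {n d : ℕ} (t : Fin d → Fin (n + 1)) :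
    codeMonomial n d (finFunctionFinEquiv t) = monomial (wordExponent t) (1 : ℝ) := by
  rw [monomial_wordExponent, codeMonomial,
    ← Fin.prod_univ_eq_prod_range (fun j => digitFactor n (digit (n + 1) _ j))]
  simp_rw [digit_finFunctionFinEquiv]

theorem sum_range_codes {A : Type*} [AddCommMonoid A] (N d : ℕ) (f : ℕ → A) :
    ∑ c ∈ Finset.range (N ^ d), f c =
      ∑ t : Fin d → Fin N, f (finFunctionFinEquiv t) := by
  rw [← Fin.sum_univ_eq_sum_range, ← finFunctionFinEquiv.sum_comp]

theorem momentArray_eq {n d c : ℕ} (L : MvPolynomial (Fin n) ℝ →ₗ[ℝ] ℝ) (hc : c < (n + 1) ^ d) :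
    momentArray d L c = L (codeMonomial n d c) := by
  obtain ⟨t, ht⟩ := finFunctionFinEquiv.surjective (⟨c, hc⟩ : Fin ((n + 1) ^ d))
  have hc' : c = (finFunctionFinEquiv t : Fin ((n + 1) ^ d)) := by rw [ht]
  rw [momentArray, monomialArray, dif_pos hc, ← ht, Equiv.symm_apply_apply, hc',
    codeMonomial_finFunctionFinEquiv]

theorem sum_prod_digits {A : Type*} [CommSemiring A] (N d : ℕ) (f : ℕ → ℕ → A) :
    ∑ c ∈ Finset.range (N ^ d), ∏ j ∈ Finset.range d, f j (digit N c j) =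
      ∏ j ∈ Finset.range d, ∑ w ∈ Finset.range N, f j w := by
  rw [sum_range_codes]
  simp_rw [← Fin.prod_univ_eq_prod_range, ← Fin.sum_univ_eq_sum_range, digit_finFunctionFinEquiv]
  rw [Finset.prod_univ_sum, Fintype.piFinset_univ]

/-! #### Sorted words and monomials -/

theorem wordExponent_comp_perm {n d : ℕ} (t : Fin d → Fin (n + 1)) (σ : Equiv.Perm (Fin d)) :
    wordExponent (t ∘ σ) = wordExponent t :=
  Equiv.sum_comp σ fun j => Fin.cases (motive := fun _ => Fin n →₀ ℕ) 0
    (fun i => Finsupp.single i 1) (t j)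

theorem exists_wordExponent_eq {n d : ℕ} (m : Fin n →₀ ℕ) (hm : m.degree ≤ d) :
    ∃ t : Fin d → Fin (n + 1), wordExponent t = m := by
  induction d generalizing m with
  | zero =>
    refine ⟨Fin.elim0, ?_⟩
    have : m = 0 := (Finsupp.degree_eq_zero_iff m).1 (by omega)
    simp [wordExponent, this]
  | succ d ih =>
    by_cases h0 : m = 0
    · refine ⟨fun _ => 0, ?_⟩
      simp [wordExponent, h0]
    · obtain ⟨i, hi⟩ := Finsupp.ne_iff.1 h0
      have hle : Finsupp.single i 1 ≤ m := by
        rw [Finsupp.single_le_iff]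
        exact Nat.one_le_iff_ne_zero.2 hi
      have hm' : Finsupp.single i 1 + (m - Finsupp.single i 1) = m := add_tsub_cancel_of_le hle
      have hdeg : (Finsupp.single i 1 + (m - Finsupp.single i 1)).degree ≤ d + 1 := by rwa [hm']
      rw [map_add, Finsupp.degree_single] at hdeg
      obtain ⟨t, ht⟩ := ih (m - Finsupp.single i 1) (by omega)
      refine ⟨Fin.cons i.succ t, ?_⟩
      rw [wordExponent, Fin.sum_univ_succ]
      simp only [Fin.cons_zero, Fin.cons_succ, Fin.cases_succ]
      rw [← hm']
      congr 1

theorem count_map_succ {n d : ℕ} (t : Fin d → Fin (n + 1)) (i : Fin n) :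
    (Finset.univ.val.map t).count i.succ = wordExponent t i := by
  rw [Multiset.count_map, wordExponent, Finsupp.finsetSum_apply, ← Finset.filter_val,
    ← Finset.card_def, Finset.card_filter]
  refine Finset.sum_congr rfl fun j _ => ?_
  refine Fin.cases ?_ (fun i' => ?_) (t j)
  · simp [Fin.succ_ne_zero]
  · simp [Finsupp.single_apply, eq_comm]

/-- The exponent vector counts the nonzero letters, and the length then fixes the number of zeros; a
sorted word is determined by its multiset of letters. -/
theorem monotone_eq_of_wordExponent_eq {n d : ℕ} {t t' : Fin d → Fin (n + 1)} (ht : Monotone t)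
    (ht' : Monotone t') (h : wordExponent t = wordExponent t') : t = t' := by
  have hsucc : ∀ i : Fin n, (Finset.univ.val.map t).count i.succ =
      (Finset.univ.val.map t').count i.succ := fun i => by
    rw [count_map_succ, count_map_succ, h]
  have hcard : ∀ s : Fin d → Fin (n + 1), (Finset.univ.val.map s).count 0 +
      ∑ i : Fin n, (Finset.univ.val.map s).count i.succ = d := fun s => by
    rw [← Fin.sum_univ_succ fun a => (Finset.univ.val.map s).count a]
    rw [Multiset.sum_count_eq_card fun _ _ => Finset.mem_univ _]
    simp
  have hmap : Finset.univ.val.map t = Finset.univ.val.map t' := by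
    ext a
    refine Fin.cases ?_ hsucc a
    have h1 := hcard t
    have h2 := hcard t'
    simp_rw [hsucc] at h1
    omega
  rw [Fin.univ_val_map, Fin.univ_val_map, Multiset.coe_eq_coe] at hmap
  exact List.ofFn_injective
    (hmap.eq_of_pairwise' ht.sortedLE_ofFn.pairwise ht'.sortedLE_ofFn.pairwise)

open Classical in
-- A monomial is spelled by many words but by a single sorted one, so restricting to sorted words
-- takes each coefficient of `W` exactly once.
theorem sum_monotone_words {n d : ℕ} (W : MvPolynomial (Fin n) ℝ) (hW : W.totalDegree ≤ d) :
    ∑ t : Fin d → Fin (n + 1), (if Monotone t then monomial (wordExponent t)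
      (W.coeff (wordExponent t)) else 0) = W := by
  rw [← Finset.sum_filter]
  conv_rhs => rw [W.as_sum]
  rw [← Finset.sum_subset (s₁ := ({t : Fin d → Fin (n + 1) | Monotone t ∧
    wordExponent t ∈ W.support} : Finset _))]
  · refine Finset.sum_bij (fun t _ => wordExponent t) ?_ ?_ ?_ ?_
    · intro t ht
      exact (Finset.mem_filter.1 ht).2.2
    · intro t ht t' ht' h
      exact monotone_eq_of_wordExponent_eq (Finset.mem_filter.1 ht).2.1
        (Finset.mem_filter.1 ht').2.1 h
    · intro m hm
      obtain ⟨t, rfl⟩ := exists_wordExponent_eq (d := d) m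
        ((le_totalDegree hm).trans hW)
      refine ⟨t ∘ Tuple.sort t, ?_, wordExponent_comp_perm t _⟩
      simp only [Finset.mem_filter, Finset.mem_univ, true_and]
      exact ⟨Tuple.monotone_sort t, by rwa [wordExponent_comp_perm]⟩
    · intro t _; rfl
  · intro t ht
    simp only [Finset.mem_filter, Finset.mem_univ, true_and] at ht ⊢
    exact ht.1
  · intro t ht ht'
    simp only [Finset.mem_filter, Finset.mem_univ, true_and, not_and] at ht ht'
    rw [notMem_support_iff.1 (ht' ht), monomial_zero]

open Classical in
theorem sum_sorted_codes {n k : ℕ} (W : MvPolynomial (Fin n) ℝ) (hW : W.totalDegree ≤ 2 * k + 2) :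
    ∑ c ∈ Finset.range ((n + 1) ^ (2 * k + 2)),
      (if ∀ i < 2 * k + 1, digit (n + 1) c i ≤ digit (n + 1) c (i + 1) then
        coeffArray (2 * k + 2) W c • codeMonomial n (2 * k + 2) c else 0) = W := by
  rw [sum_range_codes]
  conv_rhs => rw [← sum_monotone_words W hW]
  refine Finset.sum_congr rfl fun t _ => ?_
  have hmono : (∀ i < 2 * k + 1, digit (n + 1) (finFunctionFinEquiv t) i ≤
      digit (n + 1) (finFunctionFinEquiv t) (i + 1)) ↔ Monotone t := by
    rw [Fin.monotone_iff_le_succ]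
    constructor
    · intro h i
      have := h i i.2
      rwa [show (i : ℕ) = (i.castSucc : Fin (2 * k + 2)) from rfl, digit_finFunctionFinEquiv,
        show ((i.castSucc : Fin (2 * k + 2)) : ℕ) + 1 = (i.succ : Fin (2 * k + 2)) from rfl,
        digit_finFunctionFinEquiv] at this
    · intro h i hi
      have h1 := digit_finFunctionFinEquiv t (Fin.castSucc ⟨i, hi⟩)
      have h2 := digit_finFunctionFinEquiv t (Fin.succ ⟨i, hi⟩)
      simp only [Fin.val_castSucc, Fin.val_succ] at h1 h2
      rw [h1, h2]
      exact h ⟨i, hi⟩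
  simp only [hmono]
  congr 1
  rw [codeMonomial_finFunctionFinEquiv, smul_monomial, smul_eq_mul, mul_one, coeffArray,
    monomialArray, dif_pos (finFunctionFinEquiv t).2, Fin.eta, Equiv.symm_apply_apply]

/-! ### Splitting codes into low and high digits. -/

theorem sum_range_mul_codes {A : Type*} [AddCommMonoid A] (m n : ℕ) (f : ℕ → A) :
    ∑ c ∈ Finset.range (m * n), f c =
      ∑ t ∈ Finset.range m, ∑ r ∈ Finset.range n, f (r + n * t) := by
  rw [← Fin.sum_univ_eq_sum_range, ← finProdFinEquiv.sum_comp, Fintype.sum_prod_type]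
  rw [← Fin.sum_univ_eq_sum_range (fun t => ∑ r ∈ Finset.range n, f (r + n * t))]
  refine Finset.sum_congr rfl fun t _ => ?_
  rw [← Fin.sum_univ_eq_sum_range (fun r => f (r + n * t))]
  rfl

theorem digit_add_low {N r t m j : ℕ} (hN : 0 < N) (hj : j < m) :
    digit N (r + N ^ m * t) j = digit N r j := by
  obtain ⟨e, rfl⟩ := Nat.exists_eq_add_of_lt hj
  rw [digit, digit, show N ^ (j + e + 1) * t = N ^ j * (N * (N ^ e * t)) by ring,
    Nat.add_mul_div_left _ _ (by positivity), Nat.add_mul_mod_self_left]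

theorem digit_add_high {N r t m : ℕ} (hr : r < N ^ m) (j : ℕ) :
    digit N (r + N ^ m * t) (m + j) = digit N t j := by
  rw [digit, digit, pow_add, ← Nat.div_div_eq_div_mul,
    Nat.add_mul_div_left _ _ (by omega), Nat.div_eq_of_lt hr, zero_add]

theorem codeMonomial_add {n r t m d : ℕ} (hr : r < (n + 1) ^ m) :
    codeMonomial n (m + d) (r + (n + 1) ^ m * t) = codeMonomial n m r * codeMonomial n d t := by
  rw [codeMonomial, Finset.prod_range_add]
  congr 1
  · exact Finset.prod_congr rfl fun j hj => by
      rw [digit_add_low (Nat.succ_pos n) (Finset.mem_range.1 hj)]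
  · exact Finset.prod_congr rfl fun j _ => by rw [digit_add_high hr]

/-- The `l`-th Gaussian vector drawn by the algorithm. -/
noncomputable def gaussVector (n k : ℕ) (g : ℕ → ℝ) (l : ℕ) : EuclideanSpace ℝ (Fin n) :=
  WithLp.toLp 2 fun i : Fin n => g (i * k + l)

theorem sum_digitFactor_drawn {n k : ℕ} (g : ℕ → ℝ) (l : ℕ) :
    ∑ w ∈ Finset.range (n + 1), C (drawnVector k g l w) * digitFactor n w =
      linForm (gaussVector n k g l) := by
  rw [Finset.sum_range_succ', linForm, ← Fin.sum_univ_eq_sum_range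
    (fun w => C (drawnVector k g l (w + 1)) * digitFactor n (w + 1))]
  have h0 : drawnVector k g l 0 = 0 := by simp [drawnVector]
  rw [h0, C_0, zero_mul, add_zero]
  refine Finset.sum_congr rfl fun i _ => ?_
  simp [drawnVector, digitFactor, gaussVector]

/-- The weight that the algorithm multiplies `W` with. -/
noncomputable def weight {n : ℕ} (ξ : ℕ → EuclideanSpace ℝ (Fin n)) (m : ℕ) :
    MvPolynomial (Fin n) ℝ :=
  ∏ l ∈ Finset.range m, linForm (ξ l) ^ 2

theorem prod_Icc_half {A : Type*} [CommMonoid A] (f : ℕ → A) (m : ℕ) :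
    ∏ j ∈ Finset.Icc 1 (2 * (m + 1) - 1), f (j / 2) =
      f 0 * ∏ l ∈ Finset.range m, f (l + 1) ^ 2 := by
  induction m with
  | zero => simp
  | succ m ih =>
    rw [show 2 * (m + 1 + 1) - 1 = 2 * m + 1 + 1 + 1 by omega, Finset.prod_Icc_succ_top (by omega),
      Finset.prod_Icc_succ_top (by omega), show 2 * m + 1 = 2 * (m + 1) - 1 by omega, ih,
      Finset.prod_range_succ, show (2 * (m + 1) - 1 + 1) / 2 = m + 1 by omega,
      show (2 * m + 2 + 1) / 2 = m + 1 by omega, sq, mul_assoc, mul_assoc]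

theorem range_eq_insert_Icc (m : ℕ) (hm : 1 ≤ m) :
    Finset.range m = insert 0 (Finset.Icc 1 (m - 1)) := by
  ext j; simp; omega

/-- The distributive law: multiplying out the linear forms on the right gives one term per choice of
letters, and the condition on digit `0` keeps the factor `X a`. -/
theorem sum_low_codes {n m : ℕ} (g : ℕ → ℝ) (a : Fin n) :
    ∑ r ∈ Finset.range ((n + 1) ^ (2 * (m + 1))), (if digit (n + 1) r 0 = a + 1 then
      C (∏ j ∈ Finset.Icc 1 (2 * (m + 1) - 1), drawnVector (m + 1) g (j / 2) (digit (n + 1) r j)) *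
        codeMonomial n (2 * (m + 1)) r else 0) =
    X a * linForm (gaussVector n (m + 1) g 0) *
      weight (fun l => gaussVector n (m + 1) g (l + 1)) m := by
  let φ : ℕ → ℕ → MvPolynomial (Fin n) ℝ := fun j w =>
    if j = 0 then (if w = a + 1 then digitFactor n w else 0)
    else C (drawnVector (m + 1) g (j / 2) w) * digitFactor n w
  have hins := range_eq_insert_Icc (2 * (m + 1)) (by omega)
  have h0 : (0 : ℕ) ∉ Finset.Icc 1 (2 * (m + 1) - 1) := by simp
  have hpos : ∀ j ∈ Finset.Icc 1 (2 * (m + 1) - 1), j ≠ 0 := fun j hj => by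
    have := (Finset.mem_Icc.1 hj).1; omega
  have key := sum_prod_digits (n + 1) (2 * (m + 1)) φ
  convert key using 1
  · refine Finset.sum_congr rfl fun r _ => ?_
    rw [codeMonomial, hins, Finset.prod_insert h0, Finset.prod_insert h0]
    by_cases h : digit (n + 1) r 0 = a + 1
    · rw [if_pos h]
      simp only [φ, if_pos h, if_true]
      rw [mul_left_comm, map_prod, ← Finset.prod_mul_distrib]
      congr 1
      exact Finset.prod_congr rfl fun j hj => by rw [if_neg (hpos j hj)]
    · simp [φ, if_neg h]
  · rw [hins, Finset.prod_insert h0, mul_assoc]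
    congr 1
    · simp only [φ, if_true]
      rw [Finset.sum_ite_eq', if_pos (Finset.mem_range.2 (by omega))]
      simp [digitFactor]
    · rw [weight, ← prod_Icc_half (fun l => linForm (gaussVector n (m + 1) g l))]
      refine Finset.prod_congr rfl fun j hj => ?_
      simp only [φ, if_neg (hpos j hj), sum_digitFactor_drawn]

/-- A code is `r + (n + 1) ^ (2k) * t`: the sorted words `t` assemble `W`, the words `r` assemble
the other factors, and the monomial of the joint code is the product of the two. -/
theorem rawVector_eq {n m : ℕ} (L : MvPolynomial (Fin n) ℝ →ₗ[ℝ] ℝ) (W : MvPolynomial (Fin n) ℝ)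
    (hW : W.totalDegree ≤ 2 * (m + 1) + 2) (g : ℕ → ℝ) (a : Fin n) :
    rawVector n (m + 1) (momentArray (4 * (m + 1) + 2) L) (coeffArray (2 * (m + 1) + 2) W) g a =
      L (W * (X a * linForm (gaussVector n (m + 1) g 0) *
        weight (fun l => gaussVector n (m + 1) g (l + 1)) m)) := by
  classical
  rw [← sum_low_codes]
  conv_rhs => rw [← sum_sorted_codes W hW]
  rw [Finset.sum_mul_sum, map_sum, rawVector, partialVector,
    show 4 * (m + 1) + 2 = (2 * (m + 1) + 2) + 2 * (m + 1) by ring, pow_add, sum_range_mul_codes]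
  refine Finset.sum_congr rfl fun t ht => ?_
  rw [map_sum]
  refine Finset.sum_congr rfl fun r hr => ?_
  rw [Finset.mem_range] at ht hr
  have hsort : SortedCode (n + 1) (m + 1) (r + (n + 1) ^ (2 * (m + 1)) * t) ↔
      ∀ i < 2 * (m + 1) + 1, digit (n + 1) t i ≤ digit (n + 1) t (i + 1) := by
    simp only [SortedCode, add_assoc (2 * (m + 1)), digit_add_high hr]
  have hlow : ∀ j, j < 2 * (m + 1) → digit (n + 1) (r + (n + 1) ^ (2 * (m + 1)) * t) j =
      digit (n + 1) r j := fun j hj => digit_add_low (Nat.succ_pos n) hj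
  rw [hsort, hlow 0 (by omega)]
  by_cases h1 : digit (n + 1) r 0 = a + 1
  swap
  · simp [h1]
  by_cases h2 : ∀ i < 2 * (m + 1) + 1, digit (n + 1) t i ≤ digit (n + 1) t (i + 1)
  swap
  · rw [if_neg (fun h => h2 h.2), if_neg h2]; simp
  rw [if_pos ⟨h1, h2⟩, if_pos h1, if_pos h2, summand]
  have hlt : r + (n + 1) ^ (2 * (m + 1)) * t < (n + 1) ^ ((2 * (m + 1) + 2) + 2 * (m + 1)) := by
    rw [pow_add, mul_comm ((n + 1) ^ (2 * (m + 1) + 2))]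
    calc _ < (n + 1) ^ (2 * (m + 1)) * (t + 1) := by linarith [Nat.mul_succ ((n + 1) ^ (2 * (m + 1))) t]
      _ ≤ _ := Nat.mul_le_mul_left _ ht
  have hdiv : (r + (n + 1) ^ (2 * (m + 1)) * t) / (n + 1) ^ (2 * (m + 1)) = t := by
    rw [Nat.add_mul_div_left _ _ (by positivity), Nat.div_eq_of_lt hr, zero_add]
  rw [momentArray_eq L hlt, hdiv, add_comm (2 * (m + 1) + 2), codeMonomial_add hr]
  rw [Finset.prod_congr rfl fun j hj => by
    rw [hlow j (by have := (Finset.mem_Icc.1 hj).2; omega)]]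
  rw [← smul_eq_C_mul, smul_mul_smul_comm, map_smul, smul_eq_mul,
    mul_comm (codeMonomial n (2 * (m + 1) + 2) t)]
  ring

/-! ### Sums of squares and degrees -/

theorem exists_sum_sq_of_isSumSq {R : Type*} [CommSemiring R] {Q : R} (hQ : IsSumSq Q) :
    ∃ (N : ℕ) (S : Fin N → R), Q = ∑ i, S i ^ 2 := by
  induction hQ with
  | zero => exact ⟨0, Fin.elim0, by simp⟩
  | sq_add a _ ih =>
    obtain ⟨N, S, rfl⟩ := ih
    exact ⟨N + 1, Fin.cons a S, by simp [Fin.sum_univ_succ, sq]⟩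

/-- Leading terms of squares cannot cancel: with `e` the largest degree, the coefficient at `2e` is
a sum of real squares, one of them nonzero if `e > d`. -/
theorem natDegree_le_of_sum_sq {N d : ℕ} (S : Fin N → Polynomial ℝ)
    (h : (∑ i, S i ^ 2).natDegree ≤ 2 * d) (i : Fin N) : (S i).natDegree ≤ d := by
  set e := Finset.univ.sup fun i => (S i).natDegree with he
  have hle : ∀ i, (S i).natDegree ≤ e := fun i =>
    Finset.le_sup (f := fun i => (S i).natDegree) (Finset.mem_univ i)
  refine (hle i).trans ?_
  by_contra! hlt
  obtain ⟨j, -, hj⟩ := Finset.exists_mem_eq_sup Finset.univ ⟨i, Finset.mem_univ i⟩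
    fun i => (S i).natDegree
  have h0 : (∑ i, S i ^ 2).coeff (e + e) = 0 := Polynomial.coeff_eq_zero_of_natDegree_lt (by omega)
  rw [Polynomial.finsetSum_coeff] at h0
  simp_rw [sq, Polynomial.coeff_mul_add_eq_of_natDegree_le (hle _) (hle _)] at h0
  have := (Finset.sum_eq_zero_iff_of_nonneg fun i _ => mul_self_nonneg _).1 h0 j (Finset.mem_univ j)
  rw [mul_self_eq_zero, he, hj, Polynomial.coeff_natDegree, Polynomial.leadingCoeff_eq_zero] at this
  rw [this, Polynomial.natDegree_zero] at hj
  omega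

/-- Every monomial of `P` has weight at most `d`. -/
def WeightLe {σ : Type*} (w : σ → ℕ) (d : ℕ) (P : MvPolynomial σ ℝ) : Prop :=
  ∀ m, P.coeff m ≠ 0 → Finsupp.weight w m ≤ d

/-- Substitute `x i * T ^ w i` for the `i`-th indeterminate. -/
noncomputable def scale {σ : Type*} (w : σ → ℕ) (x : σ → ℝ) :
    MvPolynomial σ ℝ →ₐ[ℝ] Polynomial ℝ :=
  aeval fun i => Polynomial.C (x i) * Polynomial.X ^ w i

theorem scale_monomial {σ : Type*} (w : σ → ℕ) (x : σ → ℝ) (m : σ →₀ ℕ) (c : ℝ) :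
    scale w x (monomial m c) =
      Polynomial.monomial (Finsupp.weight w m) (eval x (monomial m c)) := by
  rw [scale, aeval_monomial, eval_monomial, ← Polynomial.C_mul_X_pow_eq_monomial, map_mul,
    Polynomial.algebraMap_eq, mul_assoc, Finsupp.weight_apply]
  congr 1
  simp only [Finsupp.prod, mul_pow, Finset.prod_mul_distrib, map_prod, map_pow, Finsupp.sum,
    ← pow_mul, Finset.prod_pow_eq_pow_sum, smul_eq_mul, mul_comm]

theorem coeff_scale {σ : Type*} (w : σ → ℕ) (x : σ → ℝ) (P : MvPolynomial σ ℝ) (e : ℕ) :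
    (scale w x P).coeff e = eval x (weightedHomogeneousComponent w e P) := by
  classical
  induction P using MvPolynomial.induction_on' with
  | monomial m c =>
    have : weightedHomogeneousComponent w e (monomial m c) =
        if Finsupp.weight w m = e then monomial m c else 0 := by
      ext m'
      rw [coeff_weightedHomogeneousComponent]
      by_cases hm : m = m'
      · subst hm
        split_ifs <;> simp
      · split_ifs <;> simp [hm]
    rw [this, scale_monomial, Polynomial.coeff_monomial]
    split_ifs <;> simp
  | add P Q hP hQ => rw [map_add, Polynomial.coeff_add, hP, hQ, map_add, map_add]

/-- The coefficients of the univariate polynomial `scale w x P` are the weighted homogeneous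
components of `P` at `x`, and over the infinite field `ℝ` a component vanishing at all `x` is zero.
-/
theorem weightLe_iff_scale {σ : Type*} (w : σ → ℕ) (d : ℕ) (P : MvPolynomial σ ℝ) :
    WeightLe w d P ↔ ∀ x, (scale w x P).natDegree ≤ d := by
  classical
  constructor
  · intro h x
    rw [Polynomial.natDegree_le_iff_coeff_eq_zero]
    intro e he
    rw [coeff_scale]
    convert map_zero (eval x)
    ext m
    rw [coeff_weightedHomogeneousComponent, coeff_zero]
    split_ifs with hm
    · by_contra hne
      have := h m hne
      omega
    · rfl
  · intro h m hm
    by_contra! hlt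
    have h0 : weightedHomogeneousComponent w (Finsupp.weight w m) P = 0 := by
      refine MvPolynomial.funext fun x => ?_
      rw [← coeff_scale, map_zero]
      exact Polynomial.coeff_eq_zero_of_natDegree_lt ((h x).trans_lt hlt)
    have := congrArg (coeff m) h0
    rw [coeff_weightedHomogeneousComponent, if_pos rfl, coeff_zero] at this
    exact hm this

/-- General weights are needed because for polynomials in `(u, u')` the degrees in `u` and in `u'`
must be controlled separately. -/
theorem weightLe_of_sum_sq {σ : Type*} {w : σ → ℕ} {d N : ℕ} {S : Fin N → MvPolynomial σ ℝ}
    (h : WeightLe w (2 * d) (∑ i, S i ^ 2)) (i : Fin N) : WeightLe w d (S i) := by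
  rw [weightLe_iff_scale] at h ⊢
  intro x
  have hx := h x
  simp_rw [map_sum, map_pow] at hx
  exact natDegree_le_of_sum_sq _ hx i

theorem weightLe_one_iff {σ : Type*} {d : ℕ} {P : MvPolynomial σ ℝ} :
    WeightLe (1 : σ → ℕ) d P ↔ P.totalDegree ≤ d := by
  have h1 : ∀ m : σ →₀ ℕ, Finsupp.weight (1 : σ → ℕ) m = m.sum fun _ e => e := fun m => by
    rw [Finsupp.weight_apply]; simp
  constructor
  · intro h
    rw [totalDegree, Finset.sup_le_iff]
    intro m hm
    rw [← h1]
    exact h m (mem_support_iff.1 hm)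
  · intro h m hm
    rw [h1]
    exact (le_totalDegree (mem_support_iff.2 hm)).trans h

/-- `IsSumSq` bounds no degrees, but the squares in a decomposition cannot exceed the degree of
their sum. -/
theorem IsPseudoExpectation.nonneg_of_isSumSq {n d : ℕ} {L : MvPolynomial (Fin n) ℝ →ₗ[ℝ] ℝ}
    (hL : IsPseudoExpectation (2 * d) L) {Q : MvPolynomial (Fin n) ℝ} (hQ : IsSumSq Q)
    (hd : Q.totalDegree ≤ 2 * d) : 0 ≤ L Q := by
  obtain ⟨N, S, rfl⟩ := exists_sum_sq_of_isSumSq hQ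
  rw [map_sum]
  refine Finset.sum_nonneg fun i _ => hL.map_sq_nonneg _ ?_
  have := weightLe_one_iff.1 (weightLe_of_sum_sq (weightLe_one_iff.2 hd) i)
  omega

/-! ### The tensor square of a pseudo-expectation -/

/-- The exponents of `u` and `u'` in a monomial in `(u, u')`. -/
noncomputable def splitExponent {n : ℕ} :
    (Fin n ⊕ Fin n →₀ ℕ) ≃+ (Fin n →₀ ℕ) × (Fin n →₀ ℕ) :=
  Finsupp.sumFinsuppAddEquivProdFinsupp

theorem splitExponent_mapDomain {n : ℕ} (a b : Fin n →₀ ℕ) :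
    splitExponent (Finsupp.mapDomain Sum.inl a + Finsupp.mapDomain Sum.inr b) = (a, b) := by
  rw [splitExponent]
  ext i
  · simp [Finsupp.mapDomain_apply Sum.inl_injective, Finsupp.mapDomain_of_notMem_range]
  · simp [Finsupp.mapDomain_apply Sum.inr_injective, Finsupp.mapDomain_of_notMem_range]

/-- The functional `L ⊗ L` on polynomials in `(u, u')`. -/
noncomputable def tensorSquare {n : ℕ} (L : MvPolynomial (Fin n) ℝ →ₗ[ℝ] ℝ) :
    MvPolynomial (Fin n ⊕ Fin n) ℝ →ₗ[ℝ] ℝ :=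
  (basisMonomials (Fin n ⊕ Fin n) ℝ).constr ℝ fun m =>
    L (monomial (splitExponent m).1 1) * L (monomial (splitExponent m).2 1)

theorem tensorSquare_monomial {n : ℕ} (L : MvPolynomial (Fin n) ℝ →ₗ[ℝ] ℝ)
    (m : Fin n ⊕ Fin n →₀ ℕ) : tensorSquare L (monomial m 1) =
    L (monomial (splitExponent m).1 1) * L (monomial (splitExponent m).2 1) := by
  have := (basisMonomials (Fin n ⊕ Fin n) ℝ).constr_basis ℝ (fun m =>
    L (monomial (splitExponent m).1 1) * L (monomial (splitExponent m).2 1)) m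
  rwa [coe_basisMonomials] at this

theorem tensorSquare_inU_mul_inU' {n : ℕ} (L : MvPolynomial (Fin n) ℝ →ₗ[ℝ] ℝ)
    (P Q : MvPolynomial (Fin n) ℝ) : tensorSquare L (inU P * inU' Q) = L P * L Q := by
  have key : ∀ a b : Fin n →₀ ℕ,
      tensorSquare L (inU (monomial a 1) * inU' (monomial b 1)) =
        L (monomial a 1) * L (monomial b 1) := by
    intro a b
    rw [inU, inU', rename_monomial, rename_monomial, monomial_mul, one_mul,
      tensorSquare_monomial, splitExponent_mapDomain]
  have key' : ∀ (a : Fin n →₀ ℕ) (c : ℝ), monomial a c = c • monomial a (1 : ℝ) := fun a c => by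
    rw [smul_monomial, smul_eq_mul, mul_one]
  conv_lhs => rw [P.as_sum, Q.as_sum]
  conv_rhs => rw [P.as_sum, Q.as_sum]
  simp only [inU, inU', map_sum] at key ⊢
  rw [Finset.sum_mul_sum, Finset.sum_mul_sum, map_sum]
  refine Finset.sum_congr rfl fun a _ => ?_
  rw [map_sum]
  refine Finset.sum_congr rfl fun b _ => ?_
  rw [key' a, key' b]
  simp only [map_smul, smul_mul_smul_comm, key, smul_eq_mul]
  ring

theorem WeightLe.add {σ : Type*} {w : σ → ℕ} {d : ℕ} {P Q : MvPolynomial σ ℝ}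
    (hP : WeightLe w d P) (hQ : WeightLe w d Q) : WeightLe w d (P + Q) := by
  intro m hm
  by_cases h : P.coeff m = 0
  · exact hQ m fun h' => hm (by rw [coeff_add, h, h', add_zero])
  · exact hP m h

theorem WeightLe.neg {σ : Type*} {w : σ → ℕ} {d : ℕ} {P : MvPolynomial σ ℝ}
    (hP : WeightLe w d P) : WeightLe w d (-P) := by
  intro m hm
  exact hP m fun h' => hm (by rw [coeff_neg, h', neg_zero])

theorem WeightLe.C_mul {σ : Type*} {w : σ → ℕ} {d : ℕ} {P : MvPolynomial σ ℝ}
    (hP : WeightLe w d P) (c : ℝ) : WeightLe w d (C c * P) := by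
  intro m hm
  exact hP m fun h' => hm (by rw [coeff_C_mul, h', mul_zero])

theorem coeff_inU_mul_inU' {n : ℕ} (P Q : MvPolynomial (Fin n) ℝ) (m : Fin n ⊕ Fin n →₀ ℕ) :
    (inU P * inU' Q).coeff m = P.coeff (splitExponent m).1 * Q.coeff (splitExponent m).2 := by
  classical
  induction P using MvPolynomial.induction_on' with
  | add P P' h h' => rw [inU, map_add, add_mul, coeff_add, ← inU, ← inU, h, h', coeff_add, add_mul]
  | monomial a c =>
    induction Q using MvPolynomial.induction_on' with
    | add Q Q' h h' =>
      rw [inU', map_add, mul_add, coeff_add, ← inU', ← inU', h, h', coeff_add, mul_add]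
    | monomial b d =>
      rw [inU, inU', rename_monomial, rename_monomial, monomial_mul, coeff_monomial, coeff_monomial,
        coeff_monomial]
      have : (Finsupp.mapDomain Sum.inl a + Finsupp.mapDomain Sum.inr b = m) ↔
          (a = (splitExponent m).1 ∧ b = (splitExponent m).2) := by
        rw [← splitExponent.injective.eq_iff, splitExponent_mapDomain, Prod.ext_iff]
      simp only [this]
      by_cases h1 : a = (splitExponent m).1 <;> by_cases h2 : b = (splitExponent m).2 <;>
        simp [h1, h2]

/-- `P` has degree at most `d` in `u`, and also in `u'`. -/
def BidegreeLe {n : ℕ} (d : ℕ) (P : MvPolynomial (Fin n ⊕ Fin n) ℝ) : Prop :=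
  ∀ m, P.coeff m ≠ 0 → (splitExponent m).1.degree ≤ d ∧ (splitExponent m).2.degree ≤ d

theorem bidegreeLe_iff {n d : ℕ} {P : MvPolynomial (Fin n ⊕ Fin n) ℝ} :
    BidegreeLe d P ↔ WeightLe (Sum.elim 1 0) d P ∧ WeightLe (Sum.elim 0 1) d P := by
  have h1 : ∀ m : Fin n ⊕ Fin n →₀ ℕ,
      Finsupp.weight (Sum.elim 1 0) m = (splitExponent m).1.degree := fun m => by
    rw [Finsupp.weight_apply, Finsupp.sum_fintype _ _ (by simp), Finsupp.degree_eq_sum]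
    simp [splitExponent]
  have h2 : ∀ m : Fin n ⊕ Fin n →₀ ℕ,
      Finsupp.weight (Sum.elim 0 1) m = (splitExponent m).2.degree := fun m => by
    rw [Finsupp.weight_apply, Finsupp.sum_fintype _ _ (by simp), Finsupp.degree_eq_sum]
    simp [splitExponent]
  simp only [WeightLe, BidegreeLe, h1, h2]
  exact ⟨fun h => ⟨fun m hm => (h m hm).1, fun m hm => (h m hm).2⟩,
    fun h m hm => ⟨h.1 m hm, h.2 m hm⟩⟩

theorem posSemidef_moments {n d : ℕ} {L : MvPolynomial (Fin n) ℝ →ₗ[ℝ] ℝ}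
    (hL : IsPseudoExpectation (2 * d) L) {ι : Type*} [Fintype ι] (e : ι → Fin n →₀ ℕ)
    (he : ∀ i, (e i).degree ≤ d) :
    (Matrix.of fun i j => L (monomial (e i + e j) 1)).PosSemidef := by
  refine Matrix.PosSemidef.of_dotProduct_mulVec_nonneg ?_ fun x => ?_
  · ext i j
    simp [Matrix.conjTranspose_apply, add_comm]
  · have hd : (∑ i, monomial (e i) (x i)).totalDegree ≤ d := by
      refine totalDegree_finsetSum_le fun i _ => (totalDegree_monomial_le _ _).trans ?_
      exact he i
    have h := hL.map_sq_nonneg (∑ i, monomial (e i) (x i)) (by omega)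
    refine h.trans_eq ?_
    rw [sq, Finset.sum_mul_sum, map_sum, dotProduct]
    refine Finset.sum_congr rfl fun i _ => ?_
    rw [map_sum, Matrix.mulVec, dotProduct, Finset.mul_sum]
    refine Finset.sum_congr rfl fun j _ => ?_
    rw [monomial_mul, show monomial (e i + e j) (x i * x j) =
      (x i * x j) • monomial (e i + e j) (1 : ℝ) by rw [smul_monomial, smul_eq_mul, mul_one],
      map_smul, smul_eq_mul, Matrix.of_apply, Pi.star_apply, star_trivial]
    ring

/-- The value on `S ^ 2` is the quadratic form, at the coefficients of `S`, of the Hadamard product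
of two moment matrices of `L`; the Schur product theorem makes it positive semidefinite. -/
theorem tensorSquare_sq_nonneg {n d : ℕ} {L : MvPolynomial (Fin n) ℝ →ₗ[ℝ] ℝ}
    (hL : IsPseudoExpectation (2 * d) L) {S : MvPolynomial (Fin n ⊕ Fin n) ℝ}
    (hS : BidegreeLe d S) : 0 ≤ tensorSquare L (S ^ 2) := by
  have hA := posSemidef_moments hL (fun m : S.support => (splitExponent m.1).1)
    (fun m => (hS m.1 (mem_support_iff.1 m.2)).1)
  have hB := posSemidef_moments hL (fun m : S.support => (splitExponent m.1).2)
    (fun m => (hS m.1 (mem_support_iff.1 m.2)).2)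
  have h := (hA.hadamard hB).dotProduct_mulVec_nonneg fun m : S.support => S.coeff m.1
  refine h.trans_eq (Eq.symm ?_)
  conv_lhs => rw [S.as_sum, ← Finset.sum_coe_sort, sq, Finset.sum_mul_sum, map_sum]
  rw [dotProduct]
  refine Finset.sum_congr rfl fun i _ => ?_
  rw [map_sum, Matrix.mulVec, dotProduct, Finset.mul_sum]
  refine Finset.sum_congr rfl fun j _ => ?_
  rw [monomial_mul, show monomial (i.1 + j.1) (S.coeff i.1 * S.coeff j.1) =
    (S.coeff i.1 * S.coeff j.1) • monomial (i.1 + j.1) (1 : ℝ) by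
      rw [smul_monomial, smul_eq_mul, mul_one],
    map_smul, smul_eq_mul, tensorSquare_monomial, Matrix.hadamard_apply, Matrix.of_apply,
    Matrix.of_apply, Pi.star_apply, star_trivial, map_add]
  simp only [Prod.fst_add, Prod.snd_add]
  ring

theorem tensorSquare_nonneg_of_isSumSq {n d : ℕ} {L : MvPolynomial (Fin n) ℝ →ₗ[ℝ] ℝ}
    (hL : IsPseudoExpectation (2 * d) L) {Q : MvPolynomial (Fin n ⊕ Fin n) ℝ} (hQ : IsSumSq Q)
    (hd : BidegreeLe (2 * d) Q) : 0 ≤ tensorSquare L Q := by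
  obtain ⟨N, S, rfl⟩ := exists_sum_sq_of_isSumSq hQ
  rw [bidegreeLe_iff] at hd
  rw [map_sum]
  exact Finset.sum_nonneg fun i _ => tensorSquare_sq_nonneg hL
    (bidegreeLe_iff.2 ⟨weightLe_of_sum_sq hd.1 i, weightLe_of_sum_sq hd.2 i⟩)

/-! ### Inequalities for pseudo-expectations on the sphere -/

theorem totalDegree_mul_le_add {σ : Type*} {P Q : MvPolynomial σ ℝ} {a b : ℕ}
    (hP : P.totalDegree ≤ a) (hQ : Q.totalDegree ≤ b) : (P * Q).totalDegree ≤ a + b :=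
  (totalDegree_mul P Q).trans (add_le_add hP hQ)

theorem totalDegree_pow_le_mul {σ : Type*} {P : MvPolynomial σ ℝ} {a : ℕ}
    (hP : P.totalDegree ≤ a) (j : ℕ) : (P ^ j).totalDegree ≤ a * j :=
  (totalDegree_pow P j).trans (by rw [mul_comm]; exact Nat.mul_le_mul_right j hP)

theorem totalDegree_add_le_of_le {σ : Type*} {P Q : MvPolynomial σ ℝ} {a : ℕ}
    (hP : P.totalDegree ≤ a) (hQ : Q.totalDegree ≤ a) : (P + Q).totalDegree ≤ a :=
  (totalDegree_add P Q).trans (max_le hP hQ)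

theorem totalDegree_sub_le_of_le {σ : Type*} {P Q : MvPolynomial σ ℝ} {a : ℕ}
    (hP : P.totalDegree ≤ a) (hQ : Q.totalDegree ≤ a) : (P - Q).totalDegree ≤ a :=
  (totalDegree_sub P Q).trans (max_le hP hQ)

theorem totalDegree_C_mul_le_of_le {σ : Type*} {P : MvPolynomial σ ℝ} {a : ℕ} (r : ℝ)
    (hP : P.totalDegree ≤ a) : (C r * P).totalDegree ≤ a := by
  simpa using totalDegree_mul_le_add (totalDegree_C r).le hP

theorem totalDegree_linForm_le {n : ℕ} (c : EuclideanSpace ℝ (Fin n)) :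
    (linForm c).totalDegree ≤ 1 :=
  totalDegree_finsetSum_le fun i _ => totalDegree_C_mul_le_of_le _ (totalDegree_X i).le

theorem totalDegree_linForm_sq_le {n : ℕ} (c : EuclideanSpace ℝ (Fin n)) :
    (linForm c ^ 2).totalDegree ≤ 2 := totalDegree_pow_le_mul (totalDegree_linForm_le c) 2

theorem totalDegree_normSq_le (n : ℕ) : (normSq n).totalDegree ≤ 2 :=
  totalDegree_finsetSum_le fun i _ => totalDegree_pow_le_mul (totalDegree_X i).le 2

theorem isSumSq_pow_two {R : Type*} [CommRing R] (a : R) : IsSumSq (a ^ 2) := by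
  rw [sq]; exact IsSumSq.mul_self a

theorem isSumSq_pow {R : Type*} [CommRing R] {a : R} (ha : IsSumSq a) (j : ℕ) :
    IsSumSq (a ^ j) := by
  induction j with
  | zero => simp [IsSumSq.one]
  | succ j ih => rw [pow_succ]; exact ih.mul ha

theorem isSumSq_C {σ : Type*} {r : ℝ} (hr : 0 ≤ r) : IsSumSq (C r : MvPolynomial σ ℝ) := by
  rw [← Real.mul_self_sqrt hr, C_mul]
  exact IsSumSq.mul_self _

/-- Pythagoras: the right side is the squared norm of the component of `u` orthogonal to `c`. -/
theorem normSq_sub_linForm_sq {n : ℕ} {c : EuclideanSpace ℝ (Fin n)} (hc : ‖c‖ = 1) :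
    normSq n - linForm c ^ 2 = ∑ i, (X i - C (c i) * linForm c) ^ 2 := by
  have hsum : ∑ i, C (c i) ^ 2 = (1 : MvPolynomial (Fin n) ℝ) := by
    simp_rw [← C_pow]
    rw [← map_sum, ← EuclideanSpace.real_norm_sq_eq, hc]
    simp
  have : ∀ i : Fin n, (X i - C (c i) * linForm c) ^ 2 =
      X i ^ 2 - 2 * linForm c * (C (c i) * X i) + C (c i) ^ 2 * linForm c ^ 2 := fun i => by ring
  simp_rw [this]
  rw [Finset.sum_add_distrib, Finset.sum_sub_distrib, ← Finset.mul_sum, ← Finset.sum_mul, hsum,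
    normSq, ← linForm]
  ring

theorem isSumSq_normSq_sub {n : ℕ} {c : EuclideanSpace ℝ (Fin n)} (hc : ‖c‖ = 1) :
    IsSumSq (normSq n - linForm c ^ 2) := by
  rw [normSq_sub_linForm_sq hc]
  exact IsSumSq.sum_sq _ _

theorem SatisfiesConstraint.map_mul_normSq {n d : ℕ} {L : MvPolynomial (Fin n) ℝ →ₗ[ℝ] ℝ}
    (h : SatisfiesConstraint d L (normSq n - 1)) {Q : MvPolynomial (Fin n) ℝ}
    (hQ : Q.totalDegree + 2 ≤ d) : L (Q * normSq n) = L Q := by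
  have h1 : (normSq n - 1).totalDegree ≤ 2 :=
    totalDegree_sub_le_of_le (totalDegree_normSq_le n) (by simp)
  have := h Q (by omega)
  rw [sub_mul, one_mul, map_sub, mul_comm] at this
  linarith

theorem SatisfiesConstraint.map_mul_normSq_pow {n d : ℕ} {L : MvPolynomial (Fin n) ℝ →ₗ[ℝ] ℝ}
    (h : SatisfiesConstraint d L (normSq n - 1)) {Q : MvPolynomial (Fin n) ℝ} (j : ℕ)
    (hQ : Q.totalDegree + 2 * j ≤ d) : L (Q * normSq n ^ j) = L Q := by
  induction j with
  | zero => simp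
  | succ j ih =>
    rw [pow_succ, ← mul_assoc, h.map_mul_normSq, ih (by omega)]
    have := totalDegree_mul_le_add (le_refl Q.totalDegree)
      (totalDegree_pow_le_mul (totalDegree_normSq_le n) j)
    omega

theorem map_mul_linForm_sq_le {n d : ℕ} {L : MvPolynomial (Fin n) ℝ →ₗ[ℝ] ℝ}
    (hL : IsPseudoExpectation (2 * d) L) (hC : SatisfiesConstraint (2 * d) L (normSq n - 1))
    {c : EuclideanSpace ℝ (Fin n)} (hc : ‖c‖ = 1) {Q : MvPolynomial (Fin n) ℝ} (hQ : IsSumSq Q)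
    (hd : Q.totalDegree + 2 ≤ 2 * d) : L (Q * linForm c ^ 2) ≤ L Q := by
  have h := hL.nonneg_of_isSumSq (hQ.mul (isSumSq_normSq_sub hc))
    ((totalDegree_mul_le_add le_rfl (totalDegree_sub_le_of_le (totalDegree_normSq_le n)
      (totalDegree_linForm_sq_le c))).trans hd)
  rw [mul_sub, map_sub, hC.map_mul_normSq hd] at h
  linarith

/-- The quadratic form `⟨c, u⟩² + δ (‖u‖² - ⟨c, u⟩²)`. -/
noncomputable def tilt {n : ℕ} (δ : ℝ) (c : EuclideanSpace ℝ (Fin n)) : MvPolynomial (Fin n) ℝ :=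
  linForm c ^ 2 + C δ * (normSq n - linForm c ^ 2)

theorem totalDegree_tilt_le {n : ℕ} (δ : ℝ) (c : EuclideanSpace ℝ (Fin n)) :
    (tilt δ c).totalDegree ≤ 2 :=
  totalDegree_add_le_of_le (totalDegree_linForm_sq_le c) (totalDegree_C_mul_le_of_le _
    (totalDegree_sub_le_of_le (totalDegree_normSq_le n) (totalDegree_linForm_sq_le c)))

theorem isSumSq_tilt {n : ℕ} {δ : ℝ} (hδ : 0 ≤ δ) {c : EuclideanSpace ℝ (Fin n)} (hc : ‖c‖ = 1) :
    IsSumSq (tilt δ c) :=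
  (isSumSq_pow_two _).add ((isSumSq_C hδ).mul (isSumSq_normSq_sub hc))

/-- `L (Q * q ^ j) ^ 2 ≤ L (Q * q ^ (j - 1)) * L (Q * q ^ (j + 1))` for sums of squares `Q, q`. -/
theorem map_mul_pow_log_convex {n d : ℕ} {L : MvPolynomial (Fin n) ℝ →ₗ[ℝ] ℝ}
    (hL : IsPseudoExpectation (2 * d) L) {Q q : MvPolynomial (Fin n) ℝ} (hQ : IsSumSq Q)
    (hq : IsSumSq q) {a j : ℕ} (ha : Q.totalDegree ≤ a) (hqd : q.totalDegree ≤ 2)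
    (hd : a + 2 * (j + 2) ≤ 2 * d) :
    L (Q * q ^ (j + 1)) ^ 2 ≤ L (Q * q ^ j) * L (Q * q ^ (j + 2)) := by
  -- Cauchy–Schwarz through the discriminant of `x ↦ L (Q q^j (x q + 1)²)`.
  have key : ∀ x : ℝ, 0 ≤ L (Q * q ^ (j + 2)) * (x * x) + (2 * L (Q * q ^ (j + 1))) * x +
      L (Q * q ^ j) := fun x => by
    have hs : IsSumSq (Q * q ^ j * (C x * q + 1) ^ 2) :=
      (hQ.mul (isSumSq_pow hq j)).mul (isSumSq_pow_two _)
    have h := hL.nonneg_of_isSumSq hs ?_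
    · rw [show Q * q ^ j * (C x * q + 1) ^ 2 = C (x * x) * (Q * q ^ (j + 2)) +
        C (2 * x) * (Q * q ^ (j + 1)) + Q * q ^ j by simp only [map_mul, map_ofNat]; ring] at h
      simp only [map_add, ← smul_eq_C_mul, map_smul, smul_eq_mul] at h
      linarith
    · refine (totalDegree_mul_le_add (totalDegree_mul_le_add ha (totalDegree_pow_le_mul hqd j))
        (totalDegree_pow_le_mul (totalDegree_add_le_of_le (totalDegree_C_mul_le_of_le x hqd)
          (by simp)) 2)).trans (by omega)
  have := discrim_le_zero key
  rw [discrim] at this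
  nlinarith

/-- If a log-convex sequence decreases by at most the factor `ρ ^ k` from `0` to `k`, then it
decreases by at most the factor `ρ` in the last step. -/
theorem last_ratio_ge {b : ℕ → ℝ} {ρ : ℝ} (hρ : 0 < ρ) (m : ℕ) (hb : ∀ j ≤ m + 1, 0 ≤ b j)
    (hconv : ∀ j < m, b (j + 1) ^ 2 ≤ b j * b (j + 2))
    (h : ρ ^ (m + 1) * b 0 ≤ b (m + 1)) : ρ * b m ≤ b (m + 1) := by
  by_contra! hlt
  -- If the last ratio is below `ρ`, log-convexity pushes this down to every earlier ratio, and the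
  -- product of all ratios contradicts `h`. Products replace ratios since terms may vanish.
  have step : ∀ i ≤ m, b (m - i + 1) < ρ * b (m - i) := by
    intro i hi
    induction i with
    | zero => simpa using hlt
    | succ i ih =>
      have h1 := ih (by omega)
      obtain ⟨j, hj⟩ : ∃ j, m - i = j + 1 := ⟨m - i - 1, by omega⟩
      rw [show m - (i + 1) = j by omega]
      rw [hj] at h1
      have h2 := hconv j (by omega)
      have h3 := hb j (by omega)
      have hb2 := hb (j + 2) (by omega)
      have hpos : 0 < b (j + 1) := by
        by_contra! hle
        nlinarith
      have h4 : b (j + 1) ^ 2 ≤ b j * (ρ * b (j + 1)) := h2.trans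
        (mul_le_mul_of_nonneg_left h1.le h3)
      have h5 : b (j + 1) ≤ ρ * b j := by nlinarith
      rcases h5.lt_or_eq with h6 | h6
      · exact h6
      · exfalso
        have hbj : 0 < b j := by nlinarith
        have : b j * b (j + 2) < b j * (ρ * b (j + 1)) := mul_lt_mul_of_pos_left h1 hbj
        nlinarith
  have hpow : ∀ i ≤ m + 1, b i ≤ ρ ^ i * b 0 ∧ (0 < i → b i < ρ ^ i * b 0) := by
    intro i hi
    induction i with
    | zero => simp
    | succ i ih =>
      have h1 := step (m - i) (by omega)
      rw [show m - (m - i) = i by omega] at h1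
      have h2 : b (i + 1) < ρ ^ (i + 1) * b 0 := by
        calc b (i + 1) < ρ * b i := h1
          _ ≤ ρ * (ρ ^ i * b 0) := mul_le_mul_of_nonneg_left (ih (by omega)).1 hρ.le
          _ = _ := by ring
      exact ⟨h2.le, fun _ => h2⟩
  exact absurd ((hpow (m + 1) le_rfl).2 (Nat.succ_pos m)) (not_lt.2 h)

/-- The tilt exceeds `linForm c ^ 2` by a sum of squares; the factors are exchanged one at a time,
the others staying in the sum of squares `Q`. -/
theorem tilt_pow_ge {n d : ℕ} {L : MvPolynomial (Fin n) ℝ →ₗ[ℝ] ℝ}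
    (hL : IsPseudoExpectation (2 * d) L) {c : EuclideanSpace ℝ (Fin n)} (hc : ‖c‖ = 1) {δ : ℝ}
    (hδ : 0 ≤ δ) {Q : MvPolynomial (Fin n) ℝ} (hQ : IsSumSq Q) (j : ℕ)
    (hd : Q.totalDegree + 2 * j ≤ 2 * d) :
    L (Q * (linForm c ^ 2) ^ j) ≤ L (Q * tilt δ c ^ j) := by
  induction j generalizing Q with
  | zero => simp
  | succ j ih =>
    have hdp := totalDegree_linForm_sq_le c
    have hdt := totalDegree_tilt_le δ c
    have h1 : L (Q * (linForm c ^ 2) ^ (j + 1)) ≤ L (Q * linForm c ^ 2 * tilt δ c ^ j) := by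
      rw [pow_succ', ← mul_assoc]
      refine ih (hQ.mul (isSumSq_pow_two _)) ?_
      have := totalDegree_mul_le_add (le_refl Q.totalDegree) hdp
      omega
    refine h1.trans ?_
    have h2 := hL.nonneg_of_isSumSq ((hQ.mul (isSumSq_pow (isSumSq_tilt hδ hc) j)).mul
      ((isSumSq_C hδ).mul (isSumSq_normSq_sub hc))) ?_
    · rw [← sub_nonneg, ← map_sub]
      refine h2.trans_eq (congrArg L (Eq.symm ?_))
      rw [pow_succ]
      conv_lhs => enter [1, 2, 2]; rw [tilt]
      ring
    · refine (totalDegree_mul_le_add (totalDegree_mul_le_add le_rfl (totalDegree_pow_le_mul hdt j))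
        (totalDegree_C_mul_le_of_le _ (totalDegree_sub_le_of_le (totalDegree_normSq_le n)
          hdp))).trans (by omega)

theorem map_linForm_pow_le {n d : ℕ} {L : MvPolynomial (Fin n) ℝ →ₗ[ℝ] ℝ}
    (hL : IsPseudoExpectation (2 * d) L) (hC : SatisfiesConstraint (2 * d) L (normSq n - 1))
    {c : EuclideanSpace ℝ (Fin n)} (hc : ‖c‖ = 1) {Q : MvPolynomial (Fin n) ℝ} (hQ : IsSumSq Q)
    (i : ℕ) (hd : Q.totalDegree + 2 * i ≤ 2 * d) : L (Q * (linForm c ^ 2) ^ i) ≤ L Q := by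
  induction i with
  | zero => simp
  | succ i ih =>
    refine le_trans ?_ (ih (by omega))
    rw [pow_succ, ← mul_assoc]
    refine map_mul_linForm_sq_le hL hC hc (hQ.mul (isSumSq_pow (isSumSq_pow_two _) i)) ?_
    have := totalDegree_mul_le_add (le_refl Q.totalDegree)
      (totalDegree_pow_le_mul (totalDegree_linForm_sq_le c) i)
    omega

/-- Expand binomially with `‖u‖² = 1`. The terms containing `p = ⟨c,u⟩²` satisfy `L(p^i) ≤ L p`; the
remaining `τ^(k+1)` is at most `τ · L p`, and this is where `τ^k ≤ L p` enters. -/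
theorem map_add_normSq_pow_le {n k : ℕ} {L : MvPolynomial (Fin n) ℝ →ₗ[ℝ] ℝ}
    (hL : IsPseudoExpectation (2 * (1 + 2 * k)) L)
    (hC : SatisfiesConstraint (2 * (1 + 2 * k)) L (normSq n - 1)) (hk : 1 ≤ k)
    {c : EuclideanSpace ℝ (Fin n)} (hc : ‖c‖ = 1) {τ : ℝ} (hτ : 0 ≤ τ)
    (hτk : τ ^ k ≤ L (linForm c ^ 2)) :
    L ((linForm c ^ 2 + C τ * normSq n) ^ (1 + k)) ≤ (1 + τ) ^ (k + 2) * L (linForm c ^ 2) := by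
  set p := linForm c ^ 2 with hp
  set a := L p with ha
  have hdp : p.totalDegree ≤ 2 := totalDegree_linForm_sq_le c
  have hterm : ∀ i ≤ k + 1, L (p ^ i * (C τ * normSq n) ^ (k + 1 - i) * ((k + 1).choose i :
      MvPolynomial (Fin n) ℝ)) = τ ^ (k + 1 - i) * (k + 1).choose i * L (p ^ i) := by
    intro i hi
    have : p ^ i * (C τ * normSq n) ^ (k + 1 - i) * ((k + 1).choose i : MvPolynomial (Fin n) ℝ) =
        C (τ ^ (k + 1 - i) * (k + 1).choose i) * (p ^ i * normSq n ^ (k + 1 - i)) := by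
      rw [mul_pow, C_mul, C_pow, map_natCast]; ring
    rw [this, ← smul_eq_C_mul, map_smul, smul_eq_mul, hC.map_mul_normSq_pow]
    have := totalDegree_pow_le_mul hdp i
    omega
  rw [add_comm 1 k, add_pow, map_sum]
  rw [Finset.sum_congr rfl fun i hi => hterm i (by have := Finset.mem_range.1 hi; omega)]
  rw [Finset.sum_range_succ']
  have hle : ∀ i < k + 1, L (p ^ (i + 1)) ≤ a := fun i hi => by
    have := map_linForm_pow_le hL hC hc (isSumSq_pow_two (linForm c)) i (by
      rw [← hp]; omega)
    rw [← hp] at this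
    rwa [pow_succ']
  have ha0 : 0 ≤ a := (pow_nonneg hτ k).trans hτk
  have h1 : (1 + τ) ^ (k + 1) = ∑ i ∈ Finset.range (k + 1),
      τ ^ (k + 1 - (i + 1)) * (k + 1).choose (i + 1) + τ ^ (k + 1) := by
    rw [add_pow, Finset.sum_range_succ']
    simp
  calc _ ≤ ∑ i ∈ Finset.range (k + 1), τ ^ (k + 1 - (i + 1)) * (k + 1).choose (i + 1) * a +
        τ * a := by
        refine add_le_add (Finset.sum_le_sum fun i hi => ?_) ?_
        · exact mul_le_mul_of_nonneg_left (hle i (Finset.mem_range.1 hi)) (by positivity)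
        · simp only [Nat.sub_zero, Nat.choose_zero_right, Nat.cast_one, mul_one, pow_zero,
            hL.map_one]
          rw [pow_succ']
          exact mul_le_mul_of_nonneg_left hτk hτ
    _ = ((1 + τ) ^ (k + 1) - τ ^ (k + 1) + τ) * a := by rw [h1, ← Finset.sum_mul]; ring
    _ ≤ (1 + τ) ^ (k + 2) * a := by
        refine mul_le_mul_of_nonneg_right ?_ ha0
        have h2 : 1 ≤ (1 + τ) ^ (k + 1) := one_le_pow₀ (by linarith)
        have h3 : 0 ≤ τ ^ (k + 1) := by positivity
        rw [pow_succ (1 + τ) (k + 1)]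
        nlinarith

theorem isSumSq_of_sosLe {σ : Type*} {P Q : MvPolynomial σ ℝ} (h : SOSLe P Q) (hP : IsSumSq P) :
    IsSumSq Q := by
  have : IsSumSq (P + (Q - P)) := hP.add h
  rwa [add_sub_cancel] at this

theorem map_le_of_sosLe {n d : ℕ} {L : MvPolynomial (Fin n) ℝ →ₗ[ℝ] ℝ}
    (hL : IsPseudoExpectation (2 * d) L) {P Q R : MvPolynomial (Fin n) ℝ} (h : SOSLe P Q)
    (hR : IsSumSq R) {a b : ℕ} (hP : P.totalDegree ≤ a) (hQ : Q.totalDegree ≤ a)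
    (hRb : R.totalDegree ≤ b) (hd : a + b ≤ 2 * d) : L (P * R) ≤ L (Q * R) := by
  have h1 := hL.nonneg_of_isSumSq (IsSumSq.mul h hR)
    ((totalDegree_mul_le_add (totalDegree_sub_le_of_le hQ hP) hRb).trans hd)
  rw [sub_mul, map_sub] at h1
  linarith

/-- Explains the term `3(1/k + 1)τ`: multiplied by `k` it is `3(k + 1)τ`, more than the `(k + 2)τ`
lost in `(1 + τ)^(k+2)`. -/
theorem one_add_pow_le_exp {k : ℕ} (hk : 1 ≤ k) {ε τ : ℝ} (hτ : 0 ≤ τ) :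
    Real.exp (-((ε + 3 * (1 / (k : ℝ) + 1) * τ) * k)) * (1 + τ) ^ (k + 2) ≤
      Real.exp (-(ε * k)) := by
  have h1 : (1 + τ) ^ (k + 2) ≤ Real.exp (((k + 2 : ℕ) : ℝ) * τ) := by
    rw [Real.exp_nat_mul]
    exact pow_le_pow_left₀ (by linarith) (by linarith [Real.add_one_le_exp τ]) _
  refine (mul_le_mul_of_nonneg_left h1 (Real.exp_nonneg _)).trans ?_
  rw [← Real.exp_add]
  refine Real.exp_le_exp.2 ?_
  have hk0 : (0 : ℝ) < k := by exact_mod_cast hk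
  have hk1 : (1 : ℝ) ≤ k := by exact_mod_cast hk
  have : (ε + 3 * (1 / (k : ℝ) + 1) * τ) * k = ε * k + 3 * (1 + k) * τ := by
    field_simp
  rw [this]
  push_cast
  nlinarith

/-- The bounds for the mean of the random weight. -/
theorem mean_weight_bounds {n m : ℕ} {L : MvPolynomial (Fin n) ℝ →ₗ[ℝ] ℝ}
    (hL : IsPseudoExpectation (2 * (1 + 2 * (m + 1))) L)
    (hC : SatisfiesConstraint (2 * (1 + 2 * (m + 1))) L (normSq n - 1))
    {c : EuclideanSpace ℝ (Fin n)} (hc : ‖c‖ = 1) {ε τ : ℝ} (hτ : 0 ≤ τ)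
    (hpos : 0 < L (linForm c ^ 2)) (hτk : τ ^ (m + 1) ≤ L (linForm c ^ 2))
    (hε : Real.exp (-(ε * (m + 1 : ℕ))) * L (linForm c ^ 2) ≤
      L (linForm c ^ (2 * (1 + 2 * (m + 1)))))
    {Wbar : MvPolynomial (Fin n) ℝ} (hW : Wbar.totalDegree ≤ 2 * (1 + (m + 1)))
    (h1 : SOSLe (linForm c ^ (2 * (1 + (m + 1)))) Wbar)
    (h2 : SOSLe Wbar ((linForm c ^ 2 + C τ * normSq n) ^ (1 + (m + 1)))) {θ : ℝ}
    (hθ : θ = ε + 3 * (1 / ((m + 1 : ℕ) : ℝ) + 1) * τ) {δ : ℝ} (hδ : 0 ≤ δ) :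
    0 < L Wbar ∧ Real.exp (-(θ * (m + 1 : ℕ))) * L Wbar ≤ L (Wbar * tilt δ c ^ m) ∧
      (Real.exp (-θ) - δ) * L (Wbar * tilt δ c ^ m) ≤
        L (Wbar * tilt δ c ^ m * linForm c ^ 2) := by
  have hdp := totalDegree_linForm_sq_le c
  have hdt := totalDegree_tilt_le δ c
  have hSW : IsSumSq Wbar := isSumSq_of_sosLe h1 (by rw [pow_mul]; exact isSumSq_pow (isSumSq_pow_two _) _)
  have hd1 : (linForm c ^ (2 * (1 + (m + 1)))).totalDegree ≤ 2 * (1 + (m + 1)) := by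
    simpa using totalDegree_pow_le_mul (totalDegree_linForm_le c) (2 * (1 + (m + 1)))
  have hd2 : ((linForm c ^ 2 + C τ * normSq n) ^ (1 + (m + 1))).totalDegree ≤ 2 * (1 + (m + 1)) :=
    totalDegree_pow_le_mul (totalDegree_add_le_of_le hdp
      (totalDegree_C_mul_le_of_le _ (totalDegree_normSq_le n))) _
  have hlow : Real.exp (-(ε * (m + 1 : ℕ))) * L (linForm c ^ 2) ≤
      L (Wbar * (linForm c ^ 2) ^ (m + 1)) := by
    refine hε.trans ?_
    have := map_le_of_sosLe hL h1 (isSumSq_pow (isSumSq_pow_two (linForm c)) (m + 1)) hd1 hW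
      (totalDegree_pow_le_mul hdp (m + 1)) (by omega)
    rwa [← pow_mul, ← pow_add, show 2 * (1 + (m + 1)) + 2 * (m + 1) = 2 * (1 + 2 * (m + 1)) by ring,
      pow_mul (linForm c) 2 (m + 1)] at this
  have hup : L Wbar ≤ (1 + τ) ^ (m + 1 + 2) * L (linForm c ^ 2) := by
    have := map_le_of_sosLe hL h2 IsSumSq.one hW hd2 totalDegree_one.le (by omega)
    rw [mul_one, mul_one] at this
    exact this.trans (map_add_normSq_pow_le hL hC (by omega) hc hτ hτk)
  have hWk : L (Wbar * (linForm c ^ 2) ^ (m + 1)) ≤ L (Wbar * (linForm c ^ 2) ^ m) := by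
    rw [pow_succ, ← mul_assoc]
    refine map_mul_linForm_sq_le hL hC hc (hSW.mul (isSumSq_pow (isSumSq_pow_two _) m)) ?_
    have := totalDegree_mul_le_add hW (totalDegree_pow_le_mul hdp m)
    omega
  have hpos' : 0 < L (Wbar * (linForm c ^ 2) ^ (m + 1)) := lt_of_lt_of_le (by positivity) hlow
  have hWpos : 0 < L Wbar := hpos'.trans_le
    (map_linForm_pow_le hL hC hc hSW (m + 1) (by omega))
  have hratio : Real.exp (-(θ * (m + 1 : ℕ))) * L Wbar ≤ L (Wbar * (linForm c ^ 2) ^ (m + 1)) := by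
    refine le_trans ?_ hlow
    calc _ ≤ Real.exp (-(θ * (m + 1 : ℕ))) * ((1 + τ) ^ (m + 1 + 2) * L (linForm c ^ 2)) :=
          mul_le_mul_of_nonneg_left hup (Real.exp_nonneg _)
      _ ≤ _ := by
          rw [← mul_assoc, hθ]
          exact mul_le_mul_of_nonneg_right (one_add_pow_le_exp (by omega) hτ) hpos.le
  have htilt : ∀ j ≤ m + 1, L (Wbar * (linForm c ^ 2) ^ j) ≤ L (Wbar * tilt δ c ^ j) :=
    fun j hj => tilt_pow_ge hL hc hδ hSW j (by omega)
  have hnn : ∀ j ≤ m + 1, 0 ≤ L (Wbar * tilt δ c ^ j) := fun j hj => by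
    refine hL.nonneg_of_isSumSq (hSW.mul (isSumSq_pow (isSumSq_tilt hδ hc) j)) ?_
    have := totalDegree_mul_le_add hW (totalDegree_pow_le_mul hdt j)
    omega
  refine ⟨hWpos, hratio.trans (hWk.trans (htilt m (by omega))), ?_⟩
  -- Only an average loss of `e^(-θ)` per factor is known; log-convexity transfers it to the last
  -- factor.
  have hlast := last_ratio_ge (b := fun j => L (Wbar * tilt δ c ^ j)) (Real.exp_pos (-θ)) m hnn
    (fun j hj => map_mul_pow_log_convex hL hSW (isSumSq_tilt hδ hc) hW hdt (by omega)) (by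
      rw [← Real.exp_nat_mul]
      simp only [pow_zero, mul_one]
      refine le_trans (le_of_eq ?_) (hratio.trans (htilt (m + 1) le_rfl))
      congr 2; ring)
  -- Replacing the last tilt by `⟨c,u⟩²` costs at most `δ` times the total weight, because `‖u‖² =
  -- 1`.
  have hsplit : L (Wbar * tilt δ c ^ (m + 1)) = L (Wbar * tilt δ c ^ m * linForm c ^ 2) +
      δ * (L (Wbar * tilt δ c ^ m * normSq n) - L (Wbar * tilt δ c ^ m * linForm c ^ 2)) := by
    have hpoly : Wbar * tilt δ c ^ (m + 1) = Wbar * tilt δ c ^ m * linForm c ^ 2 +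
        C δ * (Wbar * tilt δ c ^ m * normSq n - Wbar * tilt δ c ^ m * linForm c ^ 2) := by
      rw [pow_succ]
      conv_lhs => enter [2, 2]; rw [tilt]
      ring
    rw [hpoly, map_add, ← smul_eq_C_mul, map_smul, map_sub, smul_eq_mul]
  have hdeg := totalDegree_mul_le_add hW (totalDegree_pow_le_mul hdt m)
  rw [hC.map_mul_normSq (by omega)] at hsplit
  have hp0 : 0 ≤ L (Wbar * tilt δ c ^ m * linForm c ^ 2) := by
    refine hL.nonneg_of_isSumSq ((hSW.mul (isSumSq_pow (isSumSq_tilt hδ hc) m)).mul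
      (isSumSq_pow_two _)) ?_
    have := totalDegree_mul_le_add hdeg hdp
    omega
  nlinarith

/-! ### Gaussian quadratic forms -/

section Gaussian

variable {n : ℕ}

theorem map_inner_stdGaussian {c : EuclideanSpace ℝ (Fin n)} (hc : ‖c‖ = 1) :
    (stdGaussian (EuclideanSpace ℝ (Fin n))).map (fun ξ => inner ℝ c ξ) = gaussianReal 0 1 := by
  have h := IsGaussian.map_eq_gaussianReal (μ := stdGaussian (EuclideanSpace ℝ (Fin n)))
    (innerSL ℝ c)
  rw [integral_strongDual_stdGaussian, variance_dual_stdGaussian, innerSL_apply_norm, hc] at h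
  simpa using h

theorem memLp_inner_stdGaussian (v : EuclideanSpace ℝ (Fin n)) (p : ENNReal) (hp : p ≠ ⊤) :
    MemLp (fun ξ => inner ℝ v ξ) p (stdGaussian (EuclideanSpace ℝ (Fin n))) :=
  IsGaussian.memLp_dual _ (innerSL ℝ v) p hp

theorem integral_inner_stdGaussian (v : EuclideanSpace ℝ (Fin n)) :
    ∫ ξ, inner ℝ v ξ ∂stdGaussian (EuclideanSpace ℝ (Fin n)) = 0 :=
  integral_strongDual_stdGaussian (innerSL ℝ v)

theorem integral_inner_mul_inner_stdGaussian (v w : EuclideanSpace ℝ (Fin n)) :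
    ∫ ξ, inner ℝ v ξ * inner ℝ w ξ ∂stdGaussian (EuclideanSpace ℝ (Fin n)) = inner ℝ v w := by
  have h := covarianceBilin_apply (μ := stdGaussian (EuclideanSpace ℝ (Fin n)))
    IsGaussian.memLp_two_id v w
  rw [covarianceBilin_stdGaussian] at h
  rw [innerSL_apply_apply] at h
  simpa [integral_id_stdGaussian] using h.symm

theorem indepFun_inner_stdGaussian {c w : EuclideanSpace ℝ (Fin n)} (h : inner ℝ c w = 0) :
    IndepFun (fun ξ => inner ℝ c ξ) (fun ξ => inner ℝ w ξ)
      (stdGaussian (EuclideanSpace ℝ (Fin n))) := by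
  have hG : HasGaussianLaw (fun ξ => (inner ℝ c ξ, inner ℝ w ξ))
      (stdGaussian (EuclideanSpace ℝ (Fin n))) :=
    (IsGaussian.hasGaussianLaw_id (μ := stdGaussian (EuclideanSpace ℝ (Fin n)))).map_fun
      ((innerSL ℝ c).prod (innerSL ℝ w))
  refine hG.indepFun_of_covariance_eq_zero ?_
  rw [covariance_eq_sub (memLp_inner_stdGaussian c 2 (by simp))
    (memLp_inner_stdGaussian w 2 (by simp)), integral_inner_stdGaussian, zero_mul, sub_zero]
  simpa [h] using integral_inner_mul_inner_stdGaussian c w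

/-- The mass of `[R, R + 1]` under the standard Gaussian measure. -/
noncomputable def slabMass (R : ℝ) : ℝ := (gaussianReal 0 1).real (Set.Icc R (R + 1))

/-- The second moment of the standard Gaussian measure on `[R, R + 1]`. -/
noncomputable def slabSecond (R : ℝ) : ℝ := ∫ x in Set.Icc R (R + 1), x ^ 2 ∂gaussianReal 0 1

/-- The fourth moment of the standard Gaussian measure. -/
noncomputable def gaussFourth : ℝ := ∫ x, x ^ 4 ∂gaussianReal 0 1

/-- The vectors `ξ` with `⟨c, ξ⟩ ∈ [R, R + 1]`. -/
def slab (R : ℝ) (c : EuclideanSpace ℝ (Fin n)) : Set (EuclideanSpace ℝ (Fin n)) :=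
  {ξ | inner ℝ c ξ ∈ Set.Icc R (R + 1)}

theorem measurable_inner_left (c : EuclideanSpace ℝ (Fin n)) :
    Measurable fun ξ : EuclideanSpace ℝ (Fin n) => inner ℝ c ξ :=
  (innerSL ℝ c).continuous.measurable

theorem measurableSet_slab (R : ℝ) (c : EuclideanSpace ℝ (Fin n)) : MeasurableSet (slab R c) :=
  measurable_inner_left c measurableSet_Icc

theorem integrable_inner_sq (v : EuclideanSpace ℝ (Fin n)) :
    Integrable (fun ξ => inner ℝ v ξ ^ 2) (stdGaussian (EuclideanSpace ℝ (Fin n))) :=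
  (memLp_inner_stdGaussian v 2 (by simp)).integrable_sq

/-- Split `v = a c + w` with `w ⊥ c`. The Gaussians `⟨c,ξ⟩` and `⟨w,ξ⟩` are independent, and the
slab restricts only the first: the cross term vanishes and the square of the second contributes its
variance times the mass of the slab. -/
theorem setIntegral_slab_inner_sq {c : EuclideanSpace ℝ (Fin n)} (hc : ‖c‖ = 1) (R : ℝ)
    (v : EuclideanSpace ℝ (Fin n)) :
    ∫ ξ in slab R c, inner ℝ v ξ ^ 2 ∂stdGaussian (EuclideanSpace ℝ (Fin n)) =
      slabSecond R * inner ℝ v c ^ 2 + slabMass R * (‖v‖ ^ 2 - inner ℝ v c ^ 2) := by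
  set γ := stdGaussian (EuclideanSpace ℝ (Fin n)) with hγ
  set a : ℝ := inner ℝ v c with ha
  set w := v - a • c with hw
  have hcw : inner ℝ c w = 0 := by
    rw [hw, inner_sub_right, inner_smul_right, real_inner_self_eq_norm_sq, hc,
      real_inner_comm v c, ← ha]
    ring
  have hww : inner ℝ w w = ‖v‖ ^ 2 - a ^ 2 := by
    rw [hw, inner_sub_left, inner_smul_left, ← hw, hcw, hw, inner_sub_right, inner_smul_right,
      real_inner_self_eq_norm_sq, ← ha]
    simp; ring
  have hv : ∀ ξ, inner ℝ v ξ = a * inner ℝ c ξ + inner ℝ w ξ := fun ξ => by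
    rw [hw, inner_sub_left, inner_smul_left]; simp
  have hind := indepFun_inner_stdGaussian hcw
  rw [← hγ] at hind
  have hms := measurable_inner_left c
  have hmw := measurable_inner_left w
  let z : ℝ → ℝ := Set.indicator (Set.Icc R (R + 1)) 1
  have hz : Measurable z := measurable_one.indicator measurableSet_Icc
  have hmap := map_inner_stdGaussian hc
  rw [← hγ] at hmap
  rw [← integral_indicator (measurableSet_slab R c)]
  have hexp : ∀ ξ, (slab R c).indicator (fun ξ => inner ℝ v ξ ^ 2) ξ =
      a ^ 2 * (inner ℝ c ξ ^ 2 * z (inner ℝ c ξ)) +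
        (2 * a * ((inner ℝ c ξ * z (inner ℝ c ξ)) * inner ℝ w ξ) +
          z (inner ℝ c ξ) * inner ℝ w ξ ^ 2) := fun ξ => by
    by_cases h : ξ ∈ slab R c
    · have : z (inner ℝ c ξ) = 1 := Set.indicator_of_mem (s := Set.Icc R (R + 1)) h _
      rw [Set.indicator_of_mem h, this, hv]; ring
    · have : z (inner ℝ c ξ) = 0 := Set.indicator_of_notMem (s := Set.Icc R (R + 1)) h _
      rw [Set.indicator_of_notMem h, this]; ring
  have hzb : ∀ x, ‖z x‖ ≤ 1 := fun x => by
    by_cases h : x ∈ Set.Icc R (R + 1)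
    · simp [z, h]
    · simp [z, h]
  have hzm : AEStronglyMeasurable (fun ξ => z (inner ℝ c ξ)) γ :=
    (hz.comp hms).aestronglyMeasurable
  have i1 : Integrable (fun ξ => inner ℝ c ξ ^ 2 * z (inner ℝ c ξ)) γ := by
    simpa only [mul_comm] using (integrable_inner_sq c).bdd_mul hzm (ae_of_all _ fun ξ => hzb _)
  have i2 : Integrable (fun ξ => (inner ℝ c ξ * z (inner ℝ c ξ)) * inner ℝ w ξ) γ := by
    have := ((memLp_inner_stdGaussian c 2 (by simp)).integrable_mul
      (memLp_inner_stdGaussian w 2 (by simp))).bdd_mul hzm (ae_of_all _ fun ξ => hzb _)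
    refine this.congr (ae_of_all _ fun ξ => ?_)
    simp only [Pi.mul_apply]; ring
  have i3 : Integrable (fun ξ => z (inner ℝ c ξ) * inner ℝ w ξ ^ 2) γ :=
    (integrable_inner_sq w).bdd_mul hzm (ae_of_all _ fun ξ => hzb _)
  have i23 : Integrable (fun ξ => 2 * a * ((inner ℝ c ξ * z (inner ℝ c ξ)) * inner ℝ w ξ) +
      z (inner ℝ c ξ) * inner ℝ w ξ ^ 2) γ := (i2.const_mul _).add i3
  simp_rw [hexp]
  rw [integral_add (i1.const_mul _) i23, integral_add (i2.const_mul _) i3,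
    integral_const_mul, integral_const_mul]
  have e2 : ∫ ξ, (inner ℝ c ξ * z (inner ℝ c ξ)) * inner ℝ w ξ ∂γ = 0 := by
    have := hind.integral_fun_comp_mul_comp (f := fun x => x * z x) (g := fun x => x)
      hms.aemeasurable hmw.aemeasurable (measurable_id.mul hz).aestronglyMeasurable
      measurable_id.aestronglyMeasurable
    rw [this, hγ, integral_inner_stdGaussian, mul_zero]
  have e3 : ∫ ξ, z (inner ℝ c ξ) * inner ℝ w ξ ^ 2 ∂γ = slabMass R * (‖v‖ ^ 2 - a ^ 2) := by
    have := hind.integral_fun_comp_mul_comp (f := z) (g := fun x => x ^ 2)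
      hms.aemeasurable hmw.aemeasurable hz.aestronglyMeasurable
      (measurable_id.pow_const 2).aestronglyMeasurable
    rw [this]
    congr 1
    · rw [← integral_map (φ := fun ξ => inner ℝ c ξ) hms.aemeasurable hz.aestronglyMeasurable,
        hmap, integral_indicator_one measurableSet_Icc, slabMass]
    · simp_rw [sq (inner ℝ w _)]
      rw [hγ, integral_inner_mul_inner_stdGaussian, hww]
  have e1 : ∫ ξ, inner ℝ c ξ ^ 2 * z (inner ℝ c ξ) ∂γ = slabSecond R := by
    rw [← integral_map (φ := fun ξ => inner ℝ c ξ) (f := fun x => x ^ 2 * z x) hms.aemeasurable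
      ((measurable_id.pow_const 2).mul hz).aestronglyMeasurable, hmap, slabSecond,
      ← integral_indicator measurableSet_Icc]
    congr 1
    ext x
    by_cases h : x ∈ Set.Icc R (R + 1)
    · simp [z, h]
    · simp [z, h]
  rw [e1, e2, e3]
  ring

theorem integrable_inner_pow_four (v : EuclideanSpace ℝ (Fin n)) :
    Integrable (fun ξ => inner ℝ v ξ ^ 4) (stdGaussian (EuclideanSpace ℝ (Fin n))) := by
  have := (memLp_inner_stdGaussian v 4 (by simp)).integrable_norm_pow (p := 4) (by simp)
  refine this.congr (ae_of_all _ fun ξ => ?_)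
  simp only [Real.norm_eq_abs]
  exact Even.pow_abs (by decide) _

theorem integral_inner_pow_four (v : EuclideanSpace ℝ (Fin n)) :
    ∫ ξ, inner ℝ v ξ ^ 4 ∂stdGaussian (EuclideanSpace ℝ (Fin n)) = gaussFourth * ‖v‖ ^ 4 := by
  by_cases hv : v = 0
  · simp [hv]
  have hc : ‖(‖v‖⁻¹ • v)‖ = 1 := norm_smul_inv_norm (𝕜 := ℝ) hv
  have h : ∀ ξ, inner ℝ v ξ ^ 4 = ‖v‖ ^ 4 * inner ℝ (‖v‖⁻¹ • v) ξ ^ 4 := fun ξ => by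
    rw [inner_smul_left]
    have : ‖v‖ ≠ 0 := norm_ne_zero_iff.2 hv
    simp only [conj_trivial]
    field_simp
  simp_rw [h]
  rw [integral_const_mul, ← integral_map (φ := fun ξ => inner ℝ (‖v‖⁻¹ • v) ξ)
    (f := fun x => x ^ 4) (measurable_inner_left _).aemeasurable
    (measurable_id.pow_const 4).aestronglyMeasurable, map_inner_stdGaussian hc, gaussFourth, mul_comm]

/-- Cauchy–Schwarz with weights `‖v l‖²`, so that the second moment of a Gaussian quadratic form is
at most `gaussFourth` times its squared trace, with no dependence on dimension. Zero vectors are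
harmless since `0 / 0 = 0`. -/
theorem sum_inner_sq_sq_le {N : ℕ} (v : Fin N → EuclideanSpace ℝ (Fin n))
    (ξ : EuclideanSpace ℝ (Fin n)) :
    (∑ l, inner ℝ (v l) ξ ^ 2) ^ 2 ≤
      (∑ l, ‖v l‖ ^ 2) * ∑ l, inner ℝ (v l) ξ ^ 4 / ‖v l‖ ^ 2 := by
  refine Finset.sum_sq_le_sum_mul_sum_of_sq_le_mul _ (fun l _ => by positivity)
    (fun l _ => by positivity) fun l _ => ?_
  by_cases h : v l = 0
  · simp [h]
  · have : ‖v l‖ ≠ 0 := norm_ne_zero_iff.2 h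
    field_simp
    exact le_rfl

theorem gaussFourth_nonneg : 0 ≤ gaussFourth := integral_nonneg fun x => by positivity

theorem lintegral_sum_inner_sq_sq_le {N : ℕ} (v : Fin N → EuclideanSpace ℝ (Fin n)) :
    ∫⁻ ξ, ENNReal.ofReal ((∑ l, inner ℝ (v l) ξ ^ 2) ^ 2)
      ∂stdGaussian (EuclideanSpace ℝ (Fin n)) ≤
      ENNReal.ofReal (gaussFourth * (∑ l, ‖v l‖ ^ 2) ^ 2) := by
  have hint : Integrable (fun ξ => (∑ l, ‖v l‖ ^ 2) * ∑ l, inner ℝ (v l) ξ ^ 4 / ‖v l‖ ^ 2)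
      (stdGaussian (EuclideanSpace ℝ (Fin n))) :=
    (integrable_finsetSum _ fun l _ => (integrable_inner_pow_four (v l)).div_const _).const_mul _
  refine (lintegral_mono fun ξ => ENNReal.ofReal_le_ofReal (sum_inner_sq_sq_le v ξ)).trans ?_
  rw [← ofReal_integral_eq_lintegral_ofReal hint (ae_of_all _ fun ξ => by positivity)]
  refine ENNReal.ofReal_le_ofReal (le_of_eq ?_)
  rw [integral_const_mul, integral_finsetSum _
    fun l _ => (integrable_inner_pow_four (v l)).div_const _]
  simp_rw [integral_div, integral_inner_pow_four]
  rw [sq, ← mul_assoc, mul_comm gaussFourth, mul_assoc, Finset.mul_sum _ _ gaussFourth]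
  congr 1
  refine Finset.sum_congr rfl fun l _ => ?_
  by_cases h : v l = 0
  · simp [h]
  · have : ‖v l‖ ≠ 0 := norm_ne_zero_iff.2 h
    field_simp

theorem lintegral_slab_sum_inner_sq {c : EuclideanSpace ℝ (Fin n)} (hc : ‖c‖ = 1) (R : ℝ)
    {N : ℕ} (v : Fin N → EuclideanSpace ℝ (Fin n)) :
    ∫⁻ ξ in slab R c, ENNReal.ofReal (∑ l, inner ℝ (v l) ξ ^ 2)
      ∂stdGaussian (EuclideanSpace ℝ (Fin n)) =
      ENNReal.ofReal (slabSecond R * ∑ l, inner ℝ (v l) c ^ 2 +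
        slabMass R * (∑ l, ‖v l‖ ^ 2 - ∑ l, inner ℝ (v l) c ^ 2)) := by
  have hint : ∀ l, Integrable (fun ξ => inner ℝ (v l) ξ ^ 2)
      ((stdGaussian (EuclideanSpace ℝ (Fin n))).restrict (slab R c)) :=
    fun l => (integrable_inner_sq (v l)).restrict
  rw [← ofReal_integral_eq_lintegral_ofReal (integrable_finsetSum _ fun l _ => hint l)
    (ae_of_all _ fun ξ => by positivity), integral_finsetSum _ fun l _ => hint l]
  simp_rw [setIntegral_slab_inner_sq hc]
  rw [Finset.sum_add_distrib, ← Finset.mul_sum, ← Finset.mul_sum, Finset.sum_sub_distrib]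

end Gaussian

/-! ### Quadratic forms given by pseudo-expectations -/

theorem linForm_mul_linForm {n : ℕ} (ξ η : EuclideanSpace ℝ (Fin n)) :
    linForm ξ * linForm η = ∑ a, ∑ b, C (ξ a * η b) * (X a * X b) := by
  rw [linForm, linForm, Finset.sum_mul_sum]
  refine Finset.sum_congr rfl fun a _ => Finset.sum_congr rfl fun b _ => ?_
  rw [C_mul]; ring

theorem map_mul_linForm_mul_linForm {n : ℕ} (L : MvPolynomial (Fin n) ℝ →ₗ[ℝ] ℝ)
    (G : MvPolynomial (Fin n) ℝ) (ξ η : EuclideanSpace ℝ (Fin n)) :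
    L (G * (linForm ξ * linForm η)) = ∑ a, ∑ b, ξ a * η b * L (G * (X a * X b)) := by
  rw [linForm_mul_linForm, Finset.mul_sum, map_sum]
  refine Finset.sum_congr rfl fun a _ => ?_
  rw [Finset.mul_sum, map_sum]
  refine Finset.sum_congr rfl fun b _ => ?_
  rw [← mul_assoc, mul_comm G, mul_assoc, ← smul_eq_C_mul, map_smul, smul_eq_mul]

theorem linForm_single {n : ℕ} (a : Fin n) :
    linForm (EuclideanSpace.single a (1 : ℝ)) = X a := by
  classical
  rw [linForm, Finset.sum_eq_single a]
  · simp
  · intro b _ hb; simp [hb]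
  · simp

/-- The quadratic form `ξ ↦ L (G * ⟨ξ, u⟩ ^ 2)` is a sum of squares of linear forms. -/
theorem exists_rows {n d : ℕ} {L : MvPolynomial (Fin n) ℝ →ₗ[ℝ] ℝ}
    (hL : IsPseudoExpectation (2 * d) L) {G : MvPolynomial (Fin n) ℝ} (hG : IsSumSq G)
    (hd : G.totalDegree + 2 ≤ 2 * d) :
    ∃ (N : ℕ) (v : Fin N → EuclideanSpace ℝ (Fin n)),
      (∀ ξ η, L (G * (linForm ξ * linForm η)) = ∑ l, inner ℝ (v l) ξ * inner ℝ (v l) η) ∧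
      L (G * normSq n) = ∑ l, ‖v l‖ ^ 2 := by
  have hA : (Matrix.of fun a b => L (G * (X a * X b))).PosSemidef := by
    refine Matrix.PosSemidef.of_dotProduct_mulVec_nonneg ?_ fun x => ?_
    · ext a b
      simp [Matrix.conjTranspose_apply, mul_comm]
    · have h := hL.nonneg_of_isSumSq (hG.mul (isSumSq_pow_two (linForm (WithLp.toLp 2 x))))
        ((totalDegree_mul_le_add le_rfl (totalDegree_linForm_sq_le _)).trans hd)
      rw [sq, map_mul_linForm_mul_linForm] at h
      refine h.trans_eq ?_
      simp only [dotProduct, Matrix.mulVec, Finset.mul_sum, Matrix.of_apply, Pi.star_apply,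
        star_trivial]
      refine Finset.sum_congr rfl fun a _ => Finset.sum_congr rfl fun b _ => ?_
      ring
  obtain ⟨N, B, hB⟩ := Matrix.posSemidef_iff_eq_sum_vecMulVec.1 hA
  have key : ∀ ξ η, L (G * (linForm ξ * linForm η)) =
      ∑ l, inner ℝ (WithLp.toLp 2 (B l) : EuclideanSpace ℝ (Fin n)) ξ *
        inner ℝ (WithLp.toLp 2 (B l) : EuclideanSpace ℝ (Fin n)) η := by
    intro ξ η
    rw [map_mul_linForm_mul_linForm]
    have hab : ∀ a b, L (G * (X a * X b)) = ∑ l, B l a * B l b := fun a b => by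
      have := congrFun (congrFun hB a) b
      simpa [Matrix.sum_apply, Matrix.vecMulVec_apply] using this
    simp_rw [hab, PiLp.inner_apply, Finset.sum_mul_sum, Finset.mul_sum]
    simp only [RCLike.inner_apply, conj_trivial]
    rw [Finset.sum_congr rfl fun a _ => Finset.sum_comm, Finset.sum_comm]
    refine Finset.sum_congr rfl fun l _ => Finset.sum_congr rfl fun a _ =>
      Finset.sum_congr rfl fun b _ => ?_
    ring
  refine ⟨N, fun l => WithLp.toLp 2 (B l), key, ?_⟩
  rw [normSq, Finset.mul_sum, map_sum]
  simp_rw [EuclideanSpace.real_norm_sq_eq]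
  rw [Finset.sum_comm]
  refine Finset.sum_congr rfl fun a _ => ?_
  have := key (EuclideanSpace.single a 1) (EuclideanSpace.single a 1)
  rw [linForm_single, ← sq] at this
  rw [this]
  refine Finset.sum_congr rfl fun l _ => ?_
  rw [EuclideanSpace.inner_single_right]
  simp [sq]

theorem lintegral_map_mul_linForm_sq_sq_le {n d : ℕ} {L : MvPolynomial (Fin n) ℝ →ₗ[ℝ] ℝ}
    (hL : IsPseudoExpectation (2 * d) L) {G : MvPolynomial (Fin n) ℝ} (hG : IsSumSq G)
    (hd : G.totalDegree + 2 ≤ 2 * d) :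
    ∫⁻ ξ, ENNReal.ofReal (L (G * linForm ξ ^ 2) ^ 2) ∂stdGaussian (EuclideanSpace ℝ (Fin n)) ≤
      ENNReal.ofReal (gaussFourth * L (G * normSq n) ^ 2) := by
  obtain ⟨N, v, h1, h2⟩ := exists_rows hL hG hd
  simp_rw [h2, sq (linForm _), h1, ← sq (inner ℝ _ _)]
  exact lintegral_sum_inner_sq_sq_le v

/-- Origin of `tilt`: on the slab the direction `c` has second moment `slabSecond R`, the orthogonal
directions only `slabMass R`. -/
theorem lintegral_slab_map_mul_linForm_sq {n d : ℕ} {L : MvPolynomial (Fin n) ℝ →ₗ[ℝ] ℝ}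
    (hL : IsPseudoExpectation (2 * d) L) {G : MvPolynomial (Fin n) ℝ} (hG : IsSumSq G)
    (hd : G.totalDegree + 2 ≤ 2 * d) {c : EuclideanSpace ℝ (Fin n)} (hc : ‖c‖ = 1) {R : ℝ}
    (hR : slabSecond R ≠ 0) :
    ∫⁻ ξ in slab R c, ENNReal.ofReal (L (G * linForm ξ ^ 2))
      ∂stdGaussian (EuclideanSpace ℝ (Fin n)) =
      ENNReal.ofReal (slabSecond R * L (G * tilt (slabMass R / slabSecond R) c)) := by
  obtain ⟨N, v, h1, h2⟩ := exists_rows hL hG hd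
  have e : slabSecond R * L (G * tilt (slabMass R / slabSecond R) c) =
      slabSecond R * L (G * linForm c ^ 2) +
        slabMass R * (L (G * normSq n) - L (G * linForm c ^ 2)) := by
    rw [tilt, mul_add, map_add, mul_left_comm, ← smul_eq_C_mul, map_smul, smul_eq_mul, mul_sub,
      map_sub]
    field_simp
  rw [e, h2]
  simp_rw [sq (linForm _), h1, ← sq (inner ℝ _ _)]
  exact lintegral_slab_sum_inner_sq hc R v

/-! ### The slab constants -/

theorem sq_mul_slabMass_le {R : ℝ} (hR : 0 ≤ R) : R ^ 2 * slabMass R ≤ slabSecond R := by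
  rw [slabMass, slabSecond]
  have hint : IntegrableOn (fun x : ℝ => x ^ 2) (Set.Icc R (R + 1)) (gaussianReal 0 1) :=
    (memLp_id_gaussianReal 2).integrable_sq.integrableOn
  have h := setIntegral_mono_on (μ := gaussianReal 0 1) (s := Set.Icc R (R + 1))
    (f := fun _ => R ^ 2) (g := fun x => x ^ 2) (integrable_const _) hint measurableSet_Icc
    fun x hx => pow_le_pow_left₀ hR hx.1 2
  rw [setIntegral_const, smul_eq_mul] at h
  linarith

/-- The interval has length one and the density is smallest at its right end. -/
theorem slabMass_ge {R : ℝ} (hR : 0 ≤ R) :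
    Real.exp (-(R + 1) ^ 2 / 2) / √(2 * Real.pi) ≤ slabMass R := by
  rw [slabMass, Measure.real, gaussianReal_apply_eq_integral _ (by simp),
    ENNReal.toReal_ofReal (integral_nonneg fun x => gaussianPDFReal_nonneg _ _ _)]
  have h := setIntegral_mono_on (μ := volume) (s := Set.Icc R (R + 1))
    (f := fun _ => Real.exp (-(R + 1) ^ 2 / 2) / √(2 * Real.pi)) (g := gaussianPDFReal 0 1)
    (by simp) (integrable_gaussianPDFReal 0 1).integrableOn measurableSet_Icc
    fun x hx => by
      rw [gaussianPDFReal, div_eq_inv_mul]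
      simp only [NNReal.coe_one, mul_one, sub_zero]
      gcongr
      · linarith [hx.1]
      · exact hx.2
  rw [setIntegral_const] at h
  simpa using h

/-! ### Functionals in terms of coefficients -/

theorem map_eq_sum_coeff_of_subset {σ : Type*} (L : MvPolynomial σ ℝ →ₗ[ℝ] ℝ)
    {P : MvPolynomial σ ℝ} {S : Finset (σ →₀ ℕ)} (hP : P.support ⊆ S) :
    L P = ∑ e ∈ S, P.coeff e * L (monomial e 1) := by
  conv_lhs => rw [P.as_sum]
  rw [map_sum, Finset.sum_subset hP]
  · refine Finset.sum_congr rfl fun e _ => ?_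
    rw [← mul_one (P.coeff e), ← smul_eq_mul, ← smul_monomial, map_smul, smul_eq_mul, smul_eq_mul,
      mul_one]
  · intro e _ he
    rw [notMem_support_iff.1 he, monomial_zero, map_zero]

/-- The exponents of degree at most `d`. -/
noncomputable def exponents (n d : ℕ) : Finset (Fin n →₀ ℕ) :=
  (Finsupp.finite_of_degree_le (σ := Fin n) d).toFinset

theorem support_subset_exponents_iff {n d : ℕ} {P : MvPolynomial (Fin n) ℝ} :
    P.support ⊆ exponents n d ↔ P.totalDegree ≤ d := by
  rw [totalDegree, Finset.sup_le_iff]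
  refine forall₂_congr fun e _ => ?_
  rw [exponents, Set.Finite.mem_toFinset]
  rfl

theorem map_eq_sum_coeff {n d : ℕ} (L : MvPolynomial (Fin n) ℝ →ₗ[ℝ] ℝ)
    {P : MvPolynomial (Fin n) ℝ} (hP : P.totalDegree ≤ d) :
    L P = ∑ e ∈ exponents n d, P.coeff e * L (monomial e 1) :=
  map_eq_sum_coeff_of_subset L (support_subset_exponents_iff.2 hP)

/-! ### Continuous dependence of polynomials on parameters, used for measurability. -/

section Continuity

variable {T : Type*} [TopologicalSpace T] {n : ℕ}

/-- The polynomial `F t` depends continuously on `t`, coefficient by coefficient. -/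
def ContinuousCoeff (F : T → MvPolynomial (Fin n) ℝ) : Prop :=
  ∀ e, Continuous fun t => (F t).coeff e

theorem ContinuousCoeff.mul {F G : T → MvPolynomial (Fin n) ℝ} (hF : ContinuousCoeff F)
    (hG : ContinuousCoeff G) : ContinuousCoeff fun t => F t * G t := by
  classical
  intro e
  simp_rw [coeff_mul]
  exact continuous_finsetSum _ fun x _ => (hF x.1).mul (hG x.2)

theorem continuousCoeff_const (P : MvPolynomial (Fin n) ℝ) :
    ContinuousCoeff fun _ : T => P := fun _ => continuous_const

theorem ContinuousCoeff.prod {ι : Type*} (s : Finset ι) {F : ι → T → MvPolynomial (Fin n) ℝ}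
    (hF : ∀ i, ContinuousCoeff (F i)) : ContinuousCoeff fun t => ∏ i ∈ s, F i t := by
  classical
  induction s using Finset.induction_on with
  | empty => simpa using continuousCoeff_const 1
  | insert i s hi ih =>
    simp_rw [Finset.prod_insert hi]
    exact (hF i).mul ih

theorem continuousCoeff_linForm {f : T → EuclideanSpace ℝ (Fin n)} (hf : Continuous f) :
    ContinuousCoeff fun t => linForm (f t) := by
  intro e
  simp_rw [linForm, coeff_sum, coeff_C_mul]
  exact continuous_finsetSum _ fun i _ =>
    ((EuclideanSpace.proj (𝕜 := ℝ) i).continuous.comp hf).mul continuous_const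

theorem ContinuousCoeff.continuous_map {F : T → MvPolynomial (Fin n) ℝ} (hF : ContinuousCoeff F)
    {d : ℕ} (hd : ∀ t, (F t).totalDegree ≤ d) (L : MvPolynomial (Fin n) ℝ →ₗ[ℝ] ℝ) :
    Continuous fun t => L (F t) := by
  simp_rw [fun t => map_eq_sum_coeff L (hd t)]
  exact continuous_finsetSum _ fun e _ => (hF e).mul continuous_const

end Continuity

/-! ### Products of Gaussian linear forms -/

section Product

variable {n : ℕ}

/-- The polynomial `∏ ⟨ξ i, u⟩ ^ 2`. -/
noncomputable def formProd {m : ℕ} (ξ : Fin m → EuclideanSpace ℝ (Fin n)) :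
    MvPolynomial (Fin n) ℝ := ∏ i, linForm (ξ i) ^ 2

theorem isSumSq_formProd {m : ℕ} (ξ : Fin m → EuclideanSpace ℝ (Fin n)) :
    IsSumSq (formProd ξ) := by
  rw [formProd, Finset.prod_pow]
  exact isSumSq_pow_two _

theorem totalDegree_formProd_le {m : ℕ} (ξ : Fin m → EuclideanSpace ℝ (Fin n)) :
    (formProd ξ).totalDegree ≤ 2 * m := by
  refine (totalDegree_finsetProd _ _).trans ?_
  refine (Finset.sum_le_sum fun i _ => totalDegree_linForm_sq_le (ξ i)).trans ?_
  simp [mul_comm]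

theorem formProd_cons {m : ℕ} (η : EuclideanSpace ℝ (Fin n))
    (ξ : Fin m → EuclideanSpace ℝ (Fin n)) :
    formProd (Fin.cons η ξ : Fin (m + 1) → _) = linForm η ^ 2 * formProd ξ := by
  simp [formProd, Fin.prod_univ_succ]

theorem continuousCoeff_formProd (m : ℕ) :
    ContinuousCoeff fun ξ : Fin m → EuclideanSpace ℝ (Fin n) => formProd ξ := by
  refine ContinuousCoeff.prod _ fun i => ?_
  simp_rw [sq]
  exact (continuousCoeff_linForm (continuous_apply i)).mul
    (continuousCoeff_linForm (continuous_apply i))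

theorem continuous_map_mul_formProd (L : MvPolynomial (Fin n) ℝ →ₗ[ℝ] ℝ)
    (G : MvPolynomial (Fin n) ℝ) (m : ℕ) :
    Continuous fun ξ : Fin m → EuclideanSpace ℝ (Fin n) => L (G * formProd ξ) :=
  ((continuousCoeff_const G).mul (continuousCoeff_formProd m)).continuous_map
    (fun ξ => totalDegree_mul_le_add le_rfl (totalDegree_formProd_le ξ)) L

/-- Integration over `m + 1` variables, the first one last. -/
theorem lintegral_pi_cons {α : Type*} [MeasurableSpace α] (γ : Measure α) [SigmaFinite γ] {m : ℕ}
    {f : (Fin (m + 1) → α) → ENNReal} (hf : Measurable f) :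
    ∫⁻ ξ, f ξ ∂Measure.pi (fun _ => γ) =
      ∫⁻ η, ∫⁻ ξ, f (Fin.cons η ξ) ∂Measure.pi (fun _ : Fin m => γ) ∂γ := by
  have h := (measurePreserving_piFinSuccAbove (fun _ : Fin (m + 1) => γ) 0).symm
  refine (h.lintegral_comp hf).symm.trans
    ((lintegral_prod _ (hf.comp h.measurable).aemeasurable).trans ?_)
  refine lintegral_congr fun η => lintegral_congr fun ξ => congrArg f ?_
  simp [MeasurableEquiv.piFinSuccAbove, Fin.insertNthEquiv]

variable {d : ℕ} {L : MvPolynomial (Fin n) ℝ →ₗ[ℝ] ℝ}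

/-- Integrate one vector at a time: each independent factor `⟨ξ_i,u⟩²` turns into `slabSecond R`
times the tilt, while the others remain inside the sum of squares `G`. -/
theorem lintegral_slab_map_mul_formProd (hL : IsPseudoExpectation (2 * d) L)
    {c : EuclideanSpace ℝ (Fin n)} (hc : ‖c‖ = 1) {R : ℝ} (hR : 0 < slabSecond R) (m : ℕ)
    {G : MvPolynomial (Fin n) ℝ} (hG : IsSumSq G) (hd : G.totalDegree + 2 * m ≤ 2 * d) :
    ∫⁻ ξ, ENNReal.ofReal (L (G * formProd ξ)) ∂Measure.pi (fun _ : Fin m =>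
        (stdGaussian (EuclideanSpace ℝ (Fin n))).restrict (slab R c)) =
      ENNReal.ofReal (slabSecond R ^ m * L (G * tilt (slabMass R / slabSecond R) c ^ m)) := by
  set δ := slabMass R / slabSecond R with hδ
  have hδ0 : 0 ≤ δ := div_nonneg measureReal_nonneg hR.le
  induction m generalizing G with
  | zero => simp [formProd]
  | succ m ih =>
    have hm : Measurable fun ξ : Fin (m + 1) → EuclideanSpace ℝ (Fin n) =>
        ENNReal.ofReal (L (G * formProd ξ)) :=
      (continuous_map_mul_formProd L G (m + 1)).measurable.ennreal_ofReal
    rw [lintegral_pi_cons _ hm]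
    have hstep : ∀ η : EuclideanSpace ℝ (Fin n), ∫⁻ ξ, ENNReal.ofReal
        (L (G * formProd (Fin.cons η ξ : Fin (m + 1) → _))) ∂Measure.pi (fun _ : Fin m =>
        (stdGaussian (EuclideanSpace ℝ (Fin n))).restrict (slab R c)) =
        ENNReal.ofReal (slabSecond R ^ m) *
          ENNReal.ofReal (L (G * tilt δ c ^ m * linForm η ^ 2)) := fun η => by
      simp_rw [formProd_cons, ← mul_assoc]
      rw [ih (hG.mul (isSumSq_pow_two _)) (by
          have := totalDegree_mul_le_add (le_refl G.totalDegree) (totalDegree_linForm_sq_le η)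
          omega),
        ENNReal.ofReal_mul (by positivity), mul_right_comm G]
    simp_rw [hstep]
    have hdt := totalDegree_mul_le_add (le_refl G.totalDegree)
      (totalDegree_pow_le_mul (totalDegree_tilt_le δ c) m)
    rw [lintegral_const_mul' _ _ (by simp), lintegral_slab_map_mul_linForm_sq hL
      (hG.mul (isSumSq_pow (isSumSq_tilt hδ0 hc) m)) (by omega) hc hR.ne', ← hδ,
      ← ENNReal.ofReal_mul (by positivity)]
    congr 1
    rw [pow_succ, pow_succ]
    simp only [mul_assoc]

/-- Each vector costs one factor `gaussFourth` and replaces `⟨ξ_i,u⟩²` by `‖u‖²`, which is `1` on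
the sphere. -/
theorem lintegral_map_mul_formProd_sq_le (hL : IsPseudoExpectation (2 * d) L)
    (hC : SatisfiesConstraint (2 * d) L (normSq n - 1)) (m : ℕ)
    {G : MvPolynomial (Fin n) ℝ} (hG : IsSumSq G) (hd : G.totalDegree + 2 * m ≤ 2 * d) :
    ∫⁻ ξ, ENNReal.ofReal (L (G * formProd ξ) ^ 2) ∂Measure.pi (fun _ : Fin m =>
        stdGaussian (EuclideanSpace ℝ (Fin n))) ≤
      ENNReal.ofReal (gaussFourth ^ m * L G ^ 2) := by
  induction m generalizing G with
  | zero => simp [formProd]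
  | succ m ih =>
    have hm : Measurable fun ξ : Fin (m + 1) → EuclideanSpace ℝ (Fin n) =>
        ENNReal.ofReal (L (G * formProd ξ) ^ 2) :=
      ((continuous_map_mul_formProd L G (m + 1)).measurable.pow_const 2).ennreal_ofReal
    rw [lintegral_pi_cons _ hm]
    have hK := gaussFourth_nonneg
    have hstep : ∀ η : EuclideanSpace ℝ (Fin n), ∫⁻ ξ, ENNReal.ofReal
        (L (G * formProd (Fin.cons η ξ : Fin (m + 1) → _)) ^ 2) ∂Measure.pi (fun _ : Fin m =>
        stdGaussian (EuclideanSpace ℝ (Fin n))) ≤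
        ENNReal.ofReal (gaussFourth ^ m) * ENNReal.ofReal (L (G * linForm η ^ 2) ^ 2) := fun η => by
      simp_rw [formProd_cons, ← mul_assoc]
      rw [← ENNReal.ofReal_mul (by positivity)]
      exact ih (hG.mul (isSumSq_pow_two _)) (by
          have := totalDegree_mul_le_add (le_refl G.totalDegree) (totalDegree_linForm_sq_le η)
          omega)
    refine (lintegral_mono hstep).trans ?_
    rw [lintegral_const_mul' _ _ (by simp)]
    refine (mul_le_mul_right (lintegral_map_mul_linForm_sq_sq_le hL hG (by omega)) _).trans ?_
    rw [hC.map_mul_normSq (by omega), ← ENNReal.ofReal_mul (by positivity),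
      pow_succ gaussFourth, mul_assoc (gaussFourth ^ m)]

end Product

/-! ### A second moment bound -/

/-- A lower bound for the probability of `r * Y < X` from the moments of `0 ≤ X ≤ Y`, the first
ones with respect to a smaller measure. -/
theorem measure_lt_ge_of_moments {α : Type*} [MeasurableSpace α] {γ' γ : Measure α}
    (hγ : γ' ≤ γ) {X Y : α → ℝ} (hX : Measurable X) (hY : Measurable Y) (h0 : ∀ a, 0 ≤ X a)
    (hXY : ∀ a, X a ≤ Y a) {x y z r : ℝ} (hr : 0 ≤ r) (hy : 0 ≤ y) (hz : 0 ≤ z)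
    (hx' : ENNReal.ofReal x ≤ ∫⁻ a, ENNReal.ofReal (X a) ∂γ')
    (hy' : ∫⁻ a, ENNReal.ofReal (Y a) ∂γ' ≤ ENNReal.ofReal y)
    (hz' : ∫⁻ a, ENNReal.ofReal (Y a ^ 2) ∂γ ≤ ENNReal.ofReal z) {l : ℝ} (hl : 0 ≤ l) :
    ENNReal.ofReal (2 * l * (x - r * y) - l ^ 2 * z) ≤ γ {a | r * Y a < X a} := by
  set S := {a | r * Y a < X a} with hS
  have hSm : MeasurableSet S := measurableSet_lt (hY.const_mul r) hX
  -- Pointwise `2lX ≤ 1_S + l²Y² + 2lrY`: on `S` since `X ≤ Y` and `2lY ≤ 1 + l²Y²`, off `S` since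
  -- `X ≤ rY`.
  have hpt : ∀ a, ENNReal.ofReal (2 * l) * ENNReal.ofReal (X a) ≤
      S.indicator 1 a + (ENNReal.ofReal (l ^ 2) * ENNReal.ofReal (Y a ^ 2) +
        ENNReal.ofReal (2 * l * r) * ENNReal.ofReal (Y a)) := fun a => by
    have h1 := h0 a
    have h2 := hXY a
    rw [← ENNReal.ofReal_mul (by positivity), ← ENNReal.ofReal_mul (by positivity),
      ← ENNReal.ofReal_mul (by positivity),
      ← ENNReal.ofReal_add (by positivity) (mul_nonneg (by positivity) (h1.trans h2))]
    by_cases ha : a ∈ S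
    · rw [Set.indicator_of_mem ha, Pi.one_apply, ← ENNReal.ofReal_one, ← ENNReal.ofReal_add
        zero_le_one (add_nonneg (by positivity) (mul_nonneg (by positivity) (h1.trans h2)))]
      refine ENNReal.ofReal_le_ofReal ?_
      nlinarith [sq_nonneg (l * Y a - 1), mul_nonneg hl (sub_nonneg.2 h2),
        mul_nonneg (mul_nonneg hl hr) (h1.trans h2)]
    · rw [Set.indicator_of_notMem ha, zero_add]
      refine ENNReal.ofReal_le_ofReal ?_
      have : X a ≤ r * Y a := not_lt.1 ha
      nlinarith [mul_nonneg hl (sub_nonneg.2 this), sq_nonneg (l * Y a)]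
  have hint : ENNReal.ofReal (2 * l * x) ≤
      γ S + ENNReal.ofReal (l ^ 2 * z + 2 * l * r * y) := by
    calc ENNReal.ofReal (2 * l * x)
        = ENNReal.ofReal (2 * l) * ENNReal.ofReal x := ENNReal.ofReal_mul (by positivity)
      _ ≤ ENNReal.ofReal (2 * l) * ∫⁻ a, ENNReal.ofReal (X a) ∂γ' := by gcongr
      _ = ∫⁻ a, ENNReal.ofReal (2 * l) * ENNReal.ofReal (X a) ∂γ' :=
          (lintegral_const_mul' _ _ ENNReal.ofReal_ne_top).symm
      _ ≤ ∫⁻ a, (S.indicator 1 a + (ENNReal.ofReal (l ^ 2) * ENNReal.ofReal (Y a ^ 2) +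
            ENNReal.ofReal (2 * l * r) * ENNReal.ofReal (Y a))) ∂γ' := lintegral_mono hpt
      _ = γ' S + (ENNReal.ofReal (l ^ 2) * ∫⁻ a, ENNReal.ofReal (Y a ^ 2) ∂γ' +
            ENNReal.ofReal (2 * l * r) * ∫⁻ a, ENNReal.ofReal (Y a) ∂γ') := by
          rw [lintegral_add_left (measurable_one.indicator hSm), lintegral_indicator_one hSm,
            lintegral_add_left ((hY.pow_const 2).ennreal_ofReal.const_mul _),
            lintegral_const_mul' _ _ ENNReal.ofReal_ne_top,
            lintegral_const_mul' _ _ ENNReal.ofReal_ne_top]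
      _ ≤ γ S + (ENNReal.ofReal (l ^ 2) * ENNReal.ofReal z +
            ENNReal.ofReal (2 * l * r) * ENNReal.ofReal y) := by
          have h2 : ∫⁻ a, ENNReal.ofReal (Y a ^ 2) ∂γ' ≤ ENNReal.ofReal z :=
            (lintegral_mono' hγ le_rfl).trans hz'
          have h3 := hγ S
          gcongr
      _ = γ S + ENNReal.ofReal (l ^ 2 * z + 2 * l * r * y) := by
          rw [ENNReal.ofReal_add (by positivity) (by positivity),
            ENNReal.ofReal_mul (sq_nonneg l), ENNReal.ofReal_mul (by positivity : 0 ≤ 2 * l * r)]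
  have e : 2 * l * (x - r * y) - l ^ 2 * z = 2 * l * x - (l ^ 2 * z + 2 * l * r * y) := by ring
  rw [e, ENNReal.ofReal_sub _ (by positivity)]
  exact tsub_le_iff_right.2 hint

/-- Integrate `(x² - 1)² ≥ 0`, the second moment being `1`. The exact value of the fourth moment
plays no role. -/
theorem one_le_gaussFourth : 1 ≤ gaussFourth := by
  have hm := memLp_id_gaussianReal (μ := 0) (v := 1) 4
  have i4 : Integrable (fun x : ℝ => x ^ 4) (gaussianReal 0 1) := by
    have := hm.integrable_norm_pow (p := 4) (by simp)
    refine this.congr (ae_of_all _ fun x => ?_)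
    simp only [Real.norm_eq_abs, id]
    exact Even.pow_abs (by decide) _
  have i2 : Integrable (fun x : ℝ => x ^ 2) (gaussianReal 0 1) :=
    (memLp_id_gaussianReal (μ := 0) (v := 1) 2).integrable_sq
  have e2 : ∫ x, x ^ 2 ∂gaussianReal 0 1 = 1 := by
    have h := variance_of_integral_eq_zero (μ := gaussianReal 0 1) (X := id)
      aemeasurable_id (by simp)
    rw [variance_id_gaussianReal] at h
    simpa using h.symm
  have h : 0 ≤ ∫ x, (x ^ 4 - (2 * x ^ 2 - 1)) ∂gaussianReal 0 1 :=
    integral_nonneg fun x => by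
      have : x ^ 4 - (2 * x ^ 2 - 1) = (x ^ 2 - 1) ^ 2 := by ring
      simp only [Pi.zero_apply, this]
      positivity
  have i1 : Integrable (fun x : ℝ => 2 * x ^ 2 - 1) (gaussianReal 0 1) :=
    (i2.const_mul 2).sub (integrable_const 1)
  rw [integral_sub i4 i1,
    integral_sub (i2.const_mul 2) (integrable_const 1), integral_const_mul, e2] at h
  simp only [integral_const, probReal_univ, smul_eq_mul] at h
  rw [gaussFourth]
  linarith

/-! ### The two random stages: concentrating weights, then one Gaussian vector. -/

section Stages

variable {n d : ℕ} {L : MvPolynomial (Fin n) ℝ →ₗ[ℝ] ℝ}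

/-- The probability that the weights concentrate the pseudo-distribution around `c`. -/
theorem measure_concentrated_ge (hL : IsPseudoExpectation (2 * d) L)
    (hC : SatisfiesConstraint (2 * d) L (normSq n - 1)) {c : EuclideanSpace ℝ (Fin n)}
    (hc : ‖c‖ = 1) {R : ℝ} (hR : 0 < slabSecond R) (m : ℕ) {W : MvPolynomial (Fin n) ℝ}
    (hW : IsSumSq W) (hd : W.totalDegree + 2 * m + 2 ≤ 2 * d) {r l : ℝ} (hr : 0 ≤ r)
    (hl : 0 ≤ l) :
    ENNReal.ofReal (2 * l * (slabSecond R ^ m *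
        L (W * tilt (slabMass R / slabSecond R) c ^ m * linForm c ^ 2) -
        r * (slabSecond R ^ m * L (W * tilt (slabMass R / slabSecond R) c ^ m))) -
        l ^ 2 * (gaussFourth ^ m * L W ^ 2)) ≤
      Measure.pi (fun _ : Fin m => stdGaussian (EuclideanSpace ℝ (Fin n)))
        {ξ | r * L (W * formProd ξ) < L (W * formProd ξ * linForm c ^ 2)} := by
  have hδ : 0 ≤ slabMass R / slabSecond R := div_nonneg measureReal_nonneg hR.le
  have hdp := totalDegree_mul_le_add (le_refl W.totalDegree) (totalDegree_linForm_sq_le c)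
  have hdf : ∀ ξ : Fin m → EuclideanSpace ℝ (Fin n),
      (W * formProd ξ).totalDegree ≤ W.totalDegree + 2 * m := fun ξ =>
    totalDegree_mul_le_add le_rfl (totalDegree_formProd_le ξ)
  have hcomm : ∀ ξ : Fin m → EuclideanSpace ℝ (Fin n),
      L (W * formProd ξ * linForm c ^ 2) = L (W * linForm c ^ 2 * formProd ξ) := fun ξ => by
    rw [mul_right_comm]
  -- First moments are taken only over vectors in the slab, where the weights favour `c`; the second
  -- moment is over all vectors.
  refine measure_lt_ge_of_moments
    (γ' := Measure.pi fun _ : Fin m =>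
      (stdGaussian (EuclideanSpace ℝ (Fin n))).restrict (slab R c)) ?_ ?_ ?_ ?_ ?_ hr ?_ ?_ ?_ ?_ ?_
    hl
  · rw [← Measure.restrict_pi_pi]
    exact Measure.restrict_le_self
  · simp_rw [hcomm]
    exact (continuous_map_mul_formProd L _ m).measurable
  · exact (continuous_map_mul_formProd L _ m).measurable
  · intro ξ
    refine hL.nonneg_of_isSumSq ((hW.mul (isSumSq_formProd ξ)).mul (isSumSq_pow_two _)) ?_
    have := totalDegree_mul_le_add (hdf ξ) (totalDegree_linForm_sq_le c)
    omega
  · intro ξ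
    refine map_mul_linForm_sq_le hL hC hc (hW.mul (isSumSq_formProd ξ)) ?_
    have := hdf ξ
    omega
  · refine mul_nonneg (by positivity) (hL.nonneg_of_isSumSq
      (hW.mul (isSumSq_pow (isSumSq_tilt hδ hc) m)) ?_)
    have := totalDegree_mul_le_add (le_refl W.totalDegree)
      (totalDegree_pow_le_mul (totalDegree_tilt_le (slabMass R / slabSecond R) c) m)
    omega
  · have := gaussFourth_nonneg
    positivity
  · simp_rw [hcomm]
    rw [lintegral_slab_map_mul_formProd hL hc hR m (hW.mul (isSumSq_pow_two _)) (by omega),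
      mul_right_comm W]
  · rw [lintegral_slab_map_mul_formProd hL hc hR m hW (by omega)]
  · exact lintegral_map_mul_formProd_sq_le hL hC m hW (by omega)

/-- The vector `A ξ` for the matrix `A` with entries `L (G * u_a * u_b)`. -/
noncomputable def momentVector (L : MvPolynomial (Fin n) ℝ →ₗ[ℝ] ℝ) (G : MvPolynomial (Fin n) ℝ)
    (ξ : EuclideanSpace ℝ (Fin n)) : EuclideanSpace ℝ (Fin n) :=
  WithLp.toLp 2 fun a => L (G * (X a * linForm ξ))

theorem inner_momentVector (L : MvPolynomial (Fin n) ℝ →ₗ[ℝ] ℝ) (G : MvPolynomial (Fin n) ℝ)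
    (ξ η : EuclideanSpace ℝ (Fin n)) :
    inner ℝ η (momentVector L G ξ) = L (G * (linForm η * linForm ξ)) := by
  rw [PiLp.inner_apply]
  have : linForm η * linForm ξ = ∑ a, C (η a) * (X a * linForm ξ) := by
    rw [linForm, Finset.sum_mul]
    exact Finset.sum_congr rfl fun a _ => mul_assoc _ _ _
  rw [this, Finset.mul_sum, map_sum]
  refine Finset.sum_congr rfl fun a _ => ?_
  rw [mul_left_comm, ← smul_eq_C_mul, map_smul]
  simp [momentVector, mul_comm]

theorem inner_momentVector_comm (L : MvPolynomial (Fin n) ℝ →ₗ[ℝ] ℝ) (G : MvPolynomial (Fin n) ℝ)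
    (ξ η : EuclideanSpace ℝ (Fin n)) :
    inner ℝ η (momentVector L G ξ) = inner ℝ (momentVector L G η) ξ := by
  rw [real_inner_comm ξ, inner_momentVector, inner_momentVector, mul_comm (linForm η)]

theorem norm_momentVector_sq (L : MvPolynomial (Fin n) ℝ →ₗ[ℝ] ℝ) (G : MvPolynomial (Fin n) ℝ)
    (ξ : EuclideanSpace ℝ (Fin n)) : ‖momentVector L G ξ‖ ^ 2 =
      ∑ a, inner ℝ (momentVector L G (EuclideanSpace.single a 1)) ξ ^ 2 := by
  rw [EuclideanSpace.real_norm_sq_eq]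
  refine Finset.sum_congr rfl fun a _ => ?_
  rw [← inner_momentVector_comm, EuclideanSpace.inner_single_left]
  simp

theorem lintegral_inner_sq (w : EuclideanSpace ℝ (Fin n)) :
    ∫⁻ ξ, ENNReal.ofReal (inner ℝ w ξ ^ 2) ∂stdGaussian (EuclideanSpace ℝ (Fin n)) =
      ENNReal.ofReal (‖w‖ ^ 2) := by
  rw [← ofReal_integral_eq_lintegral_ofReal (integrable_inner_sq w)
    (ae_of_all _ fun ξ => by positivity)]
  simp_rw [sq (inner ℝ w _)]
  rw [integral_inner_mul_inner_stdGaussian, real_inner_self_eq_norm_sq]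

theorem lintegral_sum_inner_sq {N : ℕ} (v : Fin N → EuclideanSpace ℝ (Fin n)) :
    ∫⁻ ξ, ENNReal.ofReal (∑ l, inner ℝ (v l) ξ ^ 2) ∂stdGaussian (EuclideanSpace ℝ (Fin n)) =
      ENNReal.ofReal (∑ l, ‖v l‖ ^ 2) := by
  simp_rw [ENNReal.ofReal_sum_of_nonneg fun l _ => sq_nonneg (inner ℝ (v l) _),
    ENNReal.ofReal_sum_of_nonneg fun l _ => sq_nonneg ‖v l‖]
  rw [lintegral_finsetSum _ fun l _ => ((measurable_inner_left (v l)).pow_const 2).ennreal_ofReal]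
  simp_rw [lintegral_inner_sq]

/-- The Frobenius norm of a positive semidefinite matrix is at most its trace, since `A_ab² ≤ A_aa
A_bb`. -/
theorem sum_norm_momentVector_sq_le (hL : IsPseudoExpectation (2 * d) L)
    {G : MvPolynomial (Fin n) ℝ} (hG : IsSumSq G) (hd : G.totalDegree + 2 ≤ 2 * d) :
    ∑ a, ‖momentVector L G (EuclideanSpace.single a 1)‖ ^ 2 ≤ L (G * normSq n) ^ 2 := by
  obtain ⟨N, v, h1, h2⟩ := exists_rows hL hG hd
  have hs : ∀ a b, inner ℝ (momentVector L G (EuclideanSpace.single a 1))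
      (EuclideanSpace.single b 1) = ∑ l, v l a * v l b := fun a b => by
    rw [← inner_momentVector_comm, inner_momentVector, h1]
    refine Finset.sum_congr rfl fun l _ => ?_
    rw [EuclideanSpace.inner_single_right, EuclideanSpace.inner_single_right]
    simp
  have hT : L (G * normSq n) = ∑ a, ∑ l, v l a ^ 2 := by
    rw [h2, Finset.sum_comm]
    simp_rw [EuclideanSpace.real_norm_sq_eq]
  have hab : ∀ a b, (∑ l, v l a * v l b) ^ 2 ≤ (∑ l, v l a ^ 2) * ∑ l, v l b ^ 2 := fun a b =>
    Finset.sum_mul_sq_le_sq_mul_sq _ _ _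
  rw [hT, sq, Finset.sum_mul_sum]
  refine Finset.sum_le_sum fun a _ => ?_
  rw [EuclideanSpace.real_norm_sq_eq]
  refine Finset.sum_le_sum fun b _ => ?_
  refine le_trans (le_of_eq ?_) (hab a b)
  rw [← hs, EuclideanSpace.inner_single_right]
  simp

theorem measurable_momentVector (L : MvPolynomial (Fin n) ℝ →ₗ[ℝ] ℝ) (G : MvPolynomial (Fin n) ℝ)
    (c : EuclideanSpace ℝ (Fin n)) :
    (Measurable fun ξ => inner ℝ c (momentVector L G ξ) ^ 2) ∧
      Measurable fun ξ => ‖momentVector L G ξ‖ ^ 2 := by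
  simp_rw [inner_momentVector_comm, norm_momentVector_sq]
  exact ⟨(measurable_inner_left _).pow_const 2,
    Finset.measurable_fun_sum _ fun a _ => (measurable_inner_left _).pow_const 2⟩

/-- The probability that the final vector is close to `c`. -/
theorem stdGaussian_close_ge (hL : IsPseudoExpectation (2 * d) L)
    (hC : SatisfiesConstraint (2 * d) L (normSq n - 1)) {c : EuclideanSpace ℝ (Fin n)}
    (hc : ‖c‖ = 1) {G : MvPolynomial (Fin n) ℝ} (hG : IsSumSq G)
    (hd : G.totalDegree + 2 ≤ 2 * d) {r s : ℝ} (hr : 0 ≤ r) (hs : 0 ≤ s) (hsr : s ≤ r ^ 2)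
    (h : r * L G < L (G * linForm c ^ 2)) :
    ENNReal.ofReal ((r ^ 2 - s) ^ 2 / gaussFourth) ≤
      stdGaussian (EuclideanSpace ℝ (Fin n))
        {ξ | s * ‖momentVector L G ξ‖ ^ 2 < inner ℝ c (momentVector L G ξ) ^ 2} := by
  have hK := one_le_gaussFourth
  have hG0 : 0 ≤ L G := hL.nonneg_of_isSumSq hG (by omega)
  have hle := map_mul_linForm_sq_le hL hC hc hG hd
  have hpos : 0 < L G := lt_of_lt_of_le ((mul_nonneg hr hG0).trans_lt h) hle
  obtain ⟨t, ht⟩ : ∃ t, t = L G := ⟨_, rfl⟩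
  obtain ⟨y, hy⟩ : ∃ y, y = ∑ a, ‖momentVector L G (EuclideanSpace.single a 1)‖ ^ 2 := ⟨_, rfl⟩
  have hy0 : 0 ≤ y := hy ▸ Finset.sum_nonneg fun a _ => sq_nonneg _
  have hyt : y ≤ t ^ 2 := by
    have := sum_norm_momentVector_sq_le hL hG hd
    rwa [hC.map_mul_normSq hd, ← hy, ← ht] at this
  -- `‖A c‖ ≥ ⟨c, A c⟩ = L (G ⟨c,u⟩²)`, because `c` is a unit vector.
  have hx : (r * t) ^ 2 ≤ ‖momentVector L G c‖ ^ 2 := by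
    rw [ht]
    refine pow_le_pow_left₀ (mul_nonneg hr hG0) ?_ 2
    have h1 := real_inner_le_norm c (momentVector L G c)
    rw [inner_momentVector, ← sq, hc, one_mul] at h1
    linarith
  rw [← ht] at hpos
  obtain ⟨hm1, hm2⟩ := measurable_momentVector L G c
  -- This `l` maximizes `2l (r² - s)t² - l² gaussFourth t⁴`.
  have hl : 0 ≤ (r ^ 2 - s) / (gaussFourth * t ^ 2) :=
    div_nonneg (sub_nonneg.2 hsr) (by positivity)
  have hXY : ∀ ξ, inner ℝ c (momentVector L G ξ) ^ 2 ≤ ‖momentVector L G ξ‖ ^ 2 := fun ξ => by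
    have := abs_real_inner_le_norm c (momentVector L G ξ)
    rw [hc, one_mul] at this
    rw [← sq_abs]
    exact pow_le_pow_left₀ (abs_nonneg _) this 2
  have m1 : ENNReal.ofReal (‖momentVector L G c‖ ^ 2) ≤
      ∫⁻ ξ, ENNReal.ofReal (inner ℝ c (momentVector L G ξ) ^ 2)
        ∂stdGaussian (EuclideanSpace ℝ (Fin n)) := by
    simp_rw [inner_momentVector_comm]
    rw [lintegral_inner_sq]
  have m2 : ∫⁻ ξ, ENNReal.ofReal (‖momentVector L G ξ‖ ^ 2)
      ∂stdGaussian (EuclideanSpace ℝ (Fin n)) ≤ ENNReal.ofReal y := by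
    simp_rw [norm_momentVector_sq]
    rw [lintegral_sum_inner_sq, hy]
  have m3 : ∫⁻ ξ, ENNReal.ofReal ((‖momentVector L G ξ‖ ^ 2) ^ 2)
      ∂stdGaussian (EuclideanSpace ℝ (Fin n)) ≤ ENNReal.ofReal (gaussFourth * y ^ 2) := by
    rw [hy]
    refine le_trans (le_of_eq ?_) (lintegral_sum_inner_sq_sq_le
      fun a => momentVector L G (EuclideanSpace.single a 1))
    exact lintegral_congr fun ξ => by rw [norm_momentVector_sq]
  have key := measure_lt_ge_of_moments (le_refl (stdGaussian (EuclideanSpace ℝ (Fin n))))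
    hm1 hm2 (fun ξ => sq_nonneg _) hXY hs hy0 (by positivity) m1 m2 m3 hl
  refine le_trans (ENNReal.ofReal_le_ofReal ?_) key
  have hy2 : y ^ 2 ≤ (t ^ 2) ^ 2 := pow_le_pow_left₀ hy0 hyt 2
  have h1 : (r ^ 2 - s) * t ^ 2 ≤ ‖momentVector L G c‖ ^ 2 - s * y := by
    nlinarith [mul_le_mul_of_nonneg_left hyt hs]
  have e : (r ^ 2 - s) ^ 2 / gaussFourth =
      2 * ((r ^ 2 - s) / (gaussFourth * t ^ 2)) * ((r ^ 2 - s) * t ^ 2) -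
        ((r ^ 2 - s) / (gaussFourth * t ^ 2)) ^ 2 * (gaussFourth * (t ^ 2) ^ 2) := by
    field_simp
    ring
  rw [e]
  gcongr

end Stages

/-! ### Random polynomials -/

section Mean

variable {Ω σ : Type*} [MeasurableSpace Ω] {μ : Measure Ω} {F : Ω → MvPolynomial σ ℝ}
  {P : MvPolynomial σ ℝ} {S : Finset (σ →₀ ℕ)}

theorem IsMean.support_subset (hF : IsMean μ F P) (hS : ∀ᵐ ω ∂μ, (F ω).support ⊆ S) :
    P.support ⊆ S := by
  intro e he
  by_contra hne
  refine mem_support_iff.1 he ?_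
  rw [← (hF e).2]
  refine integral_eq_zero_of_ae ?_
  filter_upwards [hS] with ω hω
  exact notMem_support_iff.1 fun h => hne (hω h)

theorem IsMean.integrable_map (hF : IsMean μ F P) (hS : ∀ᵐ ω ∂μ, (F ω).support ⊆ S)
    (L : MvPolynomial σ ℝ →ₗ[ℝ] ℝ) : Integrable (fun ω => L (F ω)) μ := by
  have : Integrable (fun ω => ∑ e ∈ S, (F ω).coeff e * L (monomial e 1)) μ :=
    integrable_finsetSum _ fun e _ => (hF e).1.mul_const _
  refine this.congr ?_
  filter_upwards [hS] with ω hω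
  exact (map_eq_sum_coeff_of_subset L hω).symm

theorem IsMean.integral_map (hF : IsMean μ F P) (hS : ∀ᵐ ω ∂μ, (F ω).support ⊆ S)
    (L : MvPolynomial σ ℝ →ₗ[ℝ] ℝ) : ∫ ω, L (F ω) ∂μ = L P := by
  have : ∫ ω, L (F ω) ∂μ = ∫ ω, ∑ e ∈ S, (F ω).coeff e * L (monomial e 1) ∂μ := by
    refine integral_congr_ae ?_
    filter_upwards [hS] with ω hω
    exact map_eq_sum_coeff_of_subset L hω
  rw [this, integral_finsetSum _ fun e _ => (hF e).1.mul_const _,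
    map_eq_sum_coeff_of_subset L (hF.support_subset hS)]
  exact Finset.sum_congr rfl fun e _ => by rw [integral_mul_const, (hF e).2]

end Mean

/-- The exponents of degree at most `d` in `u` and in `u'`. -/
noncomputable def biexponents (n d : ℕ) : Finset (Fin n ⊕ Fin n →₀ ℕ) :=
  (exponents n d ×ˢ exponents n d).map splitExponent.symm.toEquiv.toEmbedding

theorem mem_biexponents {n d : ℕ} {m : Fin n ⊕ Fin n →₀ ℕ} :
    m ∈ biexponents n d ↔ (splitExponent m).1.degree ≤ d ∧ (splitExponent m).2.degree ≤ d := by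
  rw [biexponents, Finset.mem_map_equiv, Finset.mem_product, exponents, Set.Finite.mem_toFinset,
    Set.Finite.mem_toFinset]
  rfl

theorem support_inU_mul_inU'_subset {n d : ℕ} {P Q : MvPolynomial (Fin n) ℝ}
    (hP : P.totalDegree ≤ d) (hQ : Q.totalDegree ≤ d) :
    (inU P * inU' Q).support ⊆ biexponents n d := by
  intro m hm
  rw [mem_support_iff, coeff_inU_mul_inU'] at hm
  rw [mem_biexponents]
  exact ⟨(le_totalDegree (mem_support_iff.2 (left_ne_zero_of_mul hm))).trans hP,
    (le_totalDegree (mem_support_iff.2 (right_ne_zero_of_mul hm))).trans hQ⟩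

/-! ### The second moment of the random polynomial. -/

section SecondMoment

variable {Ω : Type*} [MeasurableSpace Ω] {μ : Measure Ω} {n d D : ℕ}
  {W : Ω → MvPolynomial (Fin n) ℝ} {Wbar : MvPolynomial (Fin n) ℝ}
  {W₂ : MvPolynomial (Fin n ⊕ Fin n) ℝ}

theorem integrable_map_sq (hW : ∀ᵐ ω ∂μ, (W ω).totalDegree ≤ D)
    (h₂ : IsMean μ (fun ω => inU (W ω) * inU' (W ω)) W₂) (L : MvPolynomial (Fin n) ℝ →ₗ[ℝ] ℝ) :
    Integrable (fun ω => L (W ω) ^ 2) μ ∧ ∫ ω, L (W ω) ^ 2 ∂μ = tensorSquare L W₂ := by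
  have hS : ∀ᵐ ω ∂μ, (inU (W ω) * inU' (W ω)).support ⊆ biexponents n D := by
    filter_upwards [hW] with ω hω
    exact support_inU_mul_inU'_subset hω hω
  have e : ∀ ω, L (W ω) ^ 2 = tensorSquare L (inU (W ω) * inU' (W ω)) := fun ω => by
    rw [tensorSquare_inU_mul_inU', sq]
  simp_rw [e]
  exact ⟨h₂.integrable_map hS _, h₂.integral_map hS _⟩

/-- Evaluate `E W(u)W(u') ⪯ M W̄(u)W̄(u')` by `L ⊗ L`. The difference has small degree in `u` and in
`u'` separately, as nonnegativity requires. -/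
theorem tensorSquare_mean_le {L : MvPolynomial (Fin n) ℝ →ₗ[ℝ] ℝ}
    (hL : IsPseudoExpectation (2 * d) L) (hW : ∀ᵐ ω ∂μ, (W ω).totalDegree ≤ 2 * d)
    (h₁ : IsMean μ W Wbar) (h₂ : IsMean μ (fun ω => inU (W ω) * inU' (W ω)) W₂) {M : ℝ}
    (hM : SOSLe W₂ (C M * (inU Wbar * inU' Wbar))) :
    tensorSquare L W₂ ≤ M * L Wbar ^ 2 := by
  have hS : ∀ᵐ ω ∂μ, (inU (W ω) * inU' (W ω)).support ⊆ biexponents n (2 * d) := by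
    filter_upwards [hW] with ω hω
    exact support_inU_mul_inU'_subset hω hω
  have hWb : Wbar.totalDegree ≤ 2 * d := support_subset_exponents_iff.1
    (h₁.support_subset (by
      filter_upwards [hW] with ω hω
      exact support_subset_exponents_iff.2 hω))
  have b₂ : BidegreeLe (2 * d) W₂ := fun m hm =>
    mem_biexponents.1 (h₂.support_subset hS (mem_support_iff.2 hm))
  have bb : BidegreeLe (2 * d) (inU Wbar * inU' Wbar) := fun m hm =>
    mem_biexponents.1 (support_inU_mul_inU'_subset hWb hWb (mem_support_iff.2 hm))
  rw [bidegreeLe_iff] at b₂ bb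
  have h := tensorSquare_nonneg_of_isSumSq hL hM (bidegreeLe_iff.2 (by
    simp only [sub_eq_add_neg]
    exact ⟨(bb.1.C_mul M).add b₂.1.neg, (bb.2.C_mul M).add b₂.2.neg⟩))
  rw [map_sub, ← smul_eq_C_mul, map_smul, tensorSquare_inU_mul_inU', smul_eq_mul] at h
  linarith

end SecondMoment

/-! ### Product measures -/

/-- The success event need not be measurable in the product; passing to a measurable hull makes the
bound hold for the outer measure. -/
theorem lintegral_le_prod_measure {α β : Type*} [MeasurableSpace α] [MeasurableSpace β]
    {μ : Measure α} {ν : Measure β} [SFinite ν] (s : Set (α × β)) {f : α → ENNReal}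
    (h : ∀ᵐ a ∂μ, f a ≤ ν {b | (a, b) ∈ s}) : ∫⁻ a, f a ∂μ ≤ (μ.prod ν) s := by
  rw [← measure_toMeasurable s, Measure.prod_apply (measurableSet_toMeasurable _ _)]
  refine lintegral_mono_ae ?_
  filter_upwards [h] with a ha
  exact ha.trans (measure_mono fun b hb => subset_toMeasurable _ _ hb)

theorem pi_measure_eq_lintegral {α : Type*} [MeasurableSpace α] (γ : Measure α) [SigmaFinite γ]
    {m : ℕ} {T : Set (Fin (m + 1) → α)} (hT : MeasurableSet T) :
    Measure.pi (fun _ => γ) T =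
      ∫⁻ ξ, γ {η | Fin.cons η ξ ∈ T} ∂Measure.pi (fun _ : Fin m => γ) := by
  have h := (measurePreserving_piFinSuccAbove (fun _ : Fin (m + 1) => γ) 0).symm
  rw [← h.measure_preimage hT.nullMeasurableSet, Measure.prod_apply_symm (h.measurable hT)]
  refine lintegral_congr fun ξ => congrArg γ ?_
  ext η
  simp [MeasurableEquiv.piFinSuccAbove, Fin.insertNthEquiv]

theorem map_tapeLaw_comp {ι : Type*} [Fintype ι] (φ : ι → ℕ) (hφ : Function.Injective φ) :
    tapeLaw.map (fun g i => g (φ i)) = Measure.pi fun _ : ι => gaussianReal 0 1 := by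
  classical
  refine (Measure.pi_eq fun s hs => ?_).symm
  rw [Measure.map_apply (by fun_prop) (MeasurableSet.univ_pi hs), tapeLaw]
  let t : ℕ → Set ℝ := Function.extend φ s fun _ => Set.univ
  have ht : ∀ i, t (φ i) = s i := fun i => hφ.extend_apply _ _ _
  have e : (fun (g : ℕ → ℝ) i => g (φ i)) ⁻¹' Set.univ.pi s =
      ((Finset.univ.image φ : Finset ℕ) : Set ℕ).pi t := by
    ext g
    simp [Set.mem_pi, ht]
  rw [e, Measure.infinitePi_pi _ (fun j hj => by
    obtain ⟨i, -, rfl⟩ := Finset.mem_image.1 hj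
    rw [ht]
    exact hs i), Finset.prod_image fun _ _ _ _ h => hφ h]
  simp_rw [ht]

theorem measurable_gaussVectors (n k : ℕ) :
    Measurable fun (g : ℕ → ℝ) (l : Fin k) => gaussVector n k g l := by
  refine measurable_pi_lambda _ fun l => ?_
  unfold gaussVector
  exact (WithLp.measurable_toLp 2 _).comp (measurable_pi_lambda _ fun i => measurable_pi_apply _)

theorem map_tapeLaw_gaussVectors (n k : ℕ) :
    tapeLaw.map (fun g (l : Fin k) => gaussVector n k g l) =
      Measure.pi fun _ : Fin k => stdGaussian (EuclideanSpace ℝ (Fin n)) := by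
  -- Coordinate `i` of vector `l` is the draw number `i k + l`; distinct coordinates use distinct
  -- independent draws.
  have hinj : Function.Injective fun p : Fin k × Fin n => (p.2 : ℕ) * k + p.1 := by
    rintro ⟨l, i⟩ ⟨l', i'⟩ h
    simp only at h
    have hk : 0 < k := l.pos
    have h1 : (l : ℕ) = l' := by
      have := congrArg (· % k) h
      simpa [Nat.add_mod, Nat.mod_eq_of_lt l.2, Nat.mod_eq_of_lt l'.2] using this
    rw [h1] at h
    have h2 : (i : ℕ) = i' := Nat.eq_of_mul_eq_mul_right hk (Nat.add_right_cancel h)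
    rw [Fin.ext h1, Fin.ext h2]
  have h1 := map_tapeLaw_comp _ hinj
  have h2 := Measure.infinitePi_map_curry (fun (_ : Fin k) (_ : Fin n) => gaussianReal 0 1)
  have h3 := Measure.infinitePi_map_pi
    (μ := fun _ : Fin k => Measure.infinitePi fun _ : Fin n => gaussianReal 0 1)
    (f := fun _ => WithLp.toLp 2) (fun _ => WithLp.measurable_toLp 2 _)
  rw [← h2, Measure.infinitePi_eq_pi, ← h1, Measure.map_map (by fun_prop) (by fun_prop),
    Measure.map_map (by fun_prop) (by fun_prop)] at h3
  simp_rw [Measure.infinitePi_eq_pi, map_pi_eq_stdGaussian] at h3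
  exact h3.trans (Measure.infinitePi_eq_pi _)

/-! ### The success probability -/

theorem ContinuousCoeff.comp {T T' : Type*} [TopologicalSpace T] [TopologicalSpace T'] {n : ℕ}
    {F : T → MvPolynomial (Fin n) ℝ} (hF : ContinuousCoeff F) {f : T' → T} (hf : Continuous f) :
    ContinuousCoeff fun t => F (f t) := fun e => (hF e).comp hf

theorem weight_gaussVector {n m : ℕ} (g : ℕ → ℝ) :
    weight (fun l => gaussVector n (m + 1) g (l + 1)) m =
      formProd (Fin.tail fun l : Fin (m + 1) => gaussVector n (m + 1) g l) := by
  rw [weight, formProd, Finset.prod_range]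
  rfl

theorem rawOutput_eq {n m : ℕ} (L : MvPolynomial (Fin n) ℝ →ₗ[ℝ] ℝ) {W : MvPolynomial (Fin n) ℝ}
    (hW : W.totalDegree ≤ 2 * (1 + (m + 1))) (g : ℕ → ℝ) :
    rawOutput n (m + 1) (momentArray (2 * (1 + 2 * (m + 1))) L)
        (coeffArray (2 * (1 + (m + 1))) W) g =
      momentVector L
        (W * formProd (Fin.tail fun l : Fin (m + 1) => gaussVector n (m + 1) g l))
        (gaussVector n (m + 1) g 0) := by
  rw [rawOutput, momentVector]
  congr 1
  ext a
  have h := rawVector_eq (m := m) L W (by omega) g a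
  rw [show 4 * (m + 1) + 2 = 2 * (1 + 2 * (m + 1)) by ring,
    show 2 * (m + 1) + 2 = 2 * (1 + (m + 1)) by ring] at h
  rw [h, weight_gaussVector, mul_comm (X a * _), mul_assoc]

theorem measurable_momentVector_formProd {n m : ℕ} (L : MvPolynomial (Fin n) ℝ →ₗ[ℝ] ℝ)
    (W : MvPolynomial (Fin n) ℝ) :
    Measurable fun Ξ : Fin (m + 1) → EuclideanSpace ℝ (Fin n) =>
      momentVector L (W * formProd (Fin.tail Ξ)) (Ξ 0) := by
  have htail : Continuous fun Ξ : Fin (m + 1) → EuclideanSpace ℝ (Fin n) => Fin.tail Ξ :=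
    continuous_pi fun i => continuous_apply i.succ
  refine (WithLp.measurable_toLp 2 _).comp (measurable_pi_lambda _ fun a => ?_)
  have hcc : ContinuousCoeff fun Ξ : Fin (m + 1) → EuclideanSpace ℝ (Fin n) =>
      W * formProd (Fin.tail Ξ) * (X a * linForm (Ξ 0)) :=
    ((continuousCoeff_const W).mul ((continuousCoeff_formProd m).comp htail)).mul
      ((continuousCoeff_const (X a)).mul (continuousCoeff_linForm (continuous_apply 0)))
  exact (hcc.continuous_map (fun Ξ => totalDegree_mul_le_add
    (totalDegree_mul_le_add le_rfl (totalDegree_formProd_le _))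
    (totalDegree_mul_le_add (totalDegree_X a).le (totalDegree_linForm_le _))) L).measurable

section Success

variable {n m : ℕ} {L : MvPolynomial (Fin n) ℝ →ₗ[ℝ] ℝ}

/-- The event that the algorithm succeeds with the parameter `s`. -/
def successSet (L : MvPolynomial (Fin n) ℝ →ₗ[ℝ] ℝ) (m : ℕ) (c : EuclideanSpace ℝ (Fin n)) (s : ℝ)
    (W : MvPolynomial (Fin n) ℝ) : Set (ℕ → ℝ) :=
  {g | s * ‖rawOutput n (m + 1) (momentArray (2 * (1 + 2 * (m + 1))) L)
        (coeffArray (2 * (1 + (m + 1))) W) g‖ ^ 2 <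
      inner ℝ c (rawOutput n (m + 1) (momentArray (2 * (1 + 2 * (m + 1))) L)
        (coeffArray (2 * (1 + (m + 1))) W) g) ^ 2}

/-- For fixed `W`, condition on the weight vectors: when they concentrate `u` around `c`, the
independent vector `ξ_0` succeeds with the probability of `stdGaussian_close_ge`, so the two bounds
multiply. -/
theorem tapeLaw_successSet_ge (hL : IsPseudoExpectation (2 * (1 + 2 * (m + 1))) L)
    (hC : SatisfiesConstraint (2 * (1 + 2 * (m + 1))) L (normSq n - 1))
    {c : EuclideanSpace ℝ (Fin n)} (hc : ‖c‖ = 1) {R : ℝ} (hR : 0 < slabSecond R)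
    {W : MvPolynomial (Fin n) ℝ} (hW : IsSumSq W) (hd : W.totalDegree ≤ 2 * (1 + (m + 1)))
    {r s l : ℝ} (hr : 0 ≤ r) (hs : 0 ≤ s) (hsr : s ≤ r ^ 2) (hl : 0 ≤ l) :
    ENNReal.ofReal ((r ^ 2 - s) ^ 2 / gaussFourth) *
      ENNReal.ofReal (2 * l * (slabSecond R ^ m *
        L (W * tilt (slabMass R / slabSecond R) c ^ m * linForm c ^ 2) -
        r * (slabSecond R ^ m * L (W * tilt (slabMass R / slabSecond R) c ^ m))) -
        l ^ 2 * (gaussFourth ^ m * L W ^ 2)) ≤ tapeLaw (successSet L m c s W) := by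
  set p₁ := ENNReal.ofReal ((r ^ 2 - s) ^ 2 / gaussFourth)
  let v : (Fin (m + 1) → EuclideanSpace ℝ (Fin n)) → EuclideanSpace ℝ (Fin n) := fun Ξ =>
    momentVector L (W * formProd (Fin.tail Ξ)) (Ξ 0)
  have hv : Measurable v := measurable_momentVector_formProd L W
  let T : Set (Fin (m + 1) → EuclideanSpace ℝ (Fin n)) :=
    {Ξ | s * ‖v Ξ‖ ^ 2 < inner ℝ c (v Ξ) ^ 2}
  have hT : MeasurableSet T := measurableSet_lt ((hv.norm.pow_const 2).const_mul s)
    (((measurable_inner_left c).comp hv).pow_const 2)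
  have hpre : (fun g (l : Fin (m + 1)) => gaussVector n (m + 1) g l) ⁻¹' T =
      successSet L m c s W := by
    ext g
    simp only [successSet, rawOutput_eq L hd g, Set.mem_ofPred_eq, Set.mem_preimage, T, v]
    rfl
  rw [← hpre, ← Measure.map_apply (measurable_gaussVectors n (m + 1)) hT,
    map_tapeLaw_gaussVectors, pi_measure_eq_lintegral _ hT]
  let S : Set (Fin m → EuclideanSpace ℝ (Fin n)) :=
    {ξ | r * L (W * formProd ξ) < L (W * formProd ξ * linForm c ^ 2)}
  have hS : MeasurableSet S := by
    refine measurableSet_lt ((continuous_map_mul_formProd L W m).measurable.const_mul r) ?_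
    simp only [mul_right_comm W _ (linForm c ^ 2)]
    exact (continuous_map_mul_formProd L _ m).measurable
  have hstage := measure_concentrated_ge hL hC hc hR m hW (by omega) hr hl
  calc _ ≤ p₁ * Measure.pi (fun _ : Fin m => stdGaussian (EuclideanSpace ℝ (Fin n))) S := by gcongr
    _ = ∫⁻ ξ, S.indicator (fun _ => p₁) ξ
        ∂Measure.pi (fun _ : Fin m => stdGaussian (EuclideanSpace ℝ (Fin n))) := by
        rw [lintegral_indicator_const hS]
    _ ≤ _ := by
        refine lintegral_mono fun ξ => ?_
        by_cases hξ : ξ ∈ S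
        · rw [Set.indicator_of_mem hξ]
          refine stdGaussian_close_ge hL hC hc (hW.mul (isSumSq_formProd ξ)) ?_ hr hs hsr hξ
          have := totalDegree_mul_le_add hd (totalDegree_formProd_le ξ)
          omega
        · rw [Set.indicator_of_notMem hξ]
          exact zero_le

theorem ofReal_integral_le_lintegral_ofReal {Ω : Type*} [MeasurableSpace Ω] {μ : Measure Ω}
    {f : Ω → ℝ} (hf : Integrable f μ) :
    ENNReal.ofReal (∫ ω, f ω ∂μ) ≤ ∫⁻ ω, ENNReal.ofReal (f ω) ∂μ := by
  rw [integral_eq_lintegral_pos_part_sub_lintegral_neg_part hf]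
  refine (ENNReal.ofReal_le_ofReal (sub_le_self _ ENNReal.toReal_nonneg)).trans ?_
  exact ENNReal.ofReal_toReal_le

/-- With `l` fixed, the bound for given `W` is affine in `L(W q^m p)`, `L(W q^m)` and `L(W)²`, so
its mean involves only `W̄` and the second moment. Polynomials `W` with a negative bound do no harm:
`ofReal` discards the negative part. -/
theorem prod_successSet_ge {Ω : Type*} [MeasurableSpace Ω] {μ : Measure Ω}
    [IsProbabilityMeasure μ] {W : Ω → MvPolynomial (Fin n) ℝ} {Wbar : MvPolynomial (Fin n) ℝ}
    {W₂ : MvPolynomial (Fin n ⊕ Fin n) ℝ} {M : ℝ}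
    (hL : IsPseudoExpectation (2 * (1 + 2 * (m + 1))) L)
    (hC : SatisfiesConstraint (2 * (1 + 2 * (m + 1))) L (normSq n - 1))
    {c : EuclideanSpace ℝ (Fin n)} (hc : ‖c‖ = 1) {R : ℝ} (hR : 0 < slabSecond R)
    (hW : ∀ᵐ ω ∂μ, IsSumSq (W ω) ∧ (W ω).totalDegree ≤ 2 * (1 + (m + 1)))
    (h₁ : IsMean μ W Wbar) (h₂ : IsMean μ (fun ω => inU (W ω) * inU' (W ω)) W₂)
    (hM : SOSLe W₂ (C M * (inU Wbar * inU' Wbar)))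
    {r s l : ℝ} (hr : 0 ≤ r) (hs : 0 ≤ s) (hsr : s ≤ r ^ 2) (hl : 0 ≤ l) :
    ENNReal.ofReal ((r ^ 2 - s) ^ 2 / gaussFourth) *
      ENNReal.ofReal (2 * l * (slabSecond R ^ m *
        L (Wbar * tilt (slabMass R / slabSecond R) c ^ m * linForm c ^ 2) -
        r * (slabSecond R ^ m * L (Wbar * tilt (slabMass R / slabSecond R) c ^ m))) -
        l ^ 2 * (gaussFourth ^ m * (M * L Wbar ^ 2))) ≤
      (μ.prod tapeLaw) {q | q.2 ∈ successSet L m c s (W q.1)} := by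
  have hdeg : ∀ᵐ ω ∂μ, (W ω).totalDegree ≤ 2 * (1 + (m + 1)) := hW.mono fun ω h => h.2
  have hS : ∀ᵐ ω ∂μ, (W ω).support ⊆ exponents n (2 * (1 + (m + 1))) :=
    hdeg.mono fun ω h => support_subset_exponents_iff.2 h
  let q := tilt (slabMass R / slabSecond R) c ^ m
  have hmul : ∀ Q P : MvPolynomial (Fin n) ℝ, L (P * Q) = (L ∘ₗ LinearMap.mulRight ℝ Q) P :=
    fun Q P => rfl
  have i1 : Integrable (fun ω => L (W ω * q * linForm c ^ 2)) μ := by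
    simp_rw [mul_assoc _ q, hmul]
    exact h₁.integrable_map hS _
  have e1 : ∫ ω, L (W ω * q * linForm c ^ 2) ∂μ = L (Wbar * q * linForm c ^ 2) := by
    simp_rw [mul_assoc _ q, hmul]
    exact h₁.integral_map hS _
  have i2 : Integrable (fun ω => L (W ω * q)) μ := by
    simp_rw [hmul]
    exact h₁.integrable_map hS _
  have e2 : ∫ ω, L (W ω * q) ∂μ = L (Wbar * q) := by
    simp_rw [hmul]
    exact h₁.integral_map hS _
  obtain ⟨i3, e3⟩ := integrable_map_sq hdeg h₂ L
  have hle := tensorSquare_mean_le hL (hdeg.mono fun ω h => by omega) h₁ h₂ hM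
  have j1 : Integrable (fun ω => slabSecond R ^ m * L (W ω * q * linForm c ^ 2) -
      r * (slabSecond R ^ m * L (W ω * q))) μ :=
    (i1.const_mul _).sub ((i2.const_mul _).const_mul _)
  have j2 : Integrable (fun ω => l ^ 2 * (gaussFourth ^ m * L (W ω) ^ 2)) μ :=
    (i3.const_mul _).const_mul _
  have hf : Integrable (fun ω => 2 * l * (slabSecond R ^ m * L (W ω * q * linForm c ^ 2) -
      r * (slabSecond R ^ m * L (W ω * q))) - l ^ 2 * (gaussFourth ^ m * L (W ω) ^ 2)) μ :=
    (j1.const_mul _).sub j2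
  have hint : ∫ ω, (2 * l * (slabSecond R ^ m * L (W ω * q * linForm c ^ 2) -
      r * (slabSecond R ^ m * L (W ω * q))) - l ^ 2 * (gaussFourth ^ m * L (W ω) ^ 2)) ∂μ =
      2 * l * (slabSecond R ^ m * L (Wbar * q * linForm c ^ 2) -
      r * (slabSecond R ^ m * L (Wbar * q))) - l ^ 2 * (gaussFourth ^ m * tensorSquare L W₂) := by
    rw [integral_sub (j1.const_mul _) j2, integral_const_mul,
      integral_sub (i1.const_mul _) ((i2.const_mul _).const_mul _), integral_const_mul, e1,
      integral_const_mul, integral_const_mul, e2, integral_const_mul, integral_const_mul, e3]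
  have hK := gaussFourth_nonneg
  have : IsProbabilityMeasure tapeLaw := by unfold tapeLaw; infer_instance
  refine le_trans (mul_le_mul_right (le_trans (ENNReal.ofReal_le_ofReal ?_)
    (ofReal_integral_le_lintegral_ofReal hf)) _) ?_
  · rw [hint]
    gcongr
  · rw [← lintegral_const_mul' _ _ ENNReal.ofReal_ne_top]
    refine lintegral_le_prod_measure _ ?_
    filter_upwards [hW] with ω hω
    exact tapeLaw_successSet_ge hL hC hc hR hω.1 hω.2 hr hs hsr hl

end Success

/-! ### Constants -/

/-- The gap is `e^(-bθ)(e^((b-a)θ) - 1) ≥ e^(-bθ) θ`. The number `7` bounds `θ`, since `ε, τ, 1/k ≤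
1`. -/
theorem exp_neg_sub_exp_neg_ge {ε θ a b : ℝ} (hε : ε ≤ θ) (hab : 1 ≤ b - a) (hε0 : 0 < ε)
    (hb : b * θ ≤ 7 * b) : Real.exp (-(7 * b)) * ε ≤ Real.exp (-(a * θ)) - Real.exp (-(b * θ)) := by
  have hθ : 0 < θ := hε0.trans_le hε
  have e : Real.exp (-(a * θ)) = Real.exp (-(b * θ)) * Real.exp ((b - a) * θ) := by
    rw [← Real.exp_add]; congr 1; ring
  have h1 : Real.exp (-(7 * b)) ≤ Real.exp (-(b * θ)) := Real.exp_le_exp.2 (by linarith)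
  have h2 : θ + 1 ≤ Real.exp ((b - a) * θ) :=
    (Real.add_one_le_exp θ).trans (Real.exp_le_exp.2 (by nlinarith))
  rw [e]
  nlinarith [Real.exp_pos (-(7 * b)), Real.exp_pos (-(b * θ)),
    mul_le_mul h1 hε hε0.le (Real.exp_pos _).le]

/-- Turns losses polynomial in `ε` into exponentials, so that all losses add up in one exponent. -/
theorem exp_neg_inv_le {ε : ℝ} (hε : 0 < ε) : Real.exp (-(1 / ε)) ≤ ε := by
  have h1 : 1 / ε ≤ Real.exp (1 / ε) := by linarith [Real.add_one_le_exp (1 / ε)]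
  rw [Real.exp_neg, inv_le_comm₀ (Real.exp_pos _) hε]
  simpa using h1

theorem slabMass_ge_exp {R : ℝ} (hR : 1 ≤ R) : Real.exp (-(2 * R ^ 2 + 1)) ≤ slabMass R := by
  refine le_trans ?_ (slabMass_ge (by linarith))
  rw [le_div_iff₀ (by positivity)]
  have hs : √(2 * Real.pi) ≤ Real.exp 1 := by
    rw [Real.sqrt_le_left (Real.exp_pos _).le]
    nlinarith [Real.exp_one_gt_d9, Real.pi_lt_d2]
  refine (mul_le_mul_of_nonneg_left hs (Real.exp_pos _).le).trans ?_
  rw [← Real.exp_add]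
  exact Real.exp_le_exp.2 (by nlinarith)

/-- The constant in the exponent of the success probability. -/
noncomputable def successConst : ℝ := 160 + Real.log gaussFourth + 4 * Real.exp 28

/-- The dominant term is `4 m R²` with `R² = e^28/ε²`, the price of `m` slabs at height `R`; all
other terms fit into the `160 + κ`. -/
theorem success_prob_exponent {ε κ B : ℝ} (hε : 0 < ε) (hε1 : ε ≤ 1) (hκ : 0 ≤ κ) (m : ℕ)
    (hB : B = 160 + κ + 4 * Real.exp 28) :
    2 * (49 + 1 / ε) + κ + (2 * (m * (2 * (Real.exp 14 / ε) ^ 2 + 1) + (21 + 1 / ε) +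
      7 * (m + 1 : ℕ)) + κ * m) ≤ B * ((m + 1 : ℕ) * (1 / ε) ^ 2) := by
  have h28 : Real.exp 14 ^ 2 = Real.exp 28 := by rw [← Real.exp_nat_mul]; norm_num
  have hx : 1 ≤ 1 / ε := by rw [le_div_iff₀ hε]; linarith
  rw [div_eq_mul_one_div (Real.exp 14), mul_pow, h28, hB]
  set x := 1 / ε
  have hE := Real.exp_pos 28
  have hx2 : x ≤ x ^ 2 := by nlinarith
  have hx3 : 1 ≤ x ^ 2 := by nlinarith
  have hm : (0 : ℝ) ≤ m := Nat.cast_nonneg m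
  push_cast
  set E := Real.exp 28
  have a1 : (m : ℝ) ≤ m * x ^ 2 := by nlinarith
  have a2 : κ ≤ κ * x ^ 2 := by nlinarith
  have a3 : κ * m ≤ κ * m * x ^ 2 := by nlinarith [mul_nonneg hκ hm]
  have a4 : 0 ≤ E * x ^ 2 := by positivity
  have a5 : 0 ≤ (m : ℝ) * x ^ 2 := by positivity
  nlinarith

theorem success_prob_ge {ε θ : ℝ} (hε : 0 < ε) (hε1 : ε ≤ 1) (hεθ : ε ≤ θ) (hθ : θ ≤ 7) (m : ℕ)
    {R : ℝ} (hR : R = Real.exp 14 / ε) {α ρ : ℝ} (hα : slabMass R ≤ α)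
    (hρ : Real.exp (-(2 * θ)) ≤ ρ) :
    Real.exp (-(successConst * ((m + 1 : ℕ) * (1 / ε) ^ 2))) ≤
      (Real.exp (-(3 * θ)) ^ 2 - Real.exp (-(7 * θ))) ^ 2 / gaussFourth *
        ((α ^ m * ((ρ - Real.exp (-(3 * θ))) * Real.exp (-(θ * (m + 1 : ℕ))))) ^ 2 /
          gaussFourth ^ m) := by
  have hK := one_le_gaussFourth
  have hK0 : 0 < gaussFourth := by linarith
  set κ := Real.log gaussFourth with hκdef
  have hκ : 0 ≤ κ := Real.log_nonneg hK
  have hexp : gaussFourth = Real.exp κ := (Real.exp_log hK0).symm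
  have hi := exp_neg_inv_le hε
  have h14 : 1 ≤ Real.exp 14 := Real.one_le_exp (by norm_num)
  have hR1 : 1 ≤ R := by rw [hR, le_div_iff₀ hε]; linarith
  have hα' : Real.exp (-(2 * R ^ 2 + 1)) ≤ α := (slabMass_ge_exp hR1).trans hα
  have h1 : Real.exp (-(49 + 1 / ε)) ≤ Real.exp (-(3 * θ)) ^ 2 - Real.exp (-(7 * θ)) := by
    have := exp_neg_sub_exp_neg_ge (a := 6) (b := 7) hεθ (by norm_num) hε (by linarith)
    rw [← Real.exp_nat_mul, show ((2 : ℕ) : ℝ) * -(3 * θ) = -(6 * θ) by push_cast; ring]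
    refine le_trans ?_ this
    rw [neg_add, Real.exp_add, show -(7 * 7 : ℝ) = -49 by norm_num]
    gcongr
  have h2 : Real.exp (-(21 + 1 / ε)) ≤ ρ - Real.exp (-(3 * θ)) := by
    have := exp_neg_sub_exp_neg_ge (a := 2) (b := 3) hεθ (by norm_num) hε (by linarith)
    refine le_trans ?_ (this.trans (by linarith))
    rw [neg_add, Real.exp_add, show -(7 * 3 : ℝ) = -21 by norm_num]
    gcongr
  have h3 : Real.exp (-(7 * (m + 1 : ℕ))) ≤ Real.exp (-(θ * (m + 1 : ℕ))) :=
    Real.exp_le_exp.2 (neg_le_neg (by gcongr))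
  calc Real.exp (-(successConst * ((m + 1 : ℕ) * (1 / ε) ^ 2)))
      ≤ Real.exp (-(2 * (49 + 1 / ε) + κ + (2 * (m * (2 * R ^ 2 + 1) + (21 + 1 / ε) +
          7 * (m + 1 : ℕ)) + κ * m))) := by
        refine Real.exp_le_exp.2 (neg_le_neg ?_)
        rw [hR]
        exact success_prob_exponent hε hε1 hκ m rfl
    _ = Real.exp (-(49 + 1 / ε)) ^ 2 / gaussFourth *
        ((Real.exp (-(2 * R ^ 2 + 1)) ^ m * (Real.exp (-(21 + 1 / ε)) *
          Real.exp (-(7 * (m + 1 : ℕ))))) ^ 2 / gaussFourth ^ m) := by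
        rw [hexp]
        simp only [← Real.exp_nat_mul, ← Real.exp_add, ← Real.exp_sub]
        congr 1
        push_cast
        ring
    _ ≤ _ := by
        have hα0 : 0 ≤ α := (Real.exp_pos _).le.trans hα'
        have hρ0 : 0 ≤ ρ - Real.exp (-(3 * θ)) := (Real.exp_pos _).le.trans h2
        gcongr

/-- `log 2 ≥ 1/2` accounts for the factor `2` in `hCB`, and `ε ^ C ≤ ε ^ 2` for `C ≥ 2`. -/
theorem two_rpow_le {ε : ℝ} (hε : 0 < ε) (hε1 : ε ≤ 1) {C k : ℕ} (hC : 2 ≤ C)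
    (hCB : 2 * successConst ≤ C) :
    Real.exp (successConst * (k * (1 / ε) ^ 2)) ≤ (2 : ℝ) ^ ((C * k : ℝ) / ε ^ C) := by
  rw [Real.rpow_def_of_pos two_pos]
  refine Real.exp_le_exp.2 ?_
  have h2 : 1 / 2 ≤ Real.log 2 := by linarith [Real.log_two_gt_d9]
  have hpow : (1 / ε) ^ 2 ≤ 1 / ε ^ C := by
    rw [one_div_pow]
    exact one_div_le_one_div_of_le (by positivity) (pow_le_pow_of_le_one hε.le hε1 hC)
  calc successConst * (k * (1 / ε) ^ 2) ≤ (1 / 2 * C) * (k * (1 / ε ^ C)) := by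
        gcongr
        linarith
    _ ≤ (Real.log 2 * C) * (k * (1 / ε ^ C)) := by gcongr
    _ = Real.log 2 * ((C * k : ℝ) / ε ^ C) := by ring

theorem tilt_ratio_le {R : ℝ} (hR : 1 ≤ R) (hpos : 0 < slabSecond R) :
    slabMass R / slabSecond R ≤ 1 / R := by
  have h := sq_mul_slabMass_le (zero_le_one.trans hR)
  have h0 : 0 ≤ slabMass R := measureReal_nonneg
  rw [div_le_div_iff₀ hpos (by linarith)]
  nlinarith

theorem slabMass_le_slabSecond {R : ℝ} (hR : 1 ≤ R) : slabMass R ≤ slabSecond R := by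
  have h := sq_mul_slabMass_le (zero_le_one.trans hR)
  have h0 : 0 ≤ slabMass R := measureReal_nonneg
  nlinarith [mul_nonneg (sub_nonneg.2 (one_le_pow₀ hR : 1 ≤ R ^ 2)) h0]

/-! ### Choice of the parameters and conclusion. -/

/-- The success probability over the random polynomial and the random tape. -/
theorem prod_successSet_ge_exp {n m : ℕ} {L : MvPolynomial (Fin n) ℝ →ₗ[ℝ] ℝ}
    {Ω : Type*} [MeasurableSpace Ω] {μ : Measure Ω}
    [IsProbabilityMeasure μ] {W : Ω → MvPolynomial (Fin n) ℝ} {Wbar : MvPolynomial (Fin n) ℝ}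
    {W₂ : MvPolynomial (Fin n ⊕ Fin n) ℝ} {M : ℝ}
    (hL : IsPseudoExpectation (2 * (1 + 2 * (m + 1))) L)
    (hC : SatisfiesConstraint (2 * (1 + 2 * (m + 1))) L (normSq n - 1))
    {c : EuclideanSpace ℝ (Fin n)} (hc : ‖c‖ = 1) {ε τ θ : ℝ} (hε0 : 0 < ε) (hε1 : ε ≤ 1)
    (hτ : 0 < τ)
    (hW : ∀ᵐ ω ∂μ, IsSumSq (W ω) ∧ (W ω).totalDegree ≤ 2 * (1 + (m + 1)))
    (h₁ : IsMean μ W Wbar) (h₂ : IsMean μ (fun ω => inU (W ω) * inU' (W ω)) W₂)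
    (hM : SOSLe W₂ (C M * (inU Wbar * inU' Wbar))) (hM0 : 0 < M)
    (hlow : SOSLe (linForm c ^ (2 * (1 + (m + 1)))) Wbar)
    (hup : SOSLe Wbar ((linForm c ^ 2 + C τ * normSq n) ^ (1 + (m + 1))))
    (hε : Real.exp (-(ε * (m + 1 : ℕ))) * L (linForm c ^ 2) ≤
      L (linForm c ^ (2 * (1 + 2 * (m + 1)))))
    (hτk : τ ^ (m + 1) ≤ L (linForm c ^ 2))
    (hθ : θ = ε + 3 * (1 / ((m + 1 : ℕ) : ℝ) + 1) * τ) (hτ1 : τ ≤ 1) :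
    ENNReal.ofReal (Real.exp (-(successConst * ((m + 1 : ℕ) * (1 / ε) ^ 2))) / M) ≤
      (μ.prod tapeLaw) {q | q.2 ∈ successSet L m c (Real.exp (-(7 * θ))) (W q.1)} := by
  have hk1 : 0 < 1 / ((m + 1 : ℕ) : ℝ) := by positivity
  have hk2 : 1 / ((m + 1 : ℕ) : ℝ) ≤ 1 := by
    rw [div_le_one (by positivity)]
    push_cast
    linarith [(Nat.cast_nonneg m : (0 : ℝ) ≤ m)]
  have hεθ : ε ≤ θ := by rw [hθ]; nlinarith [mul_pos hk1 hτ]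
  have hθ7 : θ ≤ 7 := by rw [hθ]; nlinarith [mul_nonneg (sub_nonneg.2 hk2) hτ.le]
  have h14 : 1 ≤ Real.exp 14 := Real.one_le_exp (by norm_num)
  -- Chosen so that `δ ≤ 1/R = e^(-14) ε`, which fits into the gap between `e^(-θ)` and `e^(-2θ)`.
  obtain ⟨R, hR⟩ : ∃ R, R = Real.exp 14 / ε := ⟨_, rfl⟩
  have hR1 : 1 ≤ R := by rw [hR, le_div_iff₀ hε0]; linarith
  have hα := slabMass_le_slabSecond hR1
  have hαpos : 0 < slabSecond R :=
    lt_of_lt_of_le (Real.exp_pos _) ((slabMass_ge_exp hR1).trans hα)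
  have hδle := tilt_ratio_le hR1 hαpos
  have hδ0 : 0 ≤ slabMass R / slabSecond R := div_nonneg measureReal_nonneg hαpos.le
  have hρ : Real.exp (-(2 * θ)) ≤ Real.exp (-θ) - slabMass R / slabSecond R := by
    have h := exp_neg_sub_exp_neg_ge (a := 1) (b := 2) hεθ (by norm_num) hε0 (by linarith)
    rw [one_mul] at h
    have e : 1 / R = Real.exp (-(7 * 2)) * ε := by
      rw [hR, Real.exp_neg]; norm_num; ring
    have := hδle.trans (e.le.trans h)
    linarith
  have hWdeg : Wbar.totalDegree ≤ 2 * (1 + (m + 1)) := support_subset_exponents_iff.1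
    (h₁.support_subset (hW.mono fun ω h => support_subset_exponents_iff.2 h.2))
  have hpos : 0 < L (linForm c ^ 2) := (pow_pos hτ _).trans_le hτk
  obtain ⟨hb0, hbm, hbp⟩ := mean_weight_bounds hL hC hc hτ.le hpos hτk hε hWdeg hlow hup hθ hδ0
  have hK := one_le_gaussFourth
  have hK0 : 0 < gaussFourth := by linarith
  obtain ⟨ρ, hρdef⟩ : ∃ ρ, ρ = Real.exp (-θ) - slabMass R / slabSecond R := ⟨_, rfl⟩
  rw [← hρdef] at hρ hbp
  have hr23 : Real.exp (-(3 * θ)) ≤ Real.exp (-(2 * θ)) := Real.exp_le_exp.2 (by linarith)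
  have hρr : 0 ≤ ρ - Real.exp (-(3 * θ)) := by linarith
  set b := L Wbar with hb
  set E := slabSecond R ^ m * ((ρ - Real.exp (-(3 * θ))) * Real.exp (-(θ * (m + 1 : ℕ)))) with hE
  have hE0 : 0 ≤ E := by positivity
  have hsr : Real.exp (-(7 * θ)) ≤ Real.exp (-(3 * θ)) ^ 2 := by
    rw [← Real.exp_nat_mul]
    exact Real.exp_le_exp.2 (by push_cast; linarith)
  -- The optimal `l` when the first-moment gap is `E b` and the second moment is `gaussFourth ^ m *
  -- M * b ^ 2`; the bound becomes `E² / (gaussFourth ^ m M)`.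
  have hl : 0 ≤ E / (gaussFourth ^ m * (M * b)) := by positivity
  have key := prod_successSet_ge hL hC hc hαpos hW h₁ h₂ hM (Real.exp_pos (-(3 * θ))).le
    (Real.exp_pos (-(7 * θ))).le hsr hl
  refine le_trans ?_ key
  rw [← ENNReal.ofReal_mul (by positivity)]
  refine ENNReal.ofReal_le_ofReal ?_
  have hmain : E * b ≤ slabSecond R ^ m *
      L (Wbar * tilt (slabMass R / slabSecond R) c ^ m * linForm c ^ 2) -
      Real.exp (-(3 * θ)) *
        (slabSecond R ^ m * L (Wbar * tilt (slabMass R / slabSecond R) c ^ m)) := by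
    calc E * b = slabSecond R ^ m * ((ρ - Real.exp (-(3 * θ))) *
          (Real.exp (-(θ * (m + 1 : ℕ))) * b)) := by rw [hE]; ring
      _ ≤ slabSecond R ^ m * ((ρ - Real.exp (-(3 * θ))) *
          L (Wbar * tilt (slabMass R / slabSecond R) c ^ m)) := by gcongr
      _ = slabSecond R ^ m * (ρ * L (Wbar * tilt (slabMass R / slabSecond R) c ^ m)) -
          Real.exp (-(3 * θ)) *
            (slabSecond R ^ m * L (Wbar * tilt (slabMass R / slabSecond R) c ^ m)) := by ring
      _ ≤ _ := by gcongr
  have hfin := success_prob_ge hε0 hε1 hεθ hθ7 m hR hα hρ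
  calc Real.exp (-(successConst * ((m + 1 : ℕ) * (1 / ε) ^ 2))) / M
      ≤ (Real.exp (-(3 * θ)) ^ 2 - Real.exp (-(7 * θ))) ^ 2 / gaussFourth *
        (E ^ 2 / gaussFourth ^ m) / M := by gcongr
    _ = (Real.exp (-(3 * θ)) ^ 2 - Real.exp (-(7 * θ))) ^ 2 / gaussFourth *
        (2 * (E / (gaussFourth ^ m * (M * b))) * (E * b) -
          (E / (gaussFourth ^ m * (M * b))) ^ 2 * (gaussFourth ^ m * (M * b ^ 2))) := by
        field_simp
        ring
    _ ≤ _ := by gcongr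

/-- On the success event the normalized vector is close to `c`. -/
theorem inner_normalize_sq_ge {n : ℕ} {c v : EuclideanSpace ℝ (Fin n)} {s : ℝ}
    (h : s * ‖v‖ ^ 2 < inner ℝ c v ^ 2) :
    v ≠ 0 ∧ s ≤ inner ℝ c (‖v‖⁻¹ • v) ^ 2 := by
  -- The strict inequality excludes the zero vector, for which the program returns a default.
  have hv : v ≠ 0 := by
    rintro rfl
    simp at h
  have hn : 0 < ‖v‖ := norm_pos_iff.2 hv
  refine ⟨hv, ?_⟩
  rw [inner_smul_right, mul_pow, inv_pow, ← div_eq_inv_mul, le_div_iff₀ (by positivity)]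
  exact h.le

theorem map_linForm_sq_le_one {n d : ℕ} {L : MvPolynomial (Fin n) ℝ →ₗ[ℝ] ℝ}
    (hL : IsPseudoExpectation (2 * d) L) (hC : SatisfiesConstraint (2 * d) L (normSq n - 1))
    (hd : 1 ≤ d) {c : EuclideanSpace ℝ (Fin n)} (hc : ‖c‖ = 1) : L (linForm c ^ 2) ≤ 1 := by
  have h := map_mul_linForm_sq_le hL hC hc (Q := 1) IsSumSq.one
    (by rw [totalDegree_one]; omega)
  rwa [one_mul, hL.map_one] at h

end SOSSampling

theorem mainTheorem5 :
    ∃ C : ℕ, ∀ k : ℕ, 1 ≤ k → ∃ p : SOSSampling.Prog,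
      -- running time, and the output is a unit vector
      (∀ n : ℕ, 1 ≤ n → ∀ (x y g : ℕ → ℝ),
        ∃ (t : ℕ) (s : SOSSampling.State),
          SOSSampling.Exec g p (SOSSampling.initState n x y) t s ∧
          t ≤ (n + 1) ^ (C * k) ∧ ‖SOSSampling.output n s‖ = 1) ∧
      -- success probability
      ∀ (n : ℕ) (ε τ M : ℝ), 0 < ε → ε ≤ 1 → 0 ≤ τ →
      ∀ c : EuclideanSpace ℝ (Fin n), ‖c‖ = 1 →
      -- the distribution over sum-of-squares polynomials
      ∀ {Ω : Type*} [MeasurableSpace Ω] (μ : MeasureTheory.Measure Ω)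
        [MeasureTheory.IsProbabilityMeasure μ] (W : Ω → MvPolynomial (Fin n) ℝ)
        (Wbar : MvPolynomial (Fin n) ℝ) (W₂ : MvPolynomial (Fin n ⊕ Fin n) ℝ),
        (∀ᵐ ω ∂μ, IsSumSq (W ω) ∧ (W ω).totalDegree ≤ 2 * (1 + k)) →
        SOSSampling.IsMean μ W Wbar →
        SOSSampling.IsMean μ (fun ω => SOSSampling.inU (W ω) * SOSSampling.inU' (W ω)) W₂ →
        SOSSampling.SOSLe W₂
          (MvPolynomial.C M * (SOSSampling.inU Wbar * SOSSampling.inU' Wbar)) →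
        SOSSampling.SOSLe (SOSSampling.linForm c ^ (2 * (1 + k))) Wbar →
        SOSSampling.SOSLe Wbar
          ((SOSSampling.linForm c ^ 2 + MvPolynomial.C τ * SOSSampling.normSq n) ^ (1 + k)) →
      -- the pseudo-distribution
      ∀ L : MvPolynomial (Fin n) ℝ →ₗ[ℝ] ℝ,
        SOSSampling.IsPseudoExpectation (2 * (1 + 2 * k)) L →
        SOSSampling.SatisfiesConstraint (2 * (1 + 2 * k)) L (SOSSampling.normSq n - 1) →
        Real.exp (-(ε * k)) * L (SOSSampling.linForm c ^ 2) ≤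
          L (SOSSampling.linForm c ^ (2 * (1 + 2 * k))) →
        τ ^ k ≤ L (SOSSampling.linForm c ^ 2) →
        ENNReal.ofReal (τ ^ 2 / (M * (2 : ℝ) ^ ((C * k : ℝ) / ε ^ C))) ≤
          (μ.prod SOSSampling.tapeLaw)
            {q : Ω × (ℕ → ℝ) | ∃ (t : ℕ) (s : SOSSampling.State),
              SOSSampling.Exec q.2 p
                (SOSSampling.initState n
                  (SOSSampling.momentArray (2 * (1 + 2 * k)) L)
                  (SOSSampling.coeffArray (2 * (1 + k)) (W q.1))) t s ∧
              Real.exp (-(C * (ε + 3 * (1 / (k : ℝ) + 1) * τ))) ≤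
                (inner ℝ c (SOSSampling.output n s)) ^ 2} := by
  obtain ⟨C₀, hC₀⟩ := exists_nat_ge (2 * SOSSampling.successConst)
  -- `20` is the exponent of the running time and also covers the `7` in `e^(-7θ)`; `C₀` serves the
  -- probability.
  obtain ⟨C, hC20, hCC₀⟩ : ∃ C : ℕ, 20 ≤ C ∧ C₀ ≤ C := ⟨max 20 C₀, le_max_left _ _, le_max_right _ _⟩
  refine ⟨C, fun k hk => ⟨SOSSampling.sampler k, fun n hn x y g => ?_, ?_⟩⟩
  · obtain ⟨t, ht, s, he, hs, -⟩ := SOSSampling.sampler_exec hn hk x y g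
    exact ⟨t, s, he, ht.trans (Nat.pow_le_pow_right (by omega) (Nat.mul_le_mul_right k hC20)), hs⟩
  intro n ε τ M hε0 hε1 hτ0 c hc Ω _ μ _ W Wbar W₂ hW h₁ h₂ hM hlow hup L hL hLC hε hτk
  obtain ⟨m, rfl⟩ : ∃ m, k = m + 1 := ⟨k - 1, by omega⟩
  -- A nonpositive bound is trivial; otherwise `M > 0` and `τ > 0`, whence `L ⟨c,u⟩² ≥ τ^k > 0`.
  by_cases hpos : τ ^ 2 / (M * (2 : ℝ) ^ ((C * (m + 1 : ℕ) : ℝ) / ε ^ C)) ≤ 0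
  · rw [ENNReal.ofReal_of_nonpos hpos]
    exact zero_le
  have h2pos : (0 : ℝ) < 2 ^ ((C * (m + 1 : ℕ) : ℝ) / ε ^ C) := Real.rpow_pos_of_pos two_pos _
  have hM0 : 0 < M := by
    by_contra hM0
    exact hpos (div_nonpos_of_nonneg_of_nonpos (sq_nonneg τ)
      (mul_nonpos_of_nonpos_of_nonneg (not_lt.1 hM0) h2pos.le))
  have hτ : 0 < τ := by
    refine lt_of_le_of_ne hτ0 fun h => hpos ?_
    rw [← h]
    simp
  have hn : 1 ≤ n := by
    rcases Nat.eq_zero_or_pos n with rfl | hn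
    · rw [Subsingleton.elim c 0, norm_zero] at hc
      exact absurd hc zero_ne_one
    · exact hn
  have hτ1 : τ ≤ 1 := by
    have := hτk.trans (SOSSampling.map_linForm_sq_le_one hL hLC (by omega) hc)
    exact (pow_le_one_iff_of_nonneg hτ0 (by omega)).1 this
  obtain ⟨θ, hθ⟩ : ∃ θ, θ = ε + 3 * (1 / ((m + 1 : ℕ) : ℝ) + 1) * τ := ⟨_, rfl⟩
  have hθ0 : 0 ≤ θ := by rw [hθ]; positivity
  have key := SOSSampling.prod_successSet_ge_exp hL hLC hc hε0 hε1 hτ hW h₁ h₂ hM hM0 hlow hup hε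
    hτk hθ hτ1
  refine le_trans (ENNReal.ofReal_le_ofReal ?_) (key.trans (measure_mono ?_))
  · have hrp := SOSSampling.two_rpow_le (k := m + 1) hε0 hε1 (by omega : 2 ≤ C)
      (hC₀.trans (Nat.cast_le.2 hCC₀))
    rw [mul_comm M, ← div_div]
    refine div_le_div_of_nonneg_right ?_ hM0.le
    rw [Real.exp_neg, div_le_iff₀ h2pos, ← div_eq_inv_mul, le_div_iff₀ (Real.exp_pos _)]
    -- The probability obtained carries no factor `τ²`, so `τ² ≤ 1` suffices.
    have : τ ^ 2 ≤ 1 := pow_le_one₀ hτ0 hτ1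
    nlinarith [Real.exp_pos (SOSSampling.successConst * ((m + 1 : ℕ) * (1 / ε) ^ 2))]
  · rintro ⟨ω, g⟩ hg
    obtain ⟨t, ht, s, he, hs, hout⟩ := SOSSampling.sampler_exec hn hk
      (SOSSampling.momentArray (2 * (1 + 2 * (m + 1))) L)
      (SOSSampling.coeffArray (2 * (1 + (m + 1))) (W ω)) g
    obtain ⟨hne, hge⟩ := SOSSampling.inner_normalize_sq_ge hg
    refine ⟨t, s, he, ?_⟩
    rw [hout hne, ← hθ]
    refine le_trans (Real.exp_le_exp.2 (neg_le_neg ?_)) hge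
    have : (7 : ℝ) ≤ C := by exact_mod_cast (by omega : 7 ≤ C)
    gcongr
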